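/- Let $n\ge 0$ and let $K_n$ be the transition matrix of the binary Burnside process on $C_2^n$ (the set of binary $n$-tuples), where $S_n$ permutes coordinates: $$K_n(x,y)=\frac1{|G_x|}\sum_{s\in G_x\cap G_y}\frac1{|X_s|},$$ with $G_x\le S_n$ the stabilizer of $x$ and $X_s$ the set of tuples fixed by $s$. It acts on $L(C_2^n)$, the space of complex functions on $C_2^n$, by $(K_nf)(x)=\sum_yK_n(x,y)f(y)$. For $S\subseteq\{1,\dots,n\}$ let $v_S\in L(C_2^n)$ be the indicator function of the tuple whose ones are exactly at the positions in $S$, identify $L(C_2^n)$ with $V^{\otimes n}$, $V=\mathbb C\text{-span}\{v_0,v_1\}$ (tensor product being concatenation of tuples), and let $\langle\cdot,\cdot\rangle_\pi$ be the Hermitian inner product with $\langle v_S,v_{S'}\rangle_\pi=\delta_{SS'}\frac{1}{(n+1)\binom n{|S|}}$. Let $w\in S_n$ act by $wv_S=v_{wS}$, let $s_{ir}$ be the transposition of $i$ and $r$, $s_j=s_{j,j+1}$, and put $$M_r=\sum_{i=1}^{r-1}s_{ir}\quad(1\le r\le n),\qquad \tau_j=s_j+(M_j-M_{j+1})^{-1}\quad(1\le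 j\le n-1)$$ as operators on $L(C_2^n)$. For $0\le m\le\lfloor n/2\rfloor$ and $0\le i,\ell\le n-2m$ let $$T^{(\ell)}_{m,n}(i)=\sum_{S\subseteq\{1,\dots,n-2m\},\,|S|=\ell}(-1)^{m+|S\cap\{1,\dots,i\}|}\binom{2m+\ell}{m+|S\cap\{1,\dots,i\}|},$$ $$g_T^{m,i}=(v_{01}-v_{10})^{\otimes m}\otimes\sum_{S\subseteq\{1,\dots,n-2m\},\,|S|=i}v_S,\qquad f_T^{m,\ell}=\sum_{i=0}^{n-2m}T^{(\ell)}_{m,n}(i)\,g_T^{m,i}.$$ For a standard Young tableau $Q$ of shape $(n-m,m)$ with second row $a_1<\dots<a_m$ (so $a_r\ge 2r$) let $$f_Q^{m,\ell}=\tau_Q^{(1)}\cdots\tau_Q^{(m)}f_T^{m,\ell},\qquad \tau_Q^{(r)}=\tau_{a_r-1}\cdots\tau_{2r+1}\tau_{2r}\ \ (=1\text{ if }a_r=2r),$$ $$\gamma_Q=\prod_{r=1}^m\ \prod_{t=2}^{a_r-2r+1}\frac{t^2-1}{t^2}.$$ Let $\beta_k=\frac1{2^{4k}}\binom{2k}k^2$.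 Then the operators $M_j-M_{j+1}$, $1\le j\le n-1$, are invertible (so that the $\tau_j$ are well defined), and the family $f_Q^{m,\ell}$, indexed by all $0\le m\le\lfloor n/2\rfloor$, all standard Young tableaux $Q$ of shape $(n-m,m)$ and all $0\le\ell\le n-2m$, is an orthogonal basis of $L(C_2^n)$ with respect to $\langle\cdot,\cdot\rangle_\pi$. Each $f_Q^{m,\ell}$ is an eigenvector of $K_n$, with eigenvalue $\beta_{(m+\ell)/2}$ if $m+\ell$ is even and $0$ otherwise, and $$\langle f_Q^{m,\ell},f_Q^{m,\ell}\rangle_\pi=\gamma_Q\,\langle f_T^{m,\ell},f_T^{m,\ell}\rangle_\pi=\gamma_Q\,\frac{2^m}{n+1}\sum_{i=0}^{n-2m}\bigl(T^{(\ell)}_{m,n}(i)\bigr)^2\frac{\binom{n-2m}{i}}{\binom n{m+i}}.$$ -/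

import Mathlib

namespace BinaryBurnside

noncomputable section

/-! The binary Burnside process -/

/-- The state space `C_2^n` of binary `n`-tuples (`true` is `1`, `false` is `0`).
The coordinates `1, …, n` are the elements `0, …, n - 1` of `Fin n`. -/
abbrev Cube (n : ℕ) : Type := Fin n → Bool

/-- The number of ones of a binary tuple. -/
def ones {n : ℕ} (x : Cube n) : ℕ := (Finset.univ.filter fun i => x i = true).card

/-- `S_n` acts on `C_2^n` by permuting coordinates: `x` is fixed by `s`. -/
def Fixes {n : ℕ} (s : Equiv.Perm (Fin n)) (x : Cube n) : Prop := x ∘ s = x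

instance {n : ℕ} (s : Equiv.Perm (Fin n)) (x : Cube n) : Decidable (Fixes s x) :=
  inferInstanceAs (Decidable (x ∘ s = x))

/-- The transition matrix `K_n(x, y) = 1 / |G_x| * ∑_{s ∈ G_x ∩ G_y} 1 / |X_s|` of the Burnside
process: from `x` choose `s` uniformly in the stabilizer `G_x ≤ S_n`, then choose `y` uniformly in
the set `X_s` of tuples fixed by `s`. -/
def burnsideMatrix (n : ℕ) : Matrix (Cube n) (Cube n) ℂ := fun x y =>
  1 / ((Finset.univ.filter fun s : Equiv.Perm (Fin n) => Fixes s x).card : ℂ) *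
    ∑ s ∈ Finset.univ.filter (fun s : Equiv.Perm (Fin n) => Fixes s x ∧ Fixes s y),
      1 / ((Finset.univ.filter fun z : Cube n => Fixes s z).card : ℂ)

/-- The space `L(C_2^n) = V^{⊗ n}` of complex functions on `C_2^n`. -/
abbrev L (n : ℕ) : Type := Cube n → ℂ

/-- `K_n` as an operator, `(K_n f)(x) = ∑_y K_n(x, y) f(y)`. -/
def burnsideOp (n : ℕ) : Module.End ℂ (L n) := (burnsideMatrix n).mulVecLin

/-- `⟨f, g⟩_π = ∑_x conj (f x) g(x) π(x)` with the stationary distribution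
`π(x) = 1 / ((n + 1) * binom(n, |x|))`. -/
def innerPi {n : ℕ} (f g : L n) : ℂ :=
  ∑ x : Cube n, (starRingEnd ℂ) (f x) * g x * (1 / (((n : ℂ) + 1) * (n.choose (ones x) : ℂ)))

/-- `β_k = binom(2k, k)^2 / 2^{4k}`. -/
def beta (k : ℕ) : ℂ := ((2 * k).choose k : ℂ) ^ 2 / 2 ^ (4 * k)

/-! Basis vectors and tensor products -/

/-- The basis vector `v_S`: the indicator function of the tuple whose ones are at `S`. -/
def vec {n : ℕ} (S : Finset (Fin n)) : L n := Pi.single (fun i => decide (i ∈ S)) 1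

/-- The tensor product `V^{⊗ a} × V^{⊗ b} → V^{⊗ (a + b)}`, i.e. concatenation of tuples. -/
def tensor {a b : ℕ} (f : L a) (g : L b) : L (a + b) := fun x =>
  f (fun i => x (Fin.castAdd b i)) * g (fun j => x (Fin.natAdd a j))

/-- `(v_{01} - v_{10})^{⊗ m}`. -/
def pairPower : (m : ℕ) → L (2 * m)
  | 0 => vec ∅
  | m + 1 => tensor (b := 2) (pairPower m) (vec {1} - vec {0})

/-- `T_{m,n}^{(ℓ)}(i) = ∑_{S ⊆ {1, …, n - 2m}, |S| = ℓ}
  (-1)^{m + |S ∩ {1, …, i}|} binom(2m + ℓ, m + |S ∩ {1, …, i}|)`. -/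
def tScalar (m n l i : ℕ) : ℂ :=
  ∑ S ∈ (Finset.Icc 1 (n - 2 * m)).powersetCard l,
    (-1) ^ (m + (S ∩ Finset.Icc 1 i).card) *
      ((2 * m + l).choose (m + (S ∩ Finset.Icc 1 i).card) : ℂ)

/-- `g_T^{m,i} = (v_{01} - v_{10})^{⊗ m} ⊗ ∑_{S ⊆ {1, …, n - 2m}, |S| = i} v_S`, for the column
reading tableau `T` of shape `(n - m, m)`. -/
def gT {n m : ℕ} (hm : m ≤ n / 2) (i : ℕ) : L n := fun x =>
  tensor (pairPower m)
    (∑ S ∈ (Finset.univ : Finset (Fin (n - 2 * m))).powersetCard i, vec S)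
    (fun k => x (Fin.cast (by omega) k))

/-- `f_T^{m,ℓ} = ∑_{i = 0}^{n - 2m} T_{m,n}^{(ℓ)}(i) g_T^{m,i}`. -/
def fT {n m : ℕ} (hm : m ≤ n / 2) (l : ℕ) : L n :=
  ∑ i ∈ Finset.range (n - 2 * m + 1), tScalar m n l i • gT hm i

/-! Jucys-Murphy elements and intertwiners -/

/-- The action of `S_n` on `L(C_2^n)`, with `w v_S = v_{wS}`. -/
def permOp {n : ℕ} (w : Equiv.Perm (Fin n)) : Module.End ℂ (L n) :=
  LinearMap.funLeft ℂ ℂ (fun x : Cube n => x ∘ w)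

theorem permOp_vec {n : ℕ} (w : Equiv.Perm (Fin n)) (S : Finset (Fin n)) :
    permOp w (vec S) = vec (S.map w.toEmbedding) := by
  funext x
  simp only [permOp, vec, LinearMap.funLeft_apply, Pi.single_apply]
  congr 1
  apply propext
  constructor
  · intro h
    funext i
    have := congrFun h (w.symm i)
    simpa using this
  · intro h
    funext i
    simp [h]

/-- The transposition of the coordinates `i, r ∈ {1, …, n}`. -/
def transp (n i r : ℕ) : Equiv.Perm (Fin n) :=
  if h : (1 ≤ i ∧ i ≤ n) ∧ (1 ≤ r ∧ r ≤ n) then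
    Equiv.swap ⟨i - 1, by omega⟩ ⟨r - 1, by omega⟩
  else 1

/-- The Jucys-Murphy element `M_r = ∑_{i = 1}^{r - 1} s_{ir}`, acting on `L(C_2^n)`. -/
def jm (n r : ℕ) : Module.End ℂ (L n) := ∑ i ∈ Finset.Ico 1 r, permOp (transp n i r)

/-- The intertwiner `τ_j = s_j + (M_j - M_{j+1})⁻¹`, with the inverse in the ring of operators. -/
def tau (n j : ℕ) : Module.End ℂ (L n) :=
  permOp (transp n j (j + 1)) + Ring.inverse (jm n j - jm n (j + 1))

/-! Standard Young tableaux of two-row shape -/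

/-- A standard Young tableau: a semistandard one in which each of the numbers `1, …, |μ|` is the
entry of exactly one cell. -/
def StandardTableau (μ : YoungDiagram) : Type :=
  {Q : SemistandardYoungTableau μ //
    Set.BijOn (fun c : ℕ × ℕ => Q c.1 c.2) (μ.cells : Set (ℕ × ℕ)) (Set.Icc 1 μ.card)}

/-- The Young diagram of shape `(n - m, m)`. -/
def twoRow {n m : ℕ} (hm : m ≤ n / 2) : YoungDiagram :=
  YoungDiagram.ofRowLens [n - m, m] (by
    rw [List.sortedGE_iff_pairwise]
    simp
    omega)

/-- `a_r`, for `1 ≤ r ≤ m`: the `r`-th entry of the second row (the row of index `1`). -/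
def secondRow {n m : ℕ} {hm : m ≤ n / 2} (Q : StandardTableau (twoRow hm)) (r : ℕ) : ℕ :=
  Q.1 1 (r - 1)

/-- `τ_{a-1} ⋯ τ_{2r+1} τ_{2r}`, which is `1` if `a = 2r`. -/
def tauStep (n a r : ℕ) : Module.End ℂ (L n) :=
  ((List.range' (2 * r) (a - 2 * r)).reverse.map (tau n)).prod

/-- `τ_Q = τ_Q^{(1)} ⋯ τ_Q^{(m)}` with `τ_Q^{(r)} = τ_{a_r - 1} ⋯ τ_{2r+1} τ_{2r}`. -/
def tauQ {n m : ℕ} {hm : m ≤ n / 2} (Q : StandardTableau (twoRow hm)) : Module.End ℂ (L n) :=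
  ((List.range' 1 m).map fun r => tauStep n (secondRow Q r) r).prod

/-- `γ_Q = ∏_{r = 1}^m ∏_{t = 2}^{a_r - 2r + 1} (t^2 - 1) / t^2`. -/
def gammaQ {n m : ℕ} {hm : m ≤ n / 2} (Q : StandardTableau (twoRow hm)) : ℂ :=
  ∏ r ∈ Finset.Icc 1 m, ∏ t ∈ Finset.Icc 2 (secondRow Q r - 2 * r + 1),
    (((t : ℂ) ^ 2 - 1) / (t : ℂ) ^ 2)

/-- `f_Q^{m,ℓ} = τ_Q f_T^{m,ℓ}`. -/
def fQ {n m : ℕ} {hm : m ≤ n / 2} (Q : StandardTableau (twoRow hm)) (l : ℕ) : L n :=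
  tauQ Q (fT hm l)

/-- The triples `(m, Q, ℓ)` with `0 ≤ m ≤ ⌊n/2⌋`, `Q` a standard Young tableau of shape
`(n - m, m)`, and `0 ≤ ℓ ≤ n - 2m`. -/
structure Index (n : ℕ) where
  m : ℕ
  hm : m ≤ n / 2
  Q : StandardTableau (twoRow hm)
  l : ℕ
  hl : l ≤ n - 2 * m

end

end BinaryBurnside

open BinaryBurnside

namespace BinaryBurnside

/-! ### The inner product -/

section Inner

variable {n : ℕ}

/-! Two commuting structures carry the proof: the Jucys-Murphy elements, which separate the tableaux
Q, and K_n, which for a fixed tableau acts as a triangular operator on polynomials in one variable.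

Tableau side. As a function of x, f_T^{m,ℓ} is Δ_m(x) φ(|x|), where Δ_m = ∏ (x_{2p+2} - x_{2p+1}) is
a Specht polynomial (`fT_eq`). The Garnir relation makes every such function a joint eigenvector of
the M_k, with the contents of the column reading tableau as eigenvalues (`hasContent_spechtFn`). For
D = M_j - M_{j+1}, the relation s_j D = -D s_j - 2 and self-adjointness give invertibility of D. On
joint eigenvectors where D acts as δ ≠ 0, τ_j exchanges the j-th and (j+1)-st eigenvalues and
multiplies inner products by 1 - 1/δ² (`HasContent.tau`, `HasContent.innerPi_tau`). Along the word
τ_Q the second row {2, 4, …, 2m} travels to {a_1, …, a_m}, and the factors multiply to γ_Q. Contents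
determine the second row (`eq_of_content_eq`), so different Q give orthogonal vectors.

Transition side. Since |X_s| is 2 to the number of cycles of s, the sum over G_x ∩ G_y is a product
of rising factorials of 1/2. These are arcsine moments: given independent arcsine variables p and q,
the y_i are independent Bernoulli variables with parameter p or q according to x_i
(`burnsideMatrix_eq_arcsine₂`). Hence K_n maps Δ_m binom(|x| - m, d) to E[(p - q)^{m+d}] times
itself plus terms of lower d (`burnsideOp_spechtFn`), and E[(p - q)^j] is β_{j/2} or 0
(`arcsine₂_sub_pow`). The T^{(ℓ)}(i) are Hahn polynomials: of degree at most ℓ in i, and orthogonal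
to lower degrees for the weight binom(n-2m, i) / binom(n, m+i) (`sum_hahnWeight_mul_eval`). As K_n
is self-adjoint and triangular, f_T is an eigenvector (`burnsideOp_fT`); K_n commutes with τ_Q, so
f_Q is one too.

Counting. Nonzero orthogonal vectors are independent, and a ballot recursion shows that there are
enough of them to fill dimension 2^n (`sum_ballots`). -/

theorem innerPi_add_left (f g h : L n) : innerPi (f + g) h = innerPi f h + innerPi g h := by
  simp only [innerPi, Pi.add_apply, map_add, add_mul, Finset.sum_add_distrib]

theorem innerPi_add_right (f g h : L n) : innerPi f (g + h) = innerPi f g + innerPi f h := by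
  simp only [innerPi, Pi.add_apply, mul_add, add_mul, Finset.sum_add_distrib]

theorem innerPi_smul_left (a : ℂ) (f g : L n) :
    innerPi (a • f) g = (starRingEnd ℂ) a * innerPi f g := by
  simp only [innerPi, Pi.smul_apply, smul_eq_mul, map_mul, Finset.mul_sum]
  exact Finset.sum_congr rfl fun x _ => by ring

theorem innerPi_smul_right (a : ℂ) (f g : L n) : innerPi f (a • g) = a * innerPi f g := by
  simp only [innerPi, Pi.smul_apply, smul_eq_mul, Finset.mul_sum]
  exact Finset.sum_congr rfl fun x _ => by ring

theorem innerPi_zero_left (g : L n) : innerPi 0 g = 0 := by simp [innerPi]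

theorem innerPi_zero_right (g : L n) : innerPi g 0 = 0 := by simp [innerPi]

theorem innerPi_neg_left (f g : L n) : innerPi (-f) g = -innerPi f g := by
  simp [innerPi]

theorem innerPi_neg_right (f g : L n) : innerPi f (-g) = -innerPi f g := by
  simp [innerPi]

theorem innerPi_sub_left (f g h : L n) : innerPi (f - g) h = innerPi f h - innerPi g h := by
  rw [sub_eq_add_neg, innerPi_add_left, innerPi_neg_left, sub_eq_add_neg]

theorem innerPi_sub_right (f g h : L n) : innerPi f (g - h) = innerPi f g - innerPi f h := by
  rw [sub_eq_add_neg, innerPi_add_right, innerPi_neg_right, sub_eq_add_neg]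

theorem innerPi_sum_left {ι : Type*} (s : Finset ι) (f : ι → L n) (g : L n) :
    innerPi (∑ i ∈ s, f i) g = ∑ i ∈ s, innerPi (f i) g := by
  classical
  induction s using Finset.induction_on with
  | empty => simp [innerPi_zero_left]
  | insert a s ha ih => rw [Finset.sum_insert ha, Finset.sum_insert ha, innerPi_add_left, ih]

theorem innerPi_sum_right {ι : Type*} (s : Finset ι) (f : L n) (g : ι → L n) :
    innerPi f (∑ i ∈ s, g i) = ∑ i ∈ s, innerPi f (g i) := by
  classical
  induction s using Finset.induction_on with
  | empty => simp [innerPi_zero_right]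
  | insert a s ha ih => rw [Finset.sum_insert ha, Finset.sum_insert ha, innerPi_add_right, ih]

theorem innerPi_conj_symm (f g : L n) : (starRingEnd ℂ) (innerPi f g) = innerPi g f := by
  simp only [innerPi, map_sum]
  refine Finset.sum_congr rfl fun x _ => ?_
  simp only [map_mul, map_div₀, map_add, map_natCast, map_one, Complex.conj_conj]
  ring

theorem ones_le (x : Cube n) : ones x ≤ n := by
  simpa [ones] using Finset.card_filter_le (Finset.univ : Finset (Fin n)) (fun i => x i = true)

theorem ones_comp (x : Cube n) (w : Equiv.Perm (Fin n)) : ones (x ∘ w) = ones x := by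
  unfold ones
  refine Finset.card_bij (fun i _ => w i) ?_ ?_ ?_
  · simp
  · intro a _ b _ h; exact w.injective h
  · intro b hb; exact ⟨w.symm b, by simpa using hb, by simp⟩

theorem innerPi_self_eq_zero {f : L n} (h : innerPi f f = 0) : f = 0 := by
  have hpos : ∀ x : Cube n, 0 < 1 / (((n : ℝ) + 1) * (n.choose (ones x) : ℝ)) := fun x => by
    have : 0 < n.choose (ones x) := Nat.choose_pos (ones_le x)
    positivity
  have hre : innerPi f f =
      ((∑ x : Cube n, Complex.normSq (f x) *
        (1 / (((n : ℝ) + 1) * (n.choose (ones x) : ℝ))) : ℝ) : ℂ) := by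
    simp only [innerPi]
    push_cast
    refine Finset.sum_congr rfl fun x _ => ?_
    rw [mul_comm ((starRingEnd ℂ) (f x)), Complex.mul_conj]
  rw [hre, Complex.ofReal_eq_zero, Finset.sum_eq_zero_iff_of_nonneg
    fun x _ => mul_nonneg (Complex.normSq_nonneg _) (hpos x).le] at h
  funext x
  have := h x (Finset.mem_univ x)
  rcases mul_eq_zero.1 this with h' | h'
  · exact Complex.normSq_eq_zero.1 h'
  · exact absurd h' (hpos x).ne'

end Inner

/-! ### The action of the symmetric group -/

section Perm

variable {n : ℕ}

@[simp] theorem permOp_apply (w : Equiv.Perm (Fin n)) (f : L n) (x : Cube n) :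
    permOp w f x = f (x ∘ w) := rfl

theorem permOp_mul (u v : Equiv.Perm (Fin n)) : permOp (u * v) = permOp u * permOp v := rfl

theorem innerPi_permOp (w : Equiv.Perm (Fin n)) (f g : L n) :
    innerPi (permOp w f) (permOp w g) = innerPi f g := by
  unfold innerPi
  refine Fintype.sum_equiv (Equiv.arrowCongr w.symm (Equiv.refl Bool)) _ _ fun x => ?_
  have : (Equiv.arrowCongr w.symm (Equiv.refl Bool)) x = x ∘ w := by
    funext i; simp
  rw [this, ones_comp]
  rfl

theorem transp_eq {i r : ℕ} (hi : 1 ≤ i ∧ i ≤ n) (hr : 1 ≤ r ∧ r ≤ n) :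
    transp n i r = Equiv.swap ⟨i - 1, by omega⟩ ⟨r - 1, by omega⟩ := by
  rw [transp, dif_pos ⟨hi, hr⟩]

theorem transp_mul_self (i r : ℕ) : transp n i r * transp n i r = 1 := by
  unfold transp
  split_ifs
  · exact Equiv.swap_mul_self _ _
  · rfl

theorem transp_val {i r k : ℕ} (hi : 1 ≤ i ∧ i ≤ n) (hr : 1 ≤ r ∧ r ≤ n) (hk : 1 ≤ k ∧ k ≤ n) :
    ((transp n i r ⟨k - 1, by omega⟩ : Fin n) : ℕ) = Equiv.swap i r k - 1 := by
  rw [transp_eq hi hr]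
  simp only [Equiv.swap_apply_def, Fin.mk.injEq]
  split_ifs <;> first | rfl | (exfalso; omega)

theorem swap_mem {a b i : ℕ} (ha : 1 ≤ a ∧ a ≤ n) (hb : 1 ≤ b ∧ b ≤ n) (hi : 1 ≤ i ∧ i ≤ n) :
    1 ≤ Equiv.swap a b i ∧ Equiv.swap a b i ≤ n := by
  rw [Equiv.swap_apply_def]; split_ifs <;> assumption

theorem transp_mul_transp {a b i k : ℕ} (ha : 1 ≤ a ∧ a ≤ n) (hb : 1 ≤ b ∧ b ≤ n)
    (hi : 1 ≤ i ∧ i ≤ n) (hk : 1 ≤ k ∧ k ≤ n) :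
    transp n a b * transp n i k =
      transp n (Equiv.swap a b i) (Equiv.swap a b k) * transp n a b := by
  rw [transp_eq hi hk, Equiv.mul_swap_eq_swap_mul, transp_eq (swap_mem ha hb hi) (swap_mem ha hb hk)]
  congr 2
  · exact Fin.ext (transp_val ha hb hi)
  · exact Fin.ext (transp_val ha hb hk)

theorem innerPi_transp (i r : ℕ) (f g : L n) :
    innerPi (permOp (transp n i r) f) g = innerPi f (permOp (transp n i r) g) := by
  rw [← innerPi_permOp (transp n i r) f, ← Module.End.mul_apply, ← permOp_mul, transp_mul_self]
  rfl

theorem innerPi_jm (r : ℕ) (f g : L n) : innerPi (jm n r f) g = innerPi f (jm n r g) := by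
  simp only [jm, LinearMap.sum_apply, innerPi_sum_left, innerPi_sum_right, innerPi_transp]

theorem permOp_transp_mul_self (i r : ℕ) :
    permOp (transp n i r) * permOp (transp n i r) = 1 := by
  rw [← permOp_mul, transp_mul_self]; rfl

/-! ### Commutation relations between s_j and the Jucys-Murphy elements. -/

theorem permOp_mul_jm_of_ne {j k : ℕ} (hj : 1 ≤ j) (hjn : j + 1 ≤ n) (hkn : k ≤ n)
    (h1 : k ≠ j) (h2 : k ≠ j + 1) :
    permOp (transp n j (j + 1)) * jm n k = jm n k * permOp (transp n j (j + 1)) := by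
  rw [jm, Finset.mul_sum, Finset.sum_mul]
  have key : ∀ i ∈ Finset.Ico 1 k, permOp (transp n j (j + 1)) * permOp (transp n i k) =
      permOp (transp n (Equiv.swap j (j + 1) i) k) * permOp (transp n j (j + 1)) := by
    intro i hi
    rw [Finset.mem_Ico] at hi
    rw [← permOp_mul, transp_mul_transp ⟨hj, by omega⟩ ⟨by omega, hjn⟩ ⟨hi.1, by omega⟩
      ⟨by omega, hkn⟩, Equiv.swap_apply_of_ne_of_ne h1 h2, permOp_mul]
  rw [Finset.sum_congr rfl key]
  refine Finset.sum_equiv (Equiv.swap j (j + 1)) (fun i => ?_) fun i _ => rfl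
  simp only [Finset.mem_Ico, Equiv.swap_apply_def]
  split_ifs <;> omega

/-- Conjugation by s_j turns each summand s_{ij} of M_j into s_{i,j+1}. The sum M_{j+1} has one more
summand, s_j itself, and s_j² = 1 accounts for the constant. -/
theorem permOp_mul_jm {j : ℕ} (hj : 1 ≤ j) (hjn : j + 1 ≤ n) :
    permOp (transp n j (j + 1)) * jm n j =
      jm n (j + 1) * permOp (transp n j (j + 1)) - 1 := by
  have key : ∀ i ∈ Finset.Ico 1 j, permOp (transp n j (j + 1)) * permOp (transp n i j) =
      permOp (transp n i (j + 1)) * permOp (transp n j (j + 1)) := by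
    intro i hi
    rw [Finset.mem_Ico] at hi
    rw [← permOp_mul, transp_mul_transp ⟨hj, by omega⟩ ⟨by omega, hjn⟩ ⟨hi.1, by omega⟩
      ⟨by omega, by omega⟩, Equiv.swap_apply_left,
      Equiv.swap_apply_of_ne_of_ne (by omega) (by omega), permOp_mul]
  rw [jm, jm, Finset.mul_sum, Finset.sum_congr rfl key, Finset.sum_Ico_succ_top hj, add_mul,
    permOp_transp_mul_self, Finset.sum_mul, add_sub_cancel_right]

theorem permOp_mul_jm_succ {j : ℕ} (hj : 1 ≤ j) (hjn : j + 1 ≤ n) :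
    permOp (transp n j (j + 1)) * jm n (j + 1) =
      jm n j * permOp (transp n j (j + 1)) + 1 := by
  have h := permOp_mul_jm hj hjn
  set s := permOp (transp n j (j + 1)) with hs
  have hss : s * s = 1 := permOp_transp_mul_self _ _
  calc s * jm n (j + 1) = s * (jm n (j + 1) * s - 1) * s + 1 := by
        rw [mul_sub, sub_mul, mul_one, hss, mul_assoc, mul_assoc, hss, mul_one]; abel
    _ = jm n j * s + 1 := by rw [← h, ← mul_assoc, hss, one_mul]

theorem permOp_mul_jm_sub {j : ℕ} (hj : 1 ≤ j) (hjn : j + 1 ≤ n) :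
    permOp (transp n j (j + 1)) * (jm n j - jm n (j + 1)) =
      -((jm n j - jm n (j + 1)) * permOp (transp n j (j + 1))) - 2 := by
  rw [mul_sub, permOp_mul_jm hj hjn, permOp_mul_jm_succ hj hjn, sub_mul, ← one_add_one_eq_two]
  abel

theorem innerPi_jm_sub (j k : ℕ) (f g : L n) :
    innerPi ((jm n j - jm n k) f) g = innerPi f ((jm n j - jm n k) g) := by
  simp only [LinearMap.sub_apply, innerPi_sub_left, innerPi_sub_right, innerPi_jm]

/-- Let D v = 0. Pairing s D v = -D s v - 2 v with v kills the first two terms, because D is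
self-adjoint, so ⟨v, v⟩ = 0. Injectivity suffices in finite dimension. -/
theorem isUnit_jm_sub {j : ℕ} (hj : 1 ≤ j) (hjn : j + 1 ≤ n) :
    IsUnit (jm n j - jm n (j + 1)) := by
  rw [LinearMap.isUnit_iff_ker_eq_bot, LinearMap.ker_eq_bot']
  intro v hv
  have h := congrArg (fun F : Module.End ℂ (L n) => innerPi (F v) v) (permOp_mul_jm_sub hj hjn)
  have h2 : ((2 : Module.End ℂ (L n)) v) = (2 : ℂ) • v := by
    rw [← one_add_one_eq_two, ← one_add_one_eq_two, add_smul, one_smul]; rfl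
  simp only [Module.End.mul_apply, LinearMap.sub_apply (-_), LinearMap.neg_apply, hv, map_zero,
    innerPi_zero_left, innerPi_sub_left, innerPi_neg_left, innerPi_jm_sub, innerPi_zero_right,
    h2, innerPi_smul_left] at h
  apply innerPi_self_eq_zero
  simpa using h

/-! ### Joint eigenvectors of the Jucys-Murphy elements -/

/-- `f` is a joint eigenvector of `M_1, …, M_n` with eigenvalues `c 1, …, c n`. -/
def HasContent (c : ℕ → ℤ) (f : L n) : Prop :=
  ∀ k, 1 ≤ k → k ≤ n → jm n k f = (c k : ℂ) • f

theorem HasContent.congr {c c' : ℕ → ℤ} {f : L n} (h : HasContent c f)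
    (hc : ∀ k, 1 ≤ k → k ≤ n → c k = c' k) : HasContent c' f := fun k h1 h2 => by
  rw [h k h1 h2, hc k h1 h2]

theorem HasContent.innerPi_eq_zero {c c' : ℕ → ℤ} {f g : L n} (hf : HasContent c f)
    (hg : HasContent c' g) {k : ℕ} (h1 : 1 ≤ k) (h2 : k ≤ n) (hne : c k ≠ c' k) :
    innerPi f g = 0 := by
  have h := innerPi_jm k f g
  rw [hf k h1 h2, hg k h1 h2, innerPi_smul_left, innerPi_smul_right, map_intCast,
    ← sub_eq_zero, ← sub_mul, mul_eq_zero] at h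
  refine h.resolve_left fun h => hne ?_
  exact_mod_cast sub_eq_zero.1 h

theorem HasContent.sub_apply {c : ℕ → ℤ} {f : L n} (hf : HasContent c f) {j : ℕ} (hj : 1 ≤ j)
    (hjn : j + 1 ≤ n) :
    (jm n j - jm n (j + 1)) f = ((c j - c (j + 1) : ℤ) : ℂ) • f := by
  rw [LinearMap.sub_apply, hf j hj (by omega), hf (j + 1) (by omega) hjn, ← sub_smul, Int.cast_sub]

theorem HasContent.tau_apply {c : ℕ → ℤ} {f : L n} (hf : HasContent c f) {j : ℕ} (hj : 1 ≤ j)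
    (hjn : j + 1 ≤ n) (hne : c j ≠ c (j + 1)) :
    tau n j f = permOp (transp n j (j + 1)) f + ((c j - c (j + 1) : ℤ) : ℂ)⁻¹ • f := by
  have hu := isUnit_jm_sub hj hjn
  have hc : ((c j - c (j + 1) : ℤ) : ℂ) ≠ 0 := by exact_mod_cast sub_ne_zero.2 hne
  rw [tau, LinearMap.add_apply]
  congr 1
  have h := congrArg (fun F : Module.End ℂ (L n) => F f) (Ring.inverse_mul_cancel _ hu)
  simp only [Module.End.mul_apply, hf.sub_apply hj hjn, map_smul, Module.End.one_apply] at h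
  rw [eq_inv_smul_iff₀ hc, h]

/-- The summand f/δ in τ_j f = s_j f + f/δ absorbs the ±1 by which s_j fails to exchange M_j and
M_{j+1}. The other M_k commute with s_j. -/
theorem HasContent.tau {c : ℕ → ℤ} {f : L n} (hf : HasContent c f) {j : ℕ} (hj : 1 ≤ j)
    (hjn : j + 1 ≤ n) (hne : c j ≠ c (j + 1)) :
    HasContent (c ∘ Equiv.swap j (j + 1)) (tau n j f) := by
  have hc : ((c j : ℂ) - c (j + 1)) ≠ 0 := by exact_mod_cast sub_ne_zero.2 hne
  intro k hk hkn
  rw [hf.tau_apply hj hjn hne, map_add, map_smul, hf k hk hkn, ← Module.End.mul_apply]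
  by_cases h1 : k = j
  · subst h1
    have h := permOp_mul_jm_succ hj hjn
    rw [← sub_eq_iff_eq_add] at h
    rw [← h, LinearMap.sub_apply, Module.End.mul_apply, hf (k + 1) (by omega) hjn]
    simp only [Function.comp_apply, Equiv.swap_apply_left, map_smul, Module.End.one_apply,
      Int.cast_sub]
    match_scalars
    · simp
    · field_simp
      ring
  by_cases h2 : k = j + 1
  · subst h2
    have h := permOp_mul_jm hj hjn
    rw [eq_sub_iff_add_eq] at h
    rw [← h, LinearMap.add_apply, Module.End.mul_apply, hf j hj (by omega)]
    simp only [Function.comp_apply, Equiv.swap_apply_right, map_smul, Module.End.one_apply,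
      Int.cast_sub]
    match_scalars
    · simp
    · field_simp
      ring
  rw [← permOp_mul_jm_of_ne hj hjn hkn h1 h2, Module.End.mul_apply, hf k hk hkn,
    Function.comp_apply, Equiv.swap_apply_of_ne_of_ne h1 h2, map_smul, smul_add, smul_comm]

/-- In ⟨s f + f/δ, s g + g/δ⟩ the squares give 1 + 1/δ². The relation s D = -D s - 2, tested on f
and g, gives ⟨s f, g⟩ = -⟨f, g⟩/δ, so the two cross terms give -2/δ². Allowing f ≠ g lets
orthogonality in ℓ pass from f_T to f_Q. -/
theorem HasContent.innerPi_tau {c : ℕ → ℤ} {f g : L n} (hf : HasContent c f)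
    (hg : HasContent c g) {j : ℕ} (hj : 1 ≤ j) (hjn : j + 1 ≤ n) (hne : c j ≠ c (j + 1)) :
    innerPi (BinaryBurnside.tau n j f) (BinaryBurnside.tau n j g) =
      (1 - 1 / ((c j - c (j + 1) : ℤ) : ℂ) ^ 2) * innerPi f g := by
  have hc : ((c j - c (j + 1) : ℤ) : ℂ) ≠ 0 := by exact_mod_cast sub_ne_zero.2 hne
  have h := congrArg (fun F : Module.End ℂ (L n) => innerPi (F f) g) (permOp_mul_jm_sub hj hjn)
  have h2 : ((2 : Module.End ℂ (L n)) f) = (2 : ℂ) • f := by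
    rw [← one_add_one_eq_two, ← one_add_one_eq_two, add_smul, one_smul]; rfl
  simp only [Module.End.mul_apply, LinearMap.sub_apply (-_), LinearMap.neg_apply,
    hf.sub_apply hj hjn, map_smul, innerPi_sub_left, innerPi_neg_left, innerPi_jm_sub,
    hg.sub_apply hj hjn, h2, innerPi_smul_left, innerPi_smul_right, map_intCast] at h
  rw [hf.tau_apply hj hjn hne, hg.tau_apply hj hjn hne]
  simp only [innerPi_add_left, innerPi_add_right, innerPi_smul_left, innerPi_smul_right,
    innerPi_permOp, map_inv₀, map_intCast, ← innerPi_transp _ _ f g]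
  set δ : ℂ := ((c j - c (j + 1) : ℤ) : ℂ)
  set z := innerPi ((permOp (transp n j (j + 1))) f) g
  have hz : z = -innerPi f g / δ := by
    rw [eq_div_iff hc]
    have h3 : (starRingEnd ℂ) 2 = 2 := Complex.conj_ofNat 2
    rw [h3] at h
    linear_combination h / 2
  rw [hz]
  field_simp
  ring

end Perm

end BinaryBurnside

namespace BinaryBurnside

/-! ### Specht polynomials -/

section Specht

variable {n : ℕ}

/-- The coordinate `x_j ∈ {0, 1}`, `1 ≤ j ≤ n`, of a tuple. -/
def bit (x : Cube n) (j : ℕ) : ℂ :=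
  if h : 1 ≤ j ∧ j ≤ n then (if x ⟨j - 1, by omega⟩ = true then 1 else 0) else 0

theorem bit_comp_transp {i r : ℕ} (hi : 1 ≤ i ∧ i ≤ n) (hr : 1 ≤ r ∧ r ≤ n) (x : Cube n) :
    bit (x ∘ transp n i r) = bit x ∘ Equiv.swap i r := by
  funext j
  by_cases hj : 1 ≤ j ∧ j ≤ n
  · have hs := swap_mem hi hr hj
    simp only [bit, Function.comp_apply, dif_pos hj, dif_pos hs]
    have : transp n i r ⟨j - 1, by omega⟩ = ⟨Equiv.swap i r j - 1, by omega⟩ :=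
      Fin.ext (transp_val hi hr hj)
    simp only [this]
  · have hs : Equiv.swap i r j = j :=
      Equiv.swap_apply_of_ne_of_ne (by rintro rfl; exact hj hi) (by rintro rfl; exact hj hr)
    simp only [bit, Function.comp_apply, hs, dif_neg hj]

/-- The Specht polynomial `∏_{p < m} (y_{2p+2} - y_{2p+1})` of the column reading tableau. -/
def specht (m : ℕ) (y : ℕ → ℂ) : ℂ := ∏ p ∈ Finset.range m, (y (2 * p + 2) - y (2 * p + 1))

theorem specht_congr {m : ℕ} {y z : ℕ → ℂ} (h : ∀ j, j ≤ 2 * m → y j = z j) :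
    specht m y = specht m z := by
  refine Finset.prod_congr rfl fun p hp => ?_
  rw [Finset.mem_range] at hp
  rw [h _ (by omega), h _ (by omega)]

theorem specht_swap_pair {m r : ℕ} (hr : r < m) (y : ℕ → ℂ) :
    specht m (y ∘ Equiv.swap (2 * r + 1) (2 * r + 2)) = -specht m y := by
  have hr' : r ∈ Finset.range m := Finset.mem_range.2 hr
  rw [specht, specht, ← Finset.mul_prod_erase _ _ hr', ← Finset.mul_prod_erase _ _ hr', ← neg_mul]
  congr 1
  · simp
  · refine Finset.prod_congr rfl fun p hp => ?_
    have := Finset.ne_of_mem_erase hp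
    simp only [Function.comp_apply]
    rw [Equiv.swap_apply_of_ne_of_ne (by omega) (by omega),
      Equiv.swap_apply_of_ne_of_ne (by omega) (by omega)]

/-- The Garnir relation for column p and a later position k. If k lies in another column r, it is
the three-term quadratic identity among differences of four variables; otherwise it is (y_{2p+2} -
y_k) + (y_k - y_{2p+1}) = y_{2p+2} - y_{2p+1}. -/
theorem specht_garnir {m p k : ℕ} (hp : p < m) (hk : 2 * p + 2 < k) (y : ℕ → ℂ) :
    specht m (y ∘ Equiv.swap (2 * p + 1) k) + specht m (y ∘ Equiv.swap (2 * p + 2) k) =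
      specht m y := by
  have hp' : p ∈ Finset.range m := Finset.mem_range.2 hp
  simp only [specht]
  by_cases hr : k ≤ 2 * m
  · obtain ⟨r, hr1, hr2⟩ : ∃ r, r < m ∧ (k = 2 * r + 1 ∨ k = 2 * r + 2) :=
      ⟨(k - 1) / 2, by omega, by omega⟩
    have hr' : r ∈ (Finset.range m).erase p :=
      Finset.mem_erase.2 ⟨by omega, Finset.mem_range.2 hr1⟩
    simp only [← Finset.mul_prod_erase _ _ hp', ← Finset.mul_prod_erase _ _ hr']
    have hrest : ∀ i, i = 2 * p + 1 ∨ i = 2 * p + 2 →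
        ∏ q ∈ ((Finset.range m).erase p).erase r,
          ((y ∘ Equiv.swap i k) (2 * q + 2) - (y ∘ Equiv.swap i k) (2 * q + 1)) =
        ∏ q ∈ ((Finset.range m).erase p).erase r, (y (2 * q + 2) - y (2 * q + 1)) := by
      intro i hi
      refine Finset.prod_congr rfl fun q hq => ?_
      have h1 := Finset.ne_of_mem_erase hq
      have h2 := Finset.ne_of_mem_erase (Finset.mem_of_mem_erase hq)
      simp only [Function.comp_apply]
      rw [Equiv.swap_apply_of_ne_of_ne (by omega) (by omega),
        Equiv.swap_apply_of_ne_of_ne (by omega) (by omega)]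
    rw [hrest _ (Or.inl rfl), hrest _ (Or.inr rfl)]
    simp only [Function.comp_apply]
    rcases hr2 with rfl | rfl
    · simp only [Equiv.swap_apply_left, Equiv.swap_apply_right]
      rw [Equiv.swap_apply_of_ne_of_ne (a := 2 * p + 1) (x := 2 * p + 2) (by omega) (by omega),
        Equiv.swap_apply_of_ne_of_ne (a := 2 * p + 1) (x := 2 * r + 2) (by omega) (by omega),
        Equiv.swap_apply_of_ne_of_ne (a := 2 * p + 2) (x := 2 * p + 1) (by omega) (by omega),
        Equiv.swap_apply_of_ne_of_ne (a := 2 * p + 2) (x := 2 * r + 2) (by omega) (by omega)]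
      ring
    · simp only [Equiv.swap_apply_left, Equiv.swap_apply_right]
      rw [Equiv.swap_apply_of_ne_of_ne (a := 2 * p + 1) (x := 2 * p + 2) (by omega) (by omega),
        Equiv.swap_apply_of_ne_of_ne (a := 2 * p + 1) (x := 2 * r + 1) (by omega) (by omega),
        Equiv.swap_apply_of_ne_of_ne (a := 2 * p + 2) (x := 2 * p + 1) (by omega) (by omega),
        Equiv.swap_apply_of_ne_of_ne (a := 2 * p + 2) (x := 2 * r + 1) (by omega) (by omega)]
      ring
  · simp only [← Finset.mul_prod_erase _ _ hp']
    have hrest : ∀ i, i = 2 * p + 1 ∨ i = 2 * p + 2 →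
        ∏ q ∈ (Finset.range m).erase p,
          ((y ∘ Equiv.swap i k) (2 * q + 2) - (y ∘ Equiv.swap i k) (2 * q + 1)) =
        ∏ q ∈ (Finset.range m).erase p, (y (2 * q + 2) - y (2 * q + 1)) := by
      intro i hi
      refine Finset.prod_congr rfl fun q hq => ?_
      have h1 := Finset.ne_of_mem_erase hq
      have h2 := Finset.mem_range.1 (Finset.mem_of_mem_erase hq)
      simp only [Function.comp_apply]
      rw [Equiv.swap_apply_of_ne_of_ne (by omega) (by omega),
        Equiv.swap_apply_of_ne_of_ne (by omega) (by omega)]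
    rw [hrest _ (Or.inl rfl), hrest _ (Or.inr rfl)]
    simp only [Function.comp_apply, Equiv.swap_apply_left]
    rw [Equiv.swap_apply_of_ne_of_ne (a := 2 * p + 1) (x := 2 * p + 2) (by omega) (by omega),
      Equiv.swap_apply_of_ne_of_ne (a := 2 * p + 2) (x := 2 * p + 1) (by omega) (by omega)]
    ring

theorem sum_Ico_pairs (g : ℕ → ℂ) (r : ℕ) :
    ∑ i ∈ Finset.Ico 1 (2 * r + 1), g i =
      ∑ p ∈ Finset.range r, (g (2 * p + 1) + g (2 * p + 2)) := by
  induction r with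
  | zero => simp
  | succ r ih =>
    rw [Finset.sum_range_succ, ← ih, show 2 * (r + 1) + 1 = 2 * r + 1 + 1 + 1 by ring,
      Finset.sum_Ico_succ_top (by omega), Finset.sum_Ico_succ_top (by omega)]
    ring

theorem sum_specht_swap {m k r : ℕ} (hr : r ≤ m) (hk : 2 * r < k) (y : ℕ → ℂ) :
    ∑ i ∈ Finset.Ico 1 (2 * r + 1), specht m (y ∘ Equiv.swap i k) = r * specht m y := by
  rw [sum_Ico_pairs, Finset.sum_congr rfl fun p hp => specht_garnir
    (lt_of_lt_of_le (Finset.mem_range.1 hp) hr) (by have := Finset.mem_range.1 hp; omega) y]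
  simp

/-- The Specht polynomial times a function of the number of ones. -/
def spechtFn (n m : ℕ) (φ : ℕ → ℂ) : L n := fun x => specht m (bit x) * φ (ones x)

theorem jm_spechtFn {m k : ℕ} (hk : 1 ≤ k ∧ k ≤ n) (φ : ℕ → ℂ) (x : Cube n) :
    jm n k (spechtFn n m φ) x =
      (∑ i ∈ Finset.Ico 1 k, specht m (bit x ∘ Equiv.swap i k)) * φ (ones x) := by
  simp only [jm, LinearMap.sum_apply, Finset.sum_apply, permOp_apply, Finset.sum_mul, spechtFn,
    ones_comp]
  refine Finset.sum_congr rfl fun i hi => ?_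
  rw [Finset.mem_Ico] at hi
  rw [bit_comp_transp ⟨hi.1, by omega⟩ hk]

end Specht

/-! ### Contents of two-row tableaux -/

section Content

/-- The number of elements of `A` which are at most `k`. -/
def cnt (A : Finset ℕ) (k : ℕ) : ℕ := (A.filter (· ≤ k)).card

/-- The content of the cell of `k` in a two-row tableau with second row `A`. -/
def content (A : Finset ℕ) (k : ℕ) : ℤ :=
  if k ∈ A then (cnt A k : ℤ) - 2 else (k : ℤ) - 1 - cnt A k

/-- The second row `{2, 4, …, 2m}` of the column reading tableau. -/
def evens (m : ℕ) : Finset ℕ := (Finset.Icc 1 m).image (2 * ·)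

theorem mem_evens {m k : ℕ} : k ∈ evens m ↔ Even k ∧ 1 ≤ k ∧ k ≤ 2 * m := by
  simp only [evens, Finset.mem_image, Finset.mem_Icc]
  constructor
  · rintro ⟨r, hr, rfl⟩; exact ⟨even_two_mul r, by omega, by omega⟩
  · rintro ⟨⟨r, rfl⟩, h⟩; exact ⟨r, by omega, by omega⟩

theorem card_evens (m : ℕ) : (evens m).card = m := by
  rw [evens, Finset.card_image_of_injective _ (fun a b h => by simpa using h)]
  simp

theorem cnt_evens (m k : ℕ) : cnt (evens m) k = min m (k / 2) := by
  rw [cnt, ← card_evens (min m (k / 2))]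
  congr 1
  ext t
  simp only [Finset.mem_filter, mem_evens, Nat.even_iff]
  omega

/-- Each complete column before k contributes 1 to the eigenvalue of M_k, by the Garnir relation. If
k is the lower entry of a column, the swap with its partner contributes -1. If k > 2m, each swap
with a position between 2m and k fixes Δ_m and contributes 1. -/
theorem hasContent_spechtFn {n m : ℕ} (φ : ℕ → ℂ) :
    HasContent (content (evens m)) (spechtFn n m φ) := by
  intro k hk hkn
  funext x
  rw [jm_spechtFn ⟨hk, hkn⟩, Pi.smul_apply, smul_eq_mul, spechtFn, ← mul_assoc]
  congr 1
  by_cases hk2 : k ≤ 2 * m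
  · obtain ⟨r, hr, rfl | rfl⟩ : ∃ r, r < m ∧ (k = 2 * r + 1 ∨ k = 2 * r + 2) :=
      ⟨(k - 1) / 2, by omega, by omega⟩
    · rw [sum_specht_swap hr.le (by omega), content, if_neg (by simp [mem_evens]), cnt_evens,
        show min m ((2 * r + 1) / 2) = r by omega]
      push_cast
      ring
    · rw [Finset.sum_Ico_succ_top (by omega), sum_specht_swap hr.le (by omega),
        specht_swap_pair hr, content,
        if_pos (mem_evens.2 ⟨by simp [Nat.even_add], by omega, by omega⟩), cnt_evens,
        show min m ((2 * r + 2) / 2) = r + 1 by omega]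
      push_cast
      ring
  · rw [← Finset.sum_Ico_consecutive _ (show 1 ≤ 2 * m + 1 by omega) (show 2 * m + 1 ≤ k by omega),
      sum_specht_swap le_rfl (by omega)]
    have : ∀ i ∈ Finset.Ico (2 * m + 1) k, specht m (bit x ∘ Equiv.swap i k) =
        specht m (bit x) := by
      intro i hi
      rw [Finset.mem_Ico] at hi
      refine specht_congr fun j hj => ?_
      rw [Function.comp_apply, Equiv.swap_apply_of_ne_of_ne (by omega) (by omega)]
    rw [Finset.sum_congr rfl this, Finset.sum_const, Nat.card_Ico, content,
      if_neg (by rw [mem_evens]; omega), cnt_evens, show min m (k / 2) = m by omega, nsmul_eq_mul,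
      Nat.cast_sub (by omega)]
    push_cast
    ring

theorem cnt_insert_erase {A : Finset ℕ} {i j : ℕ} (hi : i ∈ A) (hj : j ∉ A) (hij : i < j) (k : ℕ) :
    (cnt (insert j (A.erase i)) k : ℤ) = cnt A k - if i ≤ k ∧ k < j then 1 else 0 := by
  unfold cnt
  have h1 : (A.filter (· ≤ k)).card = ((A.erase i).filter (· ≤ k)).card + if i ≤ k then 1 else 0 := by
    conv_lhs => rw [← Finset.insert_erase hi, Finset.filter_insert]
    split_ifs with h
    · rw [Finset.card_insert_of_notMem (by simp)]
    · simp
  have h2 : ((insert j (A.erase i)).filter (· ≤ k)).card =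
      ((A.erase i).filter (· ≤ k)).card + if j ≤ k then 1 else 0 := by
    rw [Finset.filter_insert]
    split_ifs with h
    · rw [Finset.card_insert_of_notMem (by simp [hj])]
    · simp
  rw [h1, h2]
  split_ifs <;> omega

/-- Exchanging j and j + 1 in the tableau leaves the cells in place, so the two numbers trade
contents. This matches the permutation of eigenvalues under τ_j. -/
theorem content_insert_erase_succ {A : Finset ℕ} {j : ℕ} (hj : j ∈ A) (hj' : j + 1 ∉ A) (k : ℕ) :
    content (insert (j + 1) (A.erase j)) k = content A (Equiv.swap j (j + 1) k) := by
  have hc := cnt_insert_erase hj hj' (Nat.lt_succ_self j)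
  have hs : (cnt A (j + 1) : ℤ) = cnt A j := by
    unfold cnt
    congr 2
    ext t
    simp only [Finset.mem_filter]
    refine and_congr_right fun ht => ⟨fun h => ?_, fun h => by omega⟩
    have : t ≠ j + 1 := by rintro rfl; exact hj' ht
    omega
  by_cases h1 : k = j
  · subst h1
    rw [Equiv.swap_apply_left, content, content, if_neg hj', if_neg (by simp), hc, hs,
      if_pos (by omega)]
    push_cast
    ring
  by_cases h2 : k = j + 1
  · subst h2
    rw [Equiv.swap_apply_right, content, content, if_pos hj, if_pos (by simp), hc, hs,
      if_neg (by omega)]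
    ring
  have hz : (if j ≤ k ∧ k < j + 1 then (1 : ℤ) else 0) = 0 := if_neg (by omega)
  rw [Equiv.swap_apply_of_ne_of_ne h1 h2, content, content, hc, hz, sub_zero]
  simp [h1, h2]

/-! ### Words in the intertwiners: transport of contents and norms. -/

theorem tauStep_self (n r : ℕ) : tauStep n (2 * r) r = 1 := by simp [tauStep]

theorem tauStep_succ (n : ℕ) {a r : ℕ} (h : 2 * r ≤ a) :
    tauStep n (a + 1) r = tau n a * tauStep n a r := by
  rw [tauStep, tauStep, show a + 1 - 2 * r = a - 2 * r + 1 by omega, List.range'_1_concat,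
    show 2 * r + (a - 2 * r) = a by omega]
  simp

/-- The r-th second-row entry moves up one unit at a time; the gap hypothesis keeps its path free.
The move from a to a + 1 has content difference (r - 2) - (a - r) = -t with t = a + 2 - 2r ≥ 2, so
it is admissible and contributes 1 - 1/t², the newest factor of the product. -/
theorem hasContent_tauStep {n r : ℕ} {A : Finset ℕ} (hr : 1 ≤ r) (hA : 2 * r ∈ A)
    (hcnt : cnt A (2 * r) = r) {a : ℕ} (ha : 2 * r ≤ a) :
    a ≤ n → (∀ t, 2 * r < t → t ≤ a → t ∉ A) → ∀ f : L n, HasContent (content A) f →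
      HasContent (content (insert a (A.erase (2 * r)))) (tauStep n a r f) ∧
      ∀ g : L n, HasContent (content A) g → innerPi (tauStep n a r f) (tauStep n a r g) =
        (∏ t ∈ Finset.Icc 2 (a - 2 * r + 1), (((t : ℂ) ^ 2 - 1) / (t : ℂ) ^ 2)) *
          innerPi f g := by
  induction a, ha using Nat.le_induction with
  | base =>
    intro _ _ f hf
    rw [tauStep_self, Finset.insert_erase hA]
    exact ⟨hf, fun g _ => by simp⟩
  | succ a ha ih =>
    intro han hgap f hf
    have ih' := ih (by omega) (fun t h1 h2 => hgap t h1 (by omega))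
    set B := insert a (A.erase (2 * r)) with hB
    have haB : a ∈ B := Finset.mem_insert_self _ _
    have haA : a ∉ A.erase (2 * r) := by
      intro h
      have h1 := Finset.ne_of_mem_erase h
      exact hgap a (by omega) (by omega) (Finset.mem_of_mem_erase h)
    have haB' : a + 1 ∉ B := by
      simp only [hB, Finset.mem_insert, Finset.mem_erase, not_or, not_and]
      exact ⟨by omega, fun _ => hgap _ (by omega) le_rfl⟩
    have hBB : insert (a + 1) (A.erase (2 * r)) = insert (a + 1) (B.erase a) := by
      rw [hB, Finset.erase_insert haA]
    have hcB : (cnt B a : ℤ) = r ∧ (cnt B (a + 1) : ℤ) = r := by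
      have e1 : (cnt B a) = r := by
        rw [← hcnt, cnt, cnt, hB, Finset.filter_insert, if_pos le_rfl,
          Finset.card_insert_of_notMem (by simp [haA])]
        have : (A.filter (· ≤ 2 * r)) = insert (2 * r) ((A.erase (2 * r)).filter (· ≤ a)) := by
          ext t
          simp only [Finset.mem_filter, Finset.mem_insert, Finset.mem_erase]
          constructor
          · rintro ⟨h1, h2⟩
            by_cases h : t = 2 * r
            · exact Or.inl h
            · exact Or.inr ⟨⟨h, h1⟩, by omega⟩
          · rintro (rfl | ⟨⟨h1, h2⟩, h3⟩)
            · exact ⟨hA, le_rfl⟩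
            · refine ⟨h2, ?_⟩
              by_contra h
              exact hgap t (by omega) (by omega) h2
        rw [this, Finset.card_insert_of_notMem (by simp)]
      refine ⟨by exact_mod_cast e1, ?_⟩
      rw [← e1]
      unfold cnt
      congr 2
      ext t
      simp only [Finset.mem_filter]
      refine and_congr_right fun ht => ⟨fun h => ?_, fun h => by omega⟩
      have : t ≠ a + 1 := by rintro rfl; exact haB' ht
      omega
    have hδ : content B a - content B (a + 1) = -((a + 2 - 2 * r : ℕ) : ℤ) := by
      rw [content, content, if_pos haB, if_neg haB', hcB.1, hcB.2]
      push_cast [show 2 * r ≤ a + 2 by omega]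
      ring
    have hne : content B a ≠ content B (a + 1) := by
      rw [← sub_ne_zero, hδ]
      omega
    have hf' := (ih' f hf).1
    rw [tauStep_succ n ha]
    refine ⟨?_, fun g hg => ?_⟩
    · rw [hBB]
      refine (hf'.tau (by omega) han hne).congr fun k _ _ => ?_
      rw [content_insert_erase_succ haB haB', Function.comp_apply]
    · rw [Module.End.mul_apply, Module.End.mul_apply,
        hf'.innerPi_tau ((ih' g hg).1) (by omega) han hne, (ih' f hf).2 g hg, hδ,
        show a + 1 - 2 * r + 1 = a - 2 * r + 1 + 1 by omega,
        Finset.prod_Icc_succ_top (show 2 ≤ a - 2 * r + 1 + 1 by omega), show a + 2 - 2 * r = a - 2 * r + 1 + 1 by omega]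
      have : ((a - 2 * r + 1 + 1 : ℕ) : ℂ) ≠ 0 := Nat.cast_ne_zero.2 (by omega)
      rw [Int.cast_neg, neg_sq, Int.cast_natCast, one_sub_div (pow_ne_zero 2 this)]
      ring

/-- The conditions on the second row of a two-row standard tableau. -/
structure IsSecondRow (n m : ℕ) (a : ℕ → ℕ) : Prop where
  lt_of_lt : ∀ r s, 1 ≤ r → r < s → s ≤ m → a r < a s
  two_mul_le : ∀ r, 1 ≤ r → r ≤ m → 2 * r ≤ a r
  le : ∀ r, 1 ≤ r → r ≤ m → a r ≤ n

/-- The rightmost factor acts first and moves the largest entry, so each 2r finds its way to a_r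
clear of the entries already placed. After the factors with index above s the second row is {2, …,
2s} ∪ {a_{s+1}, …, a_m}; hence the descending induction from s = m. -/
theorem hasContent_prod_tauStep {n m : ℕ} {a : ℕ → ℕ} (ha : IsSecondRow n m a) {s : ℕ}
    (hs : s ≤ m) {f : L n} (hf : HasContent (content (evens m)) f) :
    HasContent (content (evens s ∪ (Finset.Icc (s + 1) m).image a))
      (((List.range' (s + 1) (m - s)).map fun r => tauStep n (a r) r).prod f) ∧
    ∀ g : L n, HasContent (content (evens m)) g →
      innerPi (((List.range' (s + 1) (m - s)).map fun r => tauStep n (a r) r).prod f)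
        (((List.range' (s + 1) (m - s)).map fun r => tauStep n (a r) r).prod g) =
      (∏ r ∈ Finset.Icc (s + 1) m, ∏ t ∈ Finset.Icc 2 (a r - 2 * r + 1),
        (((t : ℂ) ^ 2 - 1) / (t : ℂ) ^ 2)) * innerPi f g := by
  induction hs using Nat.decreasingInduction generalizing f with
  | self =>
    simp only [Nat.sub_self, List.range'_zero, List.map_nil, List.prod_nil, Module.End.one_apply]
    rw [Finset.Icc_eq_empty (by omega), Finset.image_empty, Finset.union_empty]
    exact ⟨hf, fun g _ => by simp⟩
  | of_succ s hs ih =>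
    have hlist : List.range' (s + 1) (m - s) =
        (s + 1) :: List.range' (s + 1 + 1) (m - (s + 1)) := by
      rw [show m - s = m - (s + 1) + 1 by omega, List.range'_succ]
    set A := evens (s + 1) ∪ (Finset.Icc (s + 1 + 1) m).image a with hAdef
    have hmemA : ∀ t, t ∈ A → t ≤ 2 * (s + 1) ∨ a (s + 1) < t := by
      intro t ht
      rw [hAdef, Finset.mem_union, mem_evens, Finset.mem_image] at ht
      rcases ht with h | ⟨r, hr, rfl⟩
      · exact Or.inl h.2.2
      · rw [Finset.mem_Icc] at hr
        exact Or.inr (ha.lt_of_lt _ _ (by omega) (by omega) hr.2)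
    have h2 := ha.two_mul_le (s + 1) (by omega) hs
    have hA : 2 * (s + 1) ∈ A :=
      Finset.mem_union_left _ (mem_evens.2 ⟨even_two_mul _, by omega, le_rfl⟩)
    have hcnt : cnt A (2 * (s + 1)) = s + 1 := by
      refine Eq.trans ?_ (card_evens (s + 1))
      rw [cnt]
      congr 1
      ext t
      rw [Finset.mem_filter]
      refine ⟨fun ⟨h1, h3⟩ => ?_, fun h => ⟨Finset.mem_union_left _ h, (mem_evens.1 h).2.2⟩⟩
      rcases Finset.mem_union.1 h1 with h | h
      · exact h
      · obtain ⟨r, hr, rfl⟩ := Finset.mem_image.1 h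
        rw [Finset.mem_Icc] at hr
        have := ha.two_mul_le r (by omega) hr.2
        omega
    have hstage : insert (a (s + 1)) (A.erase (2 * (s + 1))) =
        evens s ∪ (Finset.Icc (s + 1) m).image a := by
      have hIcc : Finset.Icc (s + 1) m = insert (s + 1) (Finset.Icc (s + 1 + 1) m) := by
        ext t; simp only [Finset.mem_Icc, Finset.mem_insert]; omega
      rw [hIcc, Finset.image_insert, Finset.union_insert]
      congr 1
      rw [hAdef, Finset.erase_union_distrib]
      congr 1
      · ext t
        simp only [Finset.mem_erase, mem_evens, Nat.even_iff]
        omega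
      · refine Finset.erase_eq_of_notMem fun h => ?_
        obtain ⟨r, hr, hr'⟩ := Finset.mem_image.1 h
        rw [Finset.mem_Icc] at hr
        have := ha.two_mul_le r (by omega) hr.2
        omega
    have step := hasContent_tauStep (n := n) (by omega) hA hcnt h2 (ha.le (s + 1) (by omega) hs)
      (fun t h1 h3 h4 => by rcases hmemA t h4 with h | h <;> omega)
    have hprod : Finset.Icc (s + 1) m = insert (s + 1) (Finset.Icc (s + 1 + 1) m) := by
      ext t; simp only [Finset.mem_Icc, Finset.mem_insert]; omega
    rw [hlist, List.map_cons, List.prod_cons, Module.End.mul_apply, ← hstage]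
    refine ⟨(step _ (ih hf).1).1, fun g hg => ?_⟩
    rw [Module.End.mul_apply, (step _ (ih hf).1).2 _ (ih hg).1, (ih hf).2 g hg, hprod,
      Finset.prod_insert (by simp), mul_assoc]

/-- A set of positive numbers is ballot if it can be the second row of a standard tableau. -/
def IsBallot (A : Finset ℕ) : Prop := ∀ k, 2 * cnt A k ≤ k

/-- Insert 1, 2, … in order. If c of the numbers up to k lie in the second row, then k + 1 has
content c - 1 in the second row and k - c in the first. The ballot bound 2c ≤ k separates these
values, so the content reveals the row. -/
theorem eq_of_content_eq {n : ℕ} {A B : Finset ℕ} (hA : IsBallot A) (hB : IsBallot B)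
    (hAn : A ⊆ Finset.Icc 1 n) (hBn : B ⊆ Finset.Icc 1 n)
    (h : ∀ k, 1 ≤ k → k ≤ n → content A k = content B k) : A = B := by
  have key : ∀ k, k ≤ n → cnt A k = cnt B k ∧ (k ∈ A ↔ k ∈ B) := by
    intro k
    have hsucc : ∀ (C : Finset ℕ) (k : ℕ), cnt C (k + 1) = cnt C k + if k + 1 ∈ C then 1 else 0 := by
      intro C k
      unfold cnt
      split_ifs with hC
      · have : C.filter (· ≤ k + 1) = insert (k + 1) (C.filter (· ≤ k)) := by
          ext t
          simp only [Finset.mem_filter, Finset.mem_insert]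
          constructor
          · rintro ⟨h1, h2⟩
            by_cases h3 : t = k + 1
            · exact Or.inl h3
            · exact Or.inr ⟨h1, by omega⟩
          · rintro (rfl | ⟨h1, h2⟩)
            · exact ⟨hC, le_rfl⟩
            · exact ⟨h1, by omega⟩
        rw [this, Finset.card_insert_of_notMem (by simp)]
      · rw [add_zero]
        congr 1
        ext t
        simp only [Finset.mem_filter]
        refine and_congr_right fun ht => ⟨fun h => ?_, fun h => by omega⟩
        have : t ≠ k + 1 := by rintro rfl; exact hC ht
        omega
    induction k with
    | zero =>
      intro _
      have h0 : ∀ C : Finset ℕ, C ⊆ Finset.Icc 1 n → 0 ∉ C := fun C hC h => by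
        simpa using hC h
      refine ⟨?_, iff_of_false (h0 A hAn) (h0 B hBn)⟩
      have := hA 0
      have := hB 0
      omega
    | succ k ih =>
      intro hk
      have h1 := (ih (by omega)).1
      have h2 := h (k + 1) (by omega) hk
      have h3 := hA k
      have h4 := hB k
      have hiff : k + 1 ∈ A ↔ k + 1 ∈ B := by
        simp only [content, hsucc] at h2
        split_ifs at h2 with h5 h6 h6
        · exact iff_of_true h5 h6
        · push_cast at h2; omega
        · push_cast at h2; omega
        · exact iff_of_false h5 h6
      refine ⟨?_, hiff⟩
      rw [hsucc, hsucc, h1]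
      simp only [hiff]
  ext k
  by_cases hk : k ≤ n
  · exact (key k hk).2
  · exact iff_of_false (fun h => hk (Finset.mem_Icc.1 (hAn h)).2)
      (fun h => hk (Finset.mem_Icc.1 (hBn h)).2)

theorem IsSecondRow.injOn {n m : ℕ} {a : ℕ → ℕ} (ha : IsSecondRow n m a) :
    Set.InjOn a (Finset.Icc 1 m) := by
  intro r hr s hs h
  simp only [Finset.coe_Icc, Set.mem_Icc] at hr hs
  rcases lt_trichotomy r s with h1 | h1 | h1
  · exact absurd h (ha.lt_of_lt r s hr.1 h1 hs.2).ne
  · exact h1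
  · exact absurd h (ha.lt_of_lt s r hs.1 h1 hr.2).ne'

/-- From a_r ≥ 2r, at most k/2 indices r satisfy a_r ≤ k. -/
theorem IsSecondRow.isBallot {n m : ℕ} {a : ℕ → ℕ} (ha : IsSecondRow n m a) :
    IsBallot ((Finset.Icc 1 m).image a) := by
  intro k
  have : ((Finset.Icc 1 m).image a).filter (· ≤ k) ⊆ (Finset.Icc 1 (k / 2)).image a := by
    intro t ht
    rw [Finset.mem_filter, Finset.mem_image] at ht
    obtain ⟨⟨r, hr, rfl⟩, hrk⟩ := ht
    rw [Finset.mem_Icc] at hr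
    have := ha.two_mul_le r hr.1 hr.2
    exact Finset.mem_image_of_mem _ (Finset.mem_Icc.2 ⟨hr.1, by omega⟩)
  have h1 := (Finset.card_le_card this).trans Finset.card_image_le
  rw [Nat.card_Icc] at h1
  unfold cnt
  omega

end Content

end BinaryBurnside

namespace BinaryBurnside

/-! ### The transition matrix -/

section Matrix

/-- The rising factorial `(1/2) (3/2) ⋯ (k - 1/2)`. -/
noncomputable def halfRising (k : ℕ) : ℂ := ∏ i ∈ Finset.range k, ((i : ℂ) + 1 / 2)

theorem halfRising_succ (k : ℕ) : halfRising (k + 1) = halfRising k * ((k : ℂ) + 1 / 2) :=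
  Finset.prod_range_succ _ _

theorem halfRising_zero : halfRising 0 = 1 := Finset.prod_range_zero _

theorem fixes_iff {n : ℕ} (s : Equiv.Perm (Fin n)) (x : Cube n) : Fixes s x ↔ x ∘ s = x := by
  rw [Fixes]

/-- The permutation coded by (p, e) has 0 as a new fixed point if p = 0, and otherwise inserts 0
just before p in its cycle of e. Invariance of z therefore means invariance of the tail together
with z 0 = z p. -/
theorem comp_decomposeFin_symm {n : ℕ} {γ : Type*} (z : Fin (n + 1) → γ) (p : Fin (n + 1))
    (e : Equiv.Perm (Fin n)) :
    z ∘ (Equiv.Perm.decomposeFin.symm (p, e)) = z ↔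
      z p = z 0 ∧ Fin.tail z ∘ e = Fin.tail z := by
  constructor
  · intro h
    have h0 : z p = z 0 := by simpa using congrFun h 0
    refine ⟨h0, funext fun i => ?_⟩
    have hi := congrFun h i.succ
    simp only [Function.comp_apply, Equiv.Perm.decomposeFin_symm_apply_succ] at hi
    rw [← show z i.succ = Fin.tail z i from rfl, ← hi]
    by_cases hp : (e i).succ = p
    · rw [hp, Equiv.swap_apply_right, ← h0, ← hp]; rfl
    · rw [Equiv.swap_apply_of_ne_of_ne (Fin.succ_ne_zero _) hp]; rfl
  · rintro ⟨h0, h⟩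
    funext i
    refine Fin.cases (by simpa using h0) (fun i => ?_) i
    have hi : z (e i).succ = z i.succ := congrFun h i
    simp only [Function.comp_apply, Equiv.Perm.decomposeFin_symm_apply_succ]
    rw [← hi]
    by_cases hp : (e i).succ = p
    · rw [hp, Equiv.swap_apply_right, ← h0]
    · rw [Equiv.swap_apply_of_ne_of_ne (Fin.succ_ne_zero _) hp]

theorem card_fixed_decomposeFin_symm {n : ℕ} (p : Fin (n + 1)) (e : Equiv.Perm (Fin n)) :
    (Finset.univ.filter fun z : Cube (n + 1) =>
        Fixes (Equiv.Perm.decomposeFin.symm (p, e)) z).card =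
      (if p = 0 then 2 else 1) * (Finset.univ.filter fun z : Cube n => Fixes e z).card := by
  simp only [Finset.card_filter, fixes_iff, comp_decomposeFin_symm]
  rw [← Equiv.sum_comp (Fin.consEquiv fun _ => Bool), Fintype.sum_prod_type, Finset.mul_sum,
    Finset.sum_comm]
  refine Finset.sum_congr rfl fun t _ => ?_
  refine Fin.cases ?_ (fun q => ?_) p
  · by_cases ht : t ∘ e = t <;> simp [Fin.consEquiv, ht]
  · by_cases ht : t ∘ e = t <;> cases hq : t q <;> simp [Fin.consEquiv, ht, hq]

/-- Weight a permutation by 1/2 per cycle. A new point either starts a cycle, with weight 1/2, or is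
inserted before one of the k old points of its colour, with weight 1, so it contributes k + 1/2. The
colour type is arbitrary so that the pairs (x_i, y_i) can serve as colours. -/
theorem sum_inv_card_fixed {β : Type*} [Fintype β] [DecidableEq β] {n : ℕ} (c : Fin n → β) :
    (∑ s ∈ Finset.univ.filter (fun s : Equiv.Perm (Fin n) => c ∘ s = c),
      1 / ((Finset.univ.filter fun z : Cube n => Fixes s z).card : ℂ)) =
    ∏ b, halfRising (Finset.univ.filter fun i => c i = b).card := by
  induction n with
  | zero =>
    have h : ∀ s : Equiv.Perm (Fin 0), c ∘ s = c := fun s => Subsingleton.elim _ _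
    have h' : ∀ (s : Equiv.Perm (Fin 0)) (z : Cube 0), Fixes s z :=
      fun s z => Subsingleton.elim _ _
    simp [h, h', halfRising_zero]
  | succ n ih =>
    rw [Finset.sum_filter, ← Equiv.sum_comp Equiv.Perm.decomposeFin.symm, Fintype.sum_prod_type]
    have hterm : ∀ (p : Fin (n + 1)) (e : Equiv.Perm (Fin n)),
        (if c ∘ (Equiv.Perm.decomposeFin.symm (p, e)) = c then
          1 / ((Finset.univ.filter fun z : Cube (n + 1) =>
            Fixes (Equiv.Perm.decomposeFin.symm (p, e)) z).card : ℂ) else 0) =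
        (if c p = c 0 then (if p = 0 then 1 / 2 else 1) else 0) *
          (if Fin.tail c ∘ e = Fin.tail c then
            1 / ((Finset.univ.filter fun z : Cube n => Fixes e z).card : ℂ) else 0) := by
      intro p e
      rw [card_fixed_decomposeFin_symm]
      simp only [comp_decomposeFin_symm]
      by_cases h1 : c p = c 0 <;> by_cases h2 : Fin.tail c ∘ e = Fin.tail c <;>
        by_cases h3 : p = 0 <;> simp [h1, h2, h3, mul_comm]
    simp only [hterm, ← Finset.mul_sum, ← Finset.sum_mul]
    -- Splitting off p = 0 isolates the new cycle; the remaining p count old points with the colour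
    -- of 0.
    rw [← Finset.sum_filter (fun e : Equiv.Perm (Fin n) => Fin.tail c ∘ e = Fin.tail c), ih (Fin.tail c), Fin.sum_univ_succ]
    have hcard : ∀ b, (Finset.univ.filter fun i => c i = b).card =
        (Finset.univ.filter fun i => Fin.tail c i = b).card + if b = c 0 then 1 else 0 := by
      intro b
      rw [Finset.card_filter, Finset.card_filter, Fin.sum_univ_succ, add_comm]
      simp only [Fin.tail, eq_comm]
    have hprod : ∀ b, halfRising (Finset.univ.filter fun i => c i = b).card =
        halfRising (Finset.univ.filter fun i => Fin.tail c i = b).card *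
          if b = c 0 then ((Finset.univ.filter fun i => Fin.tail c i = c 0).card : ℂ) + 1 / 2
          else 1 := by
      intro b
      rw [hcard]
      split_ifs with h
      · rw [halfRising_succ, h]
      · rw [add_zero, mul_one]
    rw [Finset.prod_congr rfl fun b _ => hprod b, Finset.prod_mul_distrib, Finset.prod_ite_eq',
      if_pos (Finset.mem_univ _), mul_comm, Finset.card_filter]
    congr 1
    simp only [if_true, Fin.succ_ne_zero, if_false]
    rw [add_comm, Nat.cast_sum]
    congr 1
    refine Finset.sum_congr rfl fun i _ => ?_
    by_cases hi : c i.succ = c 0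
    · have hi' : Fin.tail c i = c 0 := hi
      rw [if_pos hi, if_pos hi', Nat.cast_one]
    · have hi' : Fin.tail c i ≠ c 0 := hi
      rw [if_neg hi, if_neg hi', Nat.cast_zero]

/-- The number of coordinates at which `x` is `a` and `y` is `b`. -/
def cross {n : ℕ} (x y : Cube n) (a b : Bool) : ℕ :=
  (Finset.univ.filter fun i => (x i, y i) = (a, b)).card

theorem card_stabilizer {n : ℕ} (x : Cube n) :
    (Finset.univ.filter fun s : Equiv.Perm (Fin n) => Fixes s x).card =
      (ones x).factorial * (n - ones x).factorial := by
  have h := DomMulAct.stabilizer_card x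
  rw [Fintype.card_subtype] at h
  have hF : (Finset.univ.filter fun i => x i = false).card = n - ones x := by
    have := Finset.card_filter_add_card_filter_not (s := (Finset.univ : Finset (Fin n)))
      (fun i => x i = true)
    simp only [Bool.not_eq_true, Finset.card_univ, Fintype.card_fin] at this
    rw [ones]
    omega
  simp only [fixes_iff]
  rw [h, Fintype.prod_bool, Fintype.card_subtype, Fintype.card_subtype, hF]
  rfl

theorem cross_add_cross {n : ℕ} (x y : Cube n) :
    cross x y true true + cross x y true false = ones x ∧
    cross x y false true + cross x y false false = n - ones x := by
  have h1 : cross x y true true + cross x y true false = ones x := by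
    have := Finset.card_filter_add_card_filter_not
      (s := (Finset.univ : Finset (Fin n)).filter fun i => x i = true) (fun i => y i = true)
    rw [Finset.filter_filter, Finset.filter_filter] at this
    simpa [cross, ones] using this
  refine ⟨h1, ?_⟩
  have h2 : cross x y false true + cross x y false false =
      (Finset.univ.filter fun i => ¬ x i = true).card := by
    have := Finset.card_filter_add_card_filter_not
      (s := (Finset.univ : Finset (Fin n)).filter fun i => ¬ x i = true) (fun i => y i = true)
    rw [Finset.filter_filter, Finset.filter_filter] at this
    simpa [cross] using this
  have h3 := Finset.card_filter_add_card_filter_not (s := (Finset.univ : Finset (Fin n)))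
      (fun i => x i = true)
  rw [Finset.card_univ, Fintype.card_fin] at h3
  rw [h2, ones]
  omega

theorem burnsideMatrix_apply {n : ℕ} (x y : Cube n) :
    burnsideMatrix n x y = (∏ a, ∏ b, halfRising (cross x y a b)) /
      ((ones x).factorial * (n - ones x).factorial) := by
  have h : (Finset.univ.filter fun s : Equiv.Perm (Fin n) => Fixes s x ∧ Fixes s y) =
      Finset.univ.filter fun s : Equiv.Perm (Fin n) =>
        (fun i => (x i, y i)) ∘ s = fun i => (x i, y i) := by
    refine Finset.filter_congr fun s _ => ?_
    simp only [Fixes, funext_iff, Function.comp_apply, Prod.mk.injEq, forall_and]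
  rw [burnsideMatrix, h, sum_inv_card_fixed, card_stabilizer, Fintype.prod_prod_type]
  push_cast
  rw [one_div, div_eq_inv_mul]
  rfl

/-! ### Reversibility and symmetry of the transition matrix. -/

theorem cross_comm {n : ℕ} (x y : Cube n) (a b : Bool) : cross x y a b = cross y x b a := by
  unfold cross
  congr 1
  ext i
  simp [and_comm]

/-- The factor 1/binom(n, |x|) of the stationary weight and the factor 1/|G_x| combine to 1/n!. What
remains is the product over colour classes, which is symmetric in x and y. -/
theorem burnsideMatrix_reversible {n : ℕ} (x y : Cube n) :
    1 / (((n : ℂ) + 1) * (n.choose (ones x) : ℂ)) * burnsideMatrix n x y =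
      1 / (((n : ℂ) + 1) * (n.choose (ones y) : ℂ)) * burnsideMatrix n y x := by
  have key : ∀ x y : Cube n, 1 / (((n : ℂ) + 1) * (n.choose (ones x) : ℂ)) * burnsideMatrix n x y =
      (∏ a, ∏ b, halfRising (cross x y a b)) / (((n : ℂ) + 1) * n.factorial) := by
    intro x y
    have hc : (n.choose (ones x) : ℂ) * (ones x).factorial * (n - ones x).factorial =
        n.factorial := by
      exact_mod_cast Nat.choose_mul_factorial_mul_factorial (ones_le x)
    rw [burnsideMatrix_apply, div_mul_div_comm, one_mul, ← hc]
    ring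
  rw [key, key, Finset.prod_comm]
  simp only [cross_comm x y]

theorem burnsideMatrix_conj {n : ℕ} (x y : Cube n) :
    (starRingEnd ℂ) (burnsideMatrix n x y) = burnsideMatrix n x y := by
  simp [burnsideMatrix]

theorem burnsideOp_apply {n : ℕ} (f : L n) (x : Cube n) :
    burnsideOp n f x = ∑ y, burnsideMatrix n x y * f y := rfl

theorem innerPi_burnsideOp {n : ℕ} (f g : L n) :
    innerPi (burnsideOp n f) g = innerPi f (burnsideOp n g) := by
  simp only [innerPi, burnsideOp_apply, map_sum, map_mul, burnsideMatrix_conj, Finset.sum_mul,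
    Finset.mul_sum]
  rw [Finset.sum_comm]
  refine Finset.sum_congr rfl fun x _ => Finset.sum_congr rfl fun y _ => ?_
  linear_combination (starRingEnd ℂ) (f x) * g y * burnsideMatrix_reversible y x

theorem burnsideOp_comm_permOp {n : ℕ} (w : Equiv.Perm (Fin n)) :
    Commute (burnsideOp n) (permOp w) := by
  have hcross : ∀ (x y : Cube n) (a b : Bool), cross (x ∘ w) (y ∘ w) a b = cross x y a b := by
    intro x y a b
    unfold cross
    refine Finset.card_bij (fun i _ => w i) ?_ ?_ ?_
    · simp
    · intro a _ b _ h; exact w.injective h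
    · intro b hb; exact ⟨w.symm b, by simpa using hb, by simp⟩
  refine LinearMap.ext fun f => funext fun x => ?_
  rw [Module.End.mul_apply, Module.End.mul_apply, permOp_apply, burnsideOp_apply, burnsideOp_apply]
  refine Fintype.sum_equiv (Equiv.arrowCongr w.symm (Equiv.refl Bool)) _ _ fun y => ?_
  have : (Equiv.arrowCongr w.symm (Equiv.refl Bool)) y = y ∘ w := by
    funext i; simp
  rw [this, permOp_apply, burnsideMatrix_apply, burnsideMatrix_apply, ones_comp]
  simp only [hcross]

theorem burnsideOp_comm_tau {n : ℕ} (j : ℕ) : Commute (burnsideOp n) (tau n j) := by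
  have hjm : ∀ r, Commute (burnsideOp n) (jm n r) := fun r =>
    Commute.sum_right _ _ _ fun i _ => burnsideOp_comm_permOp _
  refine (burnsideOp_comm_permOp _).add_right ?_
  have hd := (hjm j).sub_right (hjm (j + 1))
  by_cases hu : IsUnit (jm n j - jm n (j + 1))
  · obtain ⟨u, hu⟩ := hu
    rw [← hu] at hd ⊢
    rw [Ring.inverse_unit]
    exact hd.units_inv_right
  -- For indices out of range `Ring.inverse` may take its default value 0, which commutes with
  -- everything; hence no bound on j is needed.
  · rw [Ring.inverse_non_unit _ hu]
    exact Commute.zero_right _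

theorem burnsideOp_comm_tauQ {n m : ℕ} {hm : m ≤ n / 2} (Q : StandardTableau (twoRow hm)) :
    Commute (burnsideOp n) (tauQ Q) := by
  refine Commute.list_prod_right _ _ fun F hF => ?_
  obtain ⟨r, _, rfl⟩ := List.mem_map.1 hF
  refine Commute.list_prod_right _ _ fun F hF => ?_
  obtain ⟨j, _, rfl⟩ := List.mem_map.1 hF
  exact burnsideOp_comm_tau j

end Matrix

end BinaryBurnside

namespace BinaryBurnside

open Polynomial TensorProduct

/-! ### The arcsine functional -/

section Arcsine

/-- The expectation of a polynomial in an arcsine distributed variable on `[0, 1]`, which is given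
by the moments `halfRising j / j!`. -/
noncomputable def arcsine : ℂ[X] →ₗ[ℂ] ℂ :=
  (Polynomial.basisMonomials ℂ).constr ℂ fun j => halfRising j / j.factorial

theorem arcsine_X_pow (j : ℕ) : arcsine (X ^ j) = halfRising j / j.factorial := by
  have h := (Polynomial.basisMonomials ℂ).constr_basis ℂ
    (fun j => halfRising j / j.factorial) j
  simp only [Polynomial.coe_basisMonomials, Polynomial.monomial_one_right_eq_X_pow] at h
  exact h

/-- The Beta integral with parameters j + 1/2 and i + 1/2, recovered from the moments by writing one
factor 1 - X as a difference. -/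
theorem arcsine_X_pow_mul (j i : ℕ) :
    arcsine (X ^ j * (1 - X) ^ i) = halfRising j * halfRising i / (j + i).factorial := by
  induction i generalizing j with
  | zero => simp [arcsine_X_pow, halfRising_zero]
  | succ i ih =>
    have : (X : ℂ[X]) ^ j * (1 - X) ^ (i + 1) =
        X ^ j * (1 - X) ^ i - X ^ (j + 1) * (1 - X) ^ i := by ring
    rw [this, map_sub, ih, ih, show j + 1 + i = j + i + 1 by ring, ← add_assoc,
      Nat.factorial_succ, halfRising_succ, halfRising_succ]
    have h1 : ((j + i).factorial : ℂ) ≠ 0 := Nat.cast_ne_zero.2 (Nat.factorial_ne_zero _)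
    have h2 : ((j + i + 1 : ℕ) : ℂ) ≠ 0 := Nat.cast_ne_zero.2 (by omega)
    push_cast at h2 ⊢
    field_simp
    ring

/-- Integration by parts against the density 1/(π √(x(1-x))), since √(x(1-x)) has derivative (1/2 -
x)/√(x(1-x)). Here it is checked on monomials. -/
theorem arcsine_by_parts (g : ℂ[X]) :
    arcsine (X * (1 - X) * derivative g) = arcsine ((X - C (1 / 2)) * g) := by
  induction g using Polynomial.induction_on' with
  | add p q hp hq => rw [derivative_add, mul_add, mul_add, map_add, map_add, hp, hq]
  | monomial j a =>
    rw [← Polynomial.smul_X_eq_monomial, derivative_smul, mul_smul_comm, mul_smul_comm, map_smul,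
      map_smul]
    congr 1
    have hr : (X - C (1 / 2)) * X ^ j = X ^ (j + 1) - (1 / 2 : ℂ) • (X : ℂ[X]) ^ j := by
      rw [smul_eq_C_mul]; ring
    rw [hr, map_sub, map_smul, arcsine_X_pow, arcsine_X_pow, smul_eq_mul]
    cases j with
    | zero => simp [halfRising]
    | succ j =>
      have hl : X * (1 - X) * derivative ((X : ℂ[X]) ^ (j + 1)) =
          ((j : ℂ) + 1) • (X ^ (j + 1) - X ^ (j + 2)) := by
        rw [derivative_X_pow, smul_eq_C_mul]
        simp only [Nat.add_sub_cancel, map_add, map_natCast, Nat.cast_add, Nat.cast_one, map_one]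
        ring
      rw [hl, map_smul, map_sub, arcsine_X_pow, arcsine_X_pow, smul_eq_mul,
        halfRising_succ (j + 1), Nat.factorial_succ (j + 1)]
      have h1 : ((j + 1).factorial : ℂ) ≠ 0 := Nat.cast_ne_zero.2 (Nat.factorial_ne_zero _)
      have h2 : ((j + 1 + 1 : ℕ) : ℂ) ≠ 0 := Nat.cast_ne_zero.2 (by omega)
      push_cast at h2 ⊢
      field_simp
      ring

/-- Integration by parts for g = (2X - 1)^{k+1}, using 4X(1 - X) = 1 - (2X - 1)². -/
theorem arcsine_center_succ (k : ℕ) :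
    ((k : ℂ) + 2) * arcsine ((2 * X - 1) ^ (k + 2)) = (k + 1) * arcsine ((2 * X - 1) ^ k) := by
  have h := arcsine_by_parts ((2 * X - 1) ^ (k + 1))
  have h1 : X * (1 - X) * derivative ((2 * X - 1 : ℂ[X]) ^ (k + 1)) =
      (((k : ℂ) + 1) / 2) • ((2 * X - 1) ^ k - (2 * X - 1) ^ (k + 2)) := by
    rw [derivative_pow, smul_eq_C_mul]
    have : C (((k : ℂ) + 1) / 2) = ((k : ℂ[X]) + 1) * C (1 / 2) := by
      rw [div_eq_mul_one_div, C_mul]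
      simp
    have h2 : (2 : ℂ[X]) * C (1 / 2) = 1 := by
      rw [show (2 : ℂ[X]) = C 2 from rfl, ← C_mul]; norm_num
    rw [this]
    simp only [Nat.add_sub_cancel, map_sub, derivative_mul, derivative_X, derivative_one,
      derivative_ofNat, map_add, map_natCast, Nat.cast_add, Nat.cast_one, map_one]
    linear_combination (-(2 * X * (1 - X)) * (2 * X - 1) ^ k * ((k : ℂ[X]) + 1)) * h2
  have h3 : (X - C (1 / 2)) * (2 * X - 1 : ℂ[X]) ^ (k + 1) =
      (1 / 2 : ℂ) • (2 * X - 1) ^ (k + 2) := by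
    have h2 : (2 : ℂ[X]) * C (1 / 2) = 1 := by
      rw [show (2 : ℂ[X]) = C 2 from rfl, ← C_mul]; norm_num
    rw [smul_eq_C_mul]
    linear_combination (X : ℂ[X]) * (-(2 * X - 1 : ℂ[X]) ^ (k + 1)) * h2
  rw [h1, h3, map_smul, map_smul, map_sub, smul_eq_mul, smul_eq_mul] at h
  linear_combination -2 * h

theorem arcsine_center_odd (k : ℕ) : arcsine ((2 * X - 1) ^ (2 * k + 1)) = 0 := by
  induction k with
  | zero =>
    have h := arcsine_X_pow 1
    have h0 := arcsine_X_pow 0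
    have : (2 * X - 1 : ℂ[X]) ^ (2 * 0 + 1) = (2 : ℂ) • X ^ 1 - X ^ 0 := by
      rw [smul_eq_C_mul, show (C 2 : ℂ[X]) = 2 from rfl]; ring
    rw [this, map_sub, map_smul, h, h0]
    simp [halfRising]
  | succ k ih =>
    have h := arcsine_center_succ (2 * k + 1)
    rw [ih, mul_zero, mul_eq_zero] at h
    refine h.resolve_left ?_
    exact_mod_cast (show 2 * k + 1 + 2 ≠ 0 by omega)

theorem arcsine_center_even (k : ℕ) :
    arcsine ((2 * X - 1) ^ (2 * k)) = (2 * k).factorial / (4 ^ k * (k.factorial : ℂ) ^ 2) := by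
  induction k with
  | zero =>
    have h0 := arcsine_X_pow 0
    rw [pow_zero] at h0
    simp [h0, halfRising]
  | succ k ih =>
    have h := arcsine_center_succ (2 * k)
    have h2 : ((2 * k : ℕ) : ℂ) + 2 ≠ 0 := by exact_mod_cast (show 2 * k + 2 ≠ 0 by omega)
    have h1 : (k.factorial : ℂ) ≠ 0 := Nat.cast_ne_zero.2 (Nat.factorial_ne_zero _)
    have h3 : (k : ℂ) + 1 ≠ 0 := by exact_mod_cast (show k + 1 ≠ 0 by omega)
    rw [show 2 * (k + 1) = 2 * k + 2 by ring]
    apply mul_left_cancel₀ h2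
    rw [h, ih, Nat.factorial_succ (2 * k + 1), Nat.factorial_succ (2 * k), Nat.factorial_succ k]
    push_cast
    field_simp
    ring

/-- The polynomial functions of two variables. -/
abbrev Bivariate : Type := ℂ[X] ⊗[ℂ] ℂ[X]

theorem bivariate_smul (c : ℂ) (t : Bivariate) : c • t = algebraMap ℂ Bivariate c * t :=
  Algebra.smul_def c t

/-- The first variable. -/
noncomputable def varP : Bivariate := X ⊗ₜ 1

/-- The second variable. -/
noncomputable def varQ : Bivariate := 1 ⊗ₜ X

/-- The expectation of a polynomial in two independent arcsine distributed variables. -/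
noncomputable def arcsine₂ : Bivariate →ₗ[ℂ] ℂ :=
  LinearMap.mul' ℂ ℂ ∘ₗ TensorProduct.map arcsine arcsine

theorem arcsine₂_tmul (f g : ℂ[X]) : arcsine₂ (f ⊗ₜ g) = arcsine f * arcsine g := by
  simp [arcsine₂]

theorem varP_sub_varQ : varP - varQ =
    (1 / 2 : ℂ) • ((2 * X - 1 : ℂ[X]) ⊗ₜ[ℂ] 1 + -(1 ⊗ₜ[ℂ] (2 * X - 1 : ℂ[X]))) := by
  have h : (2 * X - 1 : ℂ[X]) = (2 : ℂ) • X - 1 := by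
    rw [smul_eq_C_mul]; rfl
  rw [h, sub_tmul, tmul_sub, TensorProduct.tmul_smul, ← TensorProduct.smul_tmul', varP, varQ]
  module

/-- With b = k - a, binom(2k, 2a) binom(2a, a) binom(2b, b) = binom(2k, k) binom(k, a)². Then ∑
binom(k, a)² = binom(2k, k). -/
theorem sum_choose_mul_center (k : ℕ) :
    ∑ a ∈ Finset.range (k + 1), ((2 * k).choose (2 * a) : ℂ) *
      (((2 * a).factorial / (4 ^ a * (a.factorial : ℂ) ^ 2)) *
        ((2 * (k - a)).factorial / (4 ^ (k - a) * ((k - a).factorial : ℂ) ^ 2))) =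
      ((2 * k).choose k : ℂ) ^ 2 / 4 ^ k := by
  have hV : ((2 * k).choose k : ℂ) = ∑ a ∈ Finset.range (k + 1), (k.choose a : ℂ) ^ 2 := by
    exact_mod_cast (Nat.sum_range_choose_sq k).symm
  rw [sq, hV, Finset.mul_sum, Finset.sum_div, ← hV]
  refine Finset.sum_congr rfl fun a ha => ?_
  have hak : a ≤ k := by have := Finset.mem_range.1 ha; omega
  obtain ⟨b, rfl⟩ := Nat.exists_eq_add_of_le hak
  have e1 : (((2 * (a + b)).choose (2 * a) : ℕ) : ℂ) =
      (2 * (a + b)).factorial / ((2 * a).factorial * (2 * b).factorial) := by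
    rw [Nat.cast_choose ℂ (by omega), show 2 * (a + b) - 2 * a = 2 * b by omega]
  have e2 : (((a + b).choose a : ℕ) : ℂ) =
      (a + b).factorial / (a.factorial * b.factorial) := by
    rw [Nat.cast_choose ℂ (by omega), show a + b - a = b by omega]
  have e3 : (((2 * (a + b)).choose (a + b) : ℕ) : ℂ) =
      (2 * (a + b)).factorial / ((a + b).factorial * (a + b).factorial) := by
    rw [Nat.cast_choose ℂ (by omega), show 2 * (a + b) - (a + b) = a + b by omega]
  rw [e1, e2, e3, show a + b - a = b by omega]
  have f1 : ((2 * a).factorial : ℂ) ≠ 0 := Nat.cast_ne_zero.2 (Nat.factorial_ne_zero _)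
  have f2 : ((2 * b).factorial : ℂ) ≠ 0 := Nat.cast_ne_zero.2 (Nat.factorial_ne_zero _)
  have f3 : (a.factorial : ℂ) ≠ 0 := Nat.cast_ne_zero.2 (Nat.factorial_ne_zero _)
  have f4 : (b.factorial : ℂ) ≠ 0 := Nat.cast_ne_zero.2 (Nat.factorial_ne_zero _)
  have f5 : ((a + b).factorial : ℂ) ≠ 0 := Nat.cast_ne_zero.2 (Nat.factorial_ne_zero _)
  field_simp
  ring

/-- Expand p - q = ((2p - 1) - (2q - 1))/2 binomially. Odd central moments vanish, so for odd j
every term dies and for even j only even exponents survive. -/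
theorem arcsine₂_sub_pow (j : ℕ) :
    arcsine₂ ((varP - varQ) ^ j) = if Even j then beta (j / 2) else 0 := by
  have hterm : ∀ a ∈ Finset.range (j + 1),
      arcsine₂ (((2 * X - 1 : ℂ[X]) ⊗ₜ[ℂ] (1 : ℂ[X])) ^ a *
        (-((1 : ℂ[X]) ⊗ₜ[ℂ] (2 * X - 1 : ℂ[X]))) ^ (j - a) * (j.choose a : Bivariate)) =
      (-1) ^ (j - a) * (j.choose a : ℂ) *
        (arcsine ((2 * X - 1) ^ a) * arcsine ((2 * X - 1) ^ (j - a))) := by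
    intro a _
    rw [neg_pow ((1 : ℂ[X]) ⊗ₜ[ℂ] (2 * X - 1 : ℂ[X])), Algebra.TensorProduct.tmul_pow, Algebra.TensorProduct.tmul_pow, one_pow, one_pow]
    have : (((2 * X - 1 : ℂ[X]) ^ a) ⊗ₜ[ℂ] (1 : ℂ[X])) *
        ((-1) ^ (j - a) * ((1 : ℂ[X]) ⊗ₜ[ℂ] ((2 * X - 1 : ℂ[X]) ^ (j - a)))) *
          (j.choose a : Bivariate) =
        ((-1 : ℂ) ^ (j - a) * (j.choose a : ℂ)) •
          (((2 * X - 1 : ℂ[X]) ^ a) ⊗ₜ[ℂ] ((2 * X - 1 : ℂ[X]) ^ (j - a))) := by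
      have h : (((2 * X - 1 : ℂ[X]) ^ a) ⊗ₜ[ℂ] (1 : ℂ[X])) *
          ((1 : ℂ[X]) ⊗ₜ[ℂ] ((2 * X - 1 : ℂ[X]) ^ (j - a))) =
          ((2 * X - 1 : ℂ[X]) ^ a) ⊗ₜ[ℂ] ((2 * X - 1 : ℂ[X]) ^ (j - a)) := by
        rw [Algebra.TensorProduct.tmul_mul_tmul, one_mul, mul_one]
      have hc : (-1 : Bivariate) ^ (j - a) * (j.choose a : Bivariate) =
          algebraMap ℂ Bivariate ((-1 : ℂ) ^ (j - a) * (j.choose a : ℂ)) := by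
        rw [map_mul, map_pow, map_neg, map_one, map_natCast]
      rw [← h]
      refine Eq.trans ?_ (bivariate_smul _ _).symm
      rw [← hc]
      ring
    rw [this, map_smul, arcsine₂_tmul, smul_eq_mul]
  rw [varP_sub_varQ, _root_.smul_pow, map_smul, add_pow, map_sum, Finset.sum_congr rfl hterm, smul_eq_mul]
  have hodd : ∀ i, ¬ Even i → arcsine ((2 * X - 1) ^ i) = 0 := fun i hi => by
    obtain ⟨k, rfl⟩ := Nat.not_even_iff_odd.1 hi
    exact arcsine_center_odd k
  split_ifs with hj
  · obtain ⟨k, rfl⟩ := hj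
    rw [← two_mul]
    have hsum : ∑ a ∈ Finset.range (2 * k + 1), (-1) ^ (2 * k - a) * ((2 * k).choose a : ℂ) *
        (arcsine ((2 * X - 1) ^ a) * arcsine ((2 * X - 1) ^ (2 * k - a))) =
        ∑ a ∈ (Finset.range (k + 1)).image (2 * ·), (-1) ^ (2 * k - a) * ((2 * k).choose a : ℂ) *
        (arcsine ((2 * X - 1) ^ a) * arcsine ((2 * X - 1) ^ (2 * k - a))) := by
      symm
      refine Finset.sum_subset (fun t ht => ?_) fun t ht ht' => ?_
      · obtain ⟨b, hb, rfl⟩ := Finset.mem_image.1 ht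
        rw [Finset.mem_range] at hb ⊢
        omega
      · rw [hodd t, zero_mul, mul_zero]
        rintro ⟨b, rfl⟩
        refine ht' (Finset.mem_image.2 ⟨b, ?_, (two_mul b)⟩)
        rw [Finset.mem_range] at ht ⊢
        omega
    rw [hsum, Finset.sum_image fun a _ b _ h => by simpa using h]
    have hterm' : ∀ a ∈ Finset.range (k + 1), (-1) ^ (2 * k - 2 * a) * ((2 * k).choose (2 * a) : ℂ) *
        (arcsine ((2 * X - 1) ^ (2 * a)) * arcsine ((2 * X - 1) ^ (2 * k - 2 * a))) =
        ((2 * k).choose (2 * a) : ℂ) *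
      (((2 * a).factorial / (4 ^ a * (a.factorial : ℂ) ^ 2)) *
        ((2 * (k - a)).factorial / (4 ^ (k - a) * ((k - a).factorial : ℂ) ^ 2))) := by
      intro a _
      rw [← Nat.mul_sub, pow_mul, neg_one_sq, one_pow, one_mul, arcsine_center_even,
        arcsine_center_even]
    rw [Finset.sum_congr rfl hterm', sum_choose_mul_center, beta, show 2 * k / 2 = k by omega,
      pow_mul, pow_mul]
    have h4 : ((1 / 2 : ℂ) ^ 2) = 1 / 4 := by norm_num
    have h16 : ((2 : ℂ) ^ 4) = 4 * 4 := by norm_num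
    rw [h4, h16, mul_pow, div_pow, one_pow]
    field_simp
  · rw [Finset.sum_eq_zero, mul_zero]
    intro a ha
    have haj : a ≤ j := by have := Finset.mem_range.1 ha; omega
    by_cases h : Even a
    · rw [hodd (j - a), mul_zero, mul_zero]
      rw [Nat.even_sub haj]
      tauto
    · rw [hodd a h, zero_mul, mul_zero]

end Arcsine

end BinaryBurnside

namespace BinaryBurnside

open Polynomial TensorProduct

/-! ### The transition operator on Specht polynomials -/

section Operator

/-- The transition probabilities of a single coordinate, given the parameters. -/
noncomputable def kernelFactor : Bool → Bool → Bivariate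
  | true, true => varP
  | true, false => 1 - varP
  | false, true => varQ
  | false, false => 1 - varQ

/-- Group the coordinates by (x_i, y_i): those with x_i = 1 give p^a (1-p)^b with a + b = |x|, the
others the same in q. The two Beta integrals reproduce the rising factorials and, in the
denominators, |x|! (n - |x|)!. -/
theorem burnsideMatrix_eq_arcsine₂ {n : ℕ} (x y : Cube n) :
    burnsideMatrix n x y = arcsine₂ (∏ i, kernelFactor (x i) (y i)) := by
  have h1 : ∏ i, kernelFactor (x i) (y i) = ∏ a, ∏ b, kernelFactor a b ^ cross x y a b := by
    rw [← Fintype.prod_prod_type' fun a b => kernelFactor a b ^ cross x y a b,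
      ← Finset.prod_fiberwise Finset.univ fun i => (x i, y i)]
    refine Finset.prod_congr rfl fun c _ => ?_
    rw [cross, ← Finset.prod_const]
    refine Finset.prod_congr rfl fun i hi => ?_
    have := (Finset.mem_filter.1 hi).2
    rw [Prod.mk.injEq] at this
    rw [this.1, this.2]
  have h2 : ∀ a b c d : ℕ, (varP ^ a * (1 - varP) ^ b) * (varQ ^ c * (1 - varQ) ^ d) =
      (X ^ a * (1 - X) ^ b : ℂ[X]) ⊗ₜ[ℂ] (X ^ c * (1 - X) ^ d : ℂ[X]) := by
    intro a b c d
    have hP : 1 - varP = (1 - X : ℂ[X]) ⊗ₜ[ℂ] (1 : ℂ[X]) := by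
      rw [varP, sub_tmul, Algebra.TensorProduct.one_def]
    have hQ : 1 - varQ = (1 : ℂ[X]) ⊗ₜ[ℂ] (1 - X : ℂ[X]) := by
      rw [varQ, tmul_sub, Algebra.TensorProduct.one_def]
    rw [hP, hQ, varP, varQ]
    simp only [Algebra.TensorProduct.tmul_pow, Algebra.TensorProduct.tmul_mul_tmul, one_pow,
      one_mul, mul_one]
  rw [h1, Fintype.prod_bool, Fintype.prod_bool, Fintype.prod_bool]
  simp only [kernelFactor]
  rw [h2, arcsine₂_tmul, arcsine_X_pow_mul, arcsine_X_pow_mul, burnsideMatrix_apply,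
    (cross_add_cross x y).1, (cross_add_cross x y).2, Fintype.prod_bool, Fintype.prod_bool,
    Fintype.prod_bool]
  ring

/-- The conditional expectation of `F(y)` given the parameters, for the chain started at `x`. -/
noncomputable def expect {n : ℕ} (x : Cube n) (F : L n) : Bivariate :=
  ∑ y, F y • ∏ i, kernelFactor (x i) (y i)

theorem burnsideOp_eq_arcsine₂ {n : ℕ} (F : L n) (x : Cube n) :
    burnsideOp n F x = arcsine₂ (expect x F) := by
  rw [burnsideOp_apply, expect, map_sum]
  refine Finset.sum_congr rfl fun y _ => ?_
  rw [map_smul, smul_eq_mul, burnsideMatrix_eq_arcsine₂, mul_comm]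

theorem expect_sum {n : ℕ} {ι : Type*} (s : Finset ι) (x : Cube n) (F : ι → L n) :
    expect x (fun y => ∑ i ∈ s, F i y) = ∑ i ∈ s, expect x (F i) := by
  simp only [expect, Finset.sum_smul]
  rw [Finset.sum_comm]

theorem expect_sub {n : ℕ} (x : Cube n) (F G : L n) :
    expect x (fun y => F y - G y) = expect x F - expect x G := by
  simp only [expect, bivariate_smul, map_sub, sub_mul, Finset.sum_sub_distrib]

theorem prod_subset_Icc {R : Type*} [CommMonoid R] {n : ℕ} {S : Finset ℕ}
    (hS : S ⊆ Finset.Icc 1 n) (f : ℕ → R) :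
    ∏ i ∈ S, f i = ∏ i : Fin n, if (i : ℕ) + 1 ∈ S then f (i + 1) else 1 := by
  rw [Fin.prod_univ_eq_prod_range (fun i => if i + 1 ∈ S then f (i + 1) else 1) n,
    ← Finset.prod_filter]
  refine Finset.prod_bij (fun i _ => i - 1) (fun i hi => ?_) (fun i hi j hj h => ?_)
    (fun i hi => ?_) fun i hi => ?_
  · have := Finset.mem_Icc.1 (hS hi)
    rw [Finset.mem_filter, Finset.mem_range, Nat.sub_add_cancel this.1]
    exact ⟨by omega, hi⟩
  · have := Finset.mem_Icc.1 (hS hi)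
    have := Finset.mem_Icc.1 (hS hj)
    omega
  · exact ⟨i + 1, (Finset.mem_filter.1 hi).2, rfl⟩
  · have := Finset.mem_Icc.1 (hS hi)
    rw [Nat.sub_add_cancel this.1]

theorem bit_succ {n : ℕ} (x : Cube n) (i : Fin n) :
    bit x (i + 1) = if x i = true then 1 else 0 := by
  have h : 1 ≤ (i : ℕ) + 1 ∧ (i : ℕ) + 1 ≤ n := ⟨by omega, i.2⟩
  rw [bit, dif_pos h]
  rfl

/-- The conditional expectation of the `j`-th coordinate. -/
noncomputable def mean {n : ℕ} (x : Cube n) (j : ℕ) : Bivariate :=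
  varQ + bit x j • (varP - varQ)

theorem expect_prod_bit {n : ℕ} (x : Cube n) {S : Finset ℕ} (hS : S ⊆ Finset.Icc 1 n) :
    expect x (fun y => ∏ i ∈ S, bit y i) = ∏ i ∈ S, mean x i := by
  have h : ∀ y : Cube n, (∏ i ∈ S, bit y i) • ∏ i, kernelFactor (x i) (y i) =
      ∏ i : Fin n, (if (i : ℕ) + 1 ∈ S then (if y i = true then (1 : ℂ) else 0) else 1) •
        kernelFactor (x i) (y i) := by
    intro y
    rw [prod_subset_Icc hS]
    simp only [bit_succ]
    rw [bivariate_smul, map_prod, ← Finset.prod_mul_distrib]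
    exact Finset.prod_congr rfl fun i _ => (bivariate_smul _ _).symm
  rw [expect, Finset.sum_congr rfl fun y _ => h y, prod_subset_Icc hS]
  have h2 := Finset.prod_univ_sum (fun _ : Fin n => (Finset.univ : Finset Bool))
    (fun i b => (if (i : ℕ) + 1 ∈ S then (if b = true then (1 : ℂ) else 0) else 1) •
        kernelFactor (x i) b)
  rw [Fintype.piFinset_univ] at h2
  rw [← h2]
  refine Finset.prod_congr rfl fun i _ => ?_
  rw [Fintype.sum_bool, mean, bit_succ]
  by_cases hi : (i : ℕ) + 1 ∈ S <;> cases hx : x i <;> simp [hi, kernelFactor]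

/-- Given p and q the coordinates are independent, and Δ_m ∏_S y_i is multilinear in distinct
coordinates, so each is replaced by its mean. The set S is general because the induction moves a
coordinate of the last column into S. -/
theorem expect_specht {n m : ℕ} (hm : 2 * m ≤ n) (x : Cube n) {S : Finset ℕ}
    (hS : S ⊆ Finset.Icc (2 * m + 1) n) :
    expect x (fun y => specht m (bit y) * ∏ i ∈ S, bit y i) =
      (∏ p ∈ Finset.range m, (mean x (2 * p + 2) - mean x (2 * p + 1))) *
        ∏ i ∈ S, mean x i := by
  induction m generalizing S with
  | zero => simpa [specht] using expect_prod_bit x hS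
  | succ m ih =>
    have hmem : ∀ j ∈ S, 2 * m + 3 ≤ j ∧ j ≤ n := fun j hj => by
      have := Finset.mem_Icc.1 (hS hj); omega
    have h1 : 2 * m + 1 ∉ S := fun h => by have := hmem _ h; omega
    have h2 : 2 * m + 2 ∉ S := fun h => by have := hmem _ h; omega
    have hsub : ∀ j, j = 2 * m + 1 ∨ j = 2 * m + 2 → insert j S ⊆ Finset.Icc (2 * m + 1) n := by
      intro j hj t ht
      rw [Finset.mem_insert] at ht
      rw [Finset.mem_Icc]
      rcases ht with rfl | ht
      · omega
      · have := hmem t ht; omega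
    have e1 := ih (by omega) (hsub _ (Or.inl rfl))
    have e2 := ih (by omega) (hsub _ (Or.inr rfl))
    simp only [Finset.prod_insert h1, Finset.prod_insert h2] at e1 e2
    have hF : (fun y : Cube n => specht (m + 1) (bit y) * ∏ i ∈ S, bit y i) = fun y =>
        specht m (bit y) * (bit y (2 * m + 2) * ∏ i ∈ S, bit y i) -
        specht m (bit y) * (bit y (2 * m + 1) * ∏ i ∈ S, bit y i) := by
      funext y
      rw [specht, Finset.prod_range_succ, specht]
      ring
    rw [hF, expect_sub, e1, e2, Finset.prod_range_succ]
    ring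

theorem prod_mean_sub {n m : ℕ} (x : Cube n) :
    ∏ p ∈ Finset.range m, (mean x (2 * p + 2) - mean x (2 * p + 1)) =
      specht m (bit x) • (varP - varQ) ^ m := by
  have h : ∀ p ∈ Finset.range m, mean x (2 * p + 2) - mean x (2 * p + 1) =
      algebraMap ℂ Bivariate (bit x (2 * p + 2) - bit x (2 * p + 1)) * (varP - varQ) := by
    intro p _
    rw [mean, mean, bivariate_smul, bivariate_smul, map_sub]
    ring
  rw [Finset.prod_congr rfl h, Finset.prod_mul_distrib, Finset.prod_const, Finset.card_range,
    ← map_prod, bivariate_smul]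
  rfl

theorem bit_eq_zero_or_one {n : ℕ} (x : Cube n) (j : ℕ) : bit x j = 0 ∨ bit x j = 1 := by
  unfold bit
  split_ifs <;> simp

/-- The number of ones of `x` at the positions `2m + 1, …, n`. -/
noncomputable def restOnes {n : ℕ} (m : ℕ) (x : Cube n) : ℕ :=
  ((Finset.Icc (2 * m + 1) n).filter fun i => bit x i = 1).card

/-! ### Elementary symmetric functions of the remaining coordinates and triangularity. -/

theorem sum_powersetCard_prod_bit {n : ℕ} (m d : ℕ) (x : Cube n) :
    ∑ S ∈ (Finset.Icc (2 * m + 1) n).powersetCard d, ∏ i ∈ S, bit x i =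
      ((restOnes m x).choose d : ℂ) := by
  set F := (Finset.Icc (2 * m + 1) n).filter fun i => bit x i = 1 with hF
  have h : ∀ S ∈ (Finset.Icc (2 * m + 1) n).powersetCard d, ∏ i ∈ S, bit x i =
      if S ⊆ F then 1 else 0 := by
    intro S hS
    rw [Finset.mem_powersetCard] at hS
    split_ifs with hSF
    · exact Finset.prod_eq_one fun i hi => (Finset.mem_filter.1 (hSF hi)).2
    · obtain ⟨i, hi, hiF⟩ := Finset.not_subset.1 hSF
      refine Finset.prod_eq_zero hi ((bit_eq_zero_or_one x i).resolve_right fun h1 => hiF ?_)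
      exact Finset.mem_filter.2 ⟨hS.1 hi, h1⟩
  rw [Finset.sum_congr rfl h, ← Finset.sum_filter, Finset.sum_const, nsmul_eq_mul, mul_one, restOnes,
    ← hF, ← Finset.card_powersetCard]
  congr 2
  ext S
  simp only [Finset.mem_filter, Finset.mem_powersetCard]
  exact ⟨fun h => ⟨h.2, h.1.2⟩, fun h => ⟨⟨h.1.trans (Finset.filter_subset _ _), h.2⟩, h.1⟩⟩

/-- Expand each product over U ⊆ S, with |U| = u, and exchange the sums: a given U lies in binom(|R|
- u, d - u) sets S of size d. -/
theorem sum_powersetCard_prod_add {α A : Type*} [DecidableEq α] [CommRing A]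
    (R : Finset α) (d : ℕ) (b : α → A) (q δ : A) :
    ∑ S ∈ R.powersetCard d, ∏ i ∈ S, (q + b i * δ) =
      ∑ u ∈ Finset.range (d + 1), ((R.card - u).choose (d - u) : A) *
        (δ ^ u * q ^ (d - u)) * ∑ U ∈ R.powersetCard u, ∏ i ∈ U, b i := by
  have h1 : ∀ S ∈ R.powersetCard d, ∏ i ∈ S, (q + b i * δ) =
      ∑ u ∈ Finset.range (d + 1), ∑ U ∈ (R.powersetCard u).filter (· ⊆ S),
        δ ^ u * q ^ (d - u) * ∏ i ∈ U, b i := by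
    intro S hS
    rw [Finset.mem_powersetCard] at hS
    simp only [add_comm q]
    rw [Finset.prod_add, Finset.sum_powerset, hS.2]
    refine Finset.sum_congr rfl fun u _ => ?_
    have : (R.powersetCard u).filter (· ⊆ S) = S.powersetCard u := by
      ext U
      simp only [Finset.mem_filter, Finset.mem_powersetCard]
      exact ⟨fun h => ⟨h.2, h.1.2⟩, fun h => ⟨⟨h.1.trans hS.1, h.2⟩, h.1⟩⟩
    rw [this]
    refine Finset.sum_congr rfl fun U hU => ?_
    rw [Finset.mem_powersetCard] at hU
    rw [Finset.prod_mul_distrib, Finset.prod_const, Finset.prod_const,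
      Finset.card_sdiff_of_subset hU.1, hU.2, hS.2]
    ring
  rw [Finset.sum_congr rfl h1, Finset.sum_comm]
  refine Finset.sum_congr rfl fun u hu => ?_
  have hu' : u ≤ d := by have := Finset.mem_range.1 hu; omega
  simp only [Finset.sum_filter]
  rw [Finset.sum_comm, Finset.mul_sum]
  refine Finset.sum_congr rfl fun U hU => ?_
  rw [Finset.mem_powersetCard] at hU
  rw [← Finset.sum_filter, Finset.sum_const,
    Finset.card_filter_powersetCard_subset _ _ _ hU.1 (hU.2.le.trans hu'), hU.2, nsmul_eq_mul]
  ring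

/-- Where Δ_m does not vanish, each of its m pairs contains exactly one 1. -/
theorem ones_eq {n m : ℕ} (hm : 2 * m ≤ n) {x : Cube n} (hx : specht m (bit x) ≠ 0) :
    ones x = m + restOnes m x := by
  have h1 : (ones x : ℂ) = ∑ i ∈ Finset.Ico 1 (n + 1), bit x i := by
    rw [ones, Finset.card_filter, Finset.sum_Ico_eq_sum_range, Nat.add_sub_cancel,
      ← Fin.sum_univ_eq_sum_range (fun i => bit x (1 + i)) n]
    push_cast
    refine Finset.sum_congr rfl fun i _ => ?_
    rw [add_comm 1, bit_succ]
  have h2 : (restOnes m x : ℂ) = ∑ i ∈ Finset.Ico (2 * m + 1) (n + 1), bit x i := by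
    rw [restOnes, Finset.card_filter]
    push_cast
    refine Finset.sum_congr rfl fun i _ => ?_
    rcases bit_eq_zero_or_one x i with h | h <;> simp [h]
  have h3 : ∑ i ∈ Finset.Ico 1 (2 * m + 1), bit x i = m := by
    rw [sum_Ico_pairs, Finset.sum_congr rfl (g := fun _ => (1 : ℂ))]
    · simp
    · intro p hp
      have := Finset.prod_ne_zero_iff.1 hx p hp
      rcases bit_eq_zero_or_one x (2 * p + 1) with h | h <;>
        rcases bit_eq_zero_or_one x (2 * p + 2) with h' | h' <;> simp_all
  have : (ones x : ℂ) = (m + restOnes m x : ℕ) := by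
    rw [h1, ← Finset.sum_Ico_consecutive _ (show 1 ≤ 2 * m + 1 by omega)
      (show 2 * m + 1 ≤ n + 1 by omega), h3, Nat.cast_add, h2]
  exact_mod_cast this

theorem spechtFn_apply {n m : ℕ} (hm : 2 * m ≤ n) (φ : ℕ → ℂ) (x : Cube n) :
    spechtFn n m φ x = specht m (bit x) * φ (m + restOnes m x) := by
  rw [spechtFn]
  by_cases hx : specht m (bit x) = 0
  · rw [hx, zero_mul, zero_mul]
  · rw [ones_eq hm hx]

/-- The function `binom(|x| - m, d)`. -/
def shiftedChoose (m d : ℕ) (j : ℕ) : ℂ := ((j - m).choose d : ℂ)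

/-- On the support of Δ_m, binom(|x| - m, d) is the d-th elementary symmetric function of the
coordinates beyond 2m. Replacing y_i by its mean q + x_i(p - q) turns Δ_m into (p - q)^m Δ_m and the
symmetric function into a combination of those of degree u ≤ d; the term u = d has coefficient E[(p
- q)^{m+d}]. -/
theorem burnsideOp_spechtFn {n m : ℕ} (hm : 2 * m ≤ n) (d : ℕ) :
    burnsideOp n (spechtFn n m (shiftedChoose m d)) =
      ∑ u ∈ Finset.range (d + 1), (((n - 2 * m - u).choose (d - u) : ℂ) *
        arcsine₂ ((varP - varQ) ^ (m + u) * varQ ^ (d - u))) •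
          spechtFn n m (shiftedChoose m u) := by
  have hval : ∀ (e : ℕ) (y : Cube n), spechtFn n m (shiftedChoose m e) y =
      ∑ S ∈ (Finset.Icc (2 * m + 1) n).powersetCard e, specht m (bit y) * ∏ i ∈ S, bit y i := by
    intro e y
    rw [spechtFn_apply hm, shiftedChoose, Nat.add_sub_cancel_left, ← sum_powersetCard_prod_bit,
      Finset.mul_sum]
  funext x
  rw [burnsideOp_eq_arcsine₂, funext (hval d), expect_sum, Finset.sum_congr rfl fun S hS =>
    expect_specht hm x (Finset.mem_powersetCard.1 hS).1, ← Finset.mul_sum, prod_mean_sub]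
  have hmean : ∀ i, mean x i = varQ + algebraMap ℂ Bivariate (bit x i) * (varP - varQ) := fun i => by
    rw [mean, bivariate_smul]
  simp only [hmean]
  rw [sum_powersetCard_prod_add, Nat.card_Icc, show n + 1 - (2 * m + 1) = n - 2 * m by omega,
    Finset.mul_sum, map_sum, Finset.sum_apply]
  refine Finset.sum_congr rfl fun u _ => ?_
  have hsum : ∑ U ∈ (Finset.Icc (2 * m + 1) n).powersetCard u,
      ∏ i ∈ U, algebraMap ℂ Bivariate (bit x i) =
      algebraMap ℂ Bivariate ((restOnes m x).choose u : ℂ) := by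
    rw [← sum_powersetCard_prod_bit, map_sum]
    exact Finset.sum_congr rfl fun U _ => (map_prod _ _ _).symm
  have hterm : specht m (bit x) • (varP - varQ) ^ m *
      (((n - 2 * m - u).choose (d - u) : Bivariate) * ((varP - varQ) ^ u * varQ ^ (d - u)) *
        algebraMap ℂ Bivariate ((restOnes m x).choose u : ℂ)) =
      (((n - 2 * m - u).choose (d - u) : ℂ) * (specht m (bit x) * ((restOnes m x).choose u : ℂ))) •
        ((varP - varQ) ^ (m + u) * varQ ^ (d - u)) := by
    rw [bivariate_smul, bivariate_smul, map_mul, map_mul, pow_add]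
    simp only [map_natCast]
    ring
  rw [hsum, hterm, map_smul, Pi.smul_apply, spechtFn_apply hm, shiftedChoose,
    Nat.add_sub_cancel_left, smul_eq_mul, smul_eq_mul]
  ring

end Operator

end BinaryBurnside

namespace BinaryBurnside

open Polynomial

/-! ### Hahn polynomials -/

section Hahn

/-- Combinatorially, sort the (r+s+1)-subsets of {0, …, M} by their (r+1)-st element t. The proof
uses Pascal's rule. -/
theorem sum_choose_mul_choose (M r s : ℕ) :
    ∑ t ∈ Finset.range (M + 1), t.choose r * (M - t).choose s = (M + 1).choose (r + s + 1) := by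
  induction M generalizing s with
  | zero =>
    rcases r with _ | r <;> rcases s with _ | s <;> simp [Nat.choose_eq_zero_of_lt]
  | succ M ih =>
    cases s with
    | zero =>
      have h := ih 0
      simp only [Nat.choose_zero_right, mul_one, add_zero] at h ⊢
      rw [Finset.sum_range_succ, h, Nat.choose_succ_succ (M + 1) r, add_comm]
    | succ s =>
      rw [Finset.sum_range_succ, Nat.sub_self, Nat.choose_zero_succ, mul_zero, add_zero]
      have : ∀ t ∈ Finset.range (M + 1), t.choose r * (M + 1 - t).choose (s + 1) =
          t.choose r * (M - t).choose s + t.choose r * (M - t).choose (s + 1) := by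
        intro t ht
        rw [Finset.mem_range] at ht
        rw [show M + 1 - t = M - t + 1 by omega, Nat.choose_succ_succ, mul_add]
      rw [Finset.sum_congr rfl this, Finset.sum_add_distrib, ih, ih, ← add_assoc r s 1,
        Nat.choose_succ_succ (M + 1)]

/-- The same convolution: terms outside the window a ≤ t ≤ a + N vanish, because a ≤ r and b ≤ s. -/
theorem sum_shifted_choose_mul_choose (N a b : ℕ) {r s : ℕ} (hr : a ≤ r) (hs : b ≤ s) :
    ∑ i ∈ Finset.range (N + 1), (a + i).choose r * (b + N - i).choose s =
      (a + b + N + 1).choose (r + s + 1) := by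
  rw [← sum_choose_mul_choose]
  symm
  have hsub : (Finset.range (N + 1)).map (addLeftEmbedding a) ⊆ Finset.range (a + b + N + 1) := by
    intro t ht
    obtain ⟨i, hi, rfl⟩ := Finset.mem_map.1 ht
    rw [Finset.mem_range] at hi ⊢
    simp only [addLeftEmbedding_apply]
    omega
  rw [← Finset.sum_subset hsub, Finset.sum_map]
  · refine Finset.sum_congr rfl fun i _ => ?_
    simp only [addLeftEmbedding_apply]
    rw [show a + b + N - (a + i) = b + N - i by omega]
  · intro t ht ht'
    rw [Finset.mem_range] at ht
    by_cases h1 : t < a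
    · rw [Nat.choose_eq_zero_of_lt (by omega), zero_mul]
    · by_cases h2 : t ≤ a + N
      · exact absurd (Finset.mem_map.2 ⟨t - a, Finset.mem_range.2 (by omega),
          by simp only [addLeftEmbedding_apply]; omega⟩) ht'
      · rw [Nat.choose_eq_zero_of_lt (k := s) (by omega), mul_zero]

theorem sum_powersetCard_card_inter {N i l : ℕ} (hi : i ≤ N) (F : ℕ → ℂ) :
    ∑ S ∈ (Finset.Icc 1 N).powersetCard l, F (S ∩ Finset.Icc 1 i).card =
      ∑ k ∈ Finset.range (l + 1), ((i.choose k : ℂ) * ((N - i).choose (l - k) : ℂ)) * F k := by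
  have hmaps : ∀ S ∈ (Finset.Icc 1 N).powersetCard l,
      (S ∩ Finset.Icc 1 i).card ∈ Finset.range (l + 1) := by
    intro S hS
    rw [Finset.mem_powersetCard] at hS
    have := Finset.card_le_card (Finset.inter_subset_left (s₁ := S) (s₂ := Finset.Icc 1 i))
    rw [Finset.mem_range]
    omega
  have hsub : Finset.Icc 1 i ⊆ Finset.Icc 1 N := Finset.Icc_subset_Icc_right hi
  rw [← Finset.sum_fiberwise_of_maps_to hmaps]
  refine Finset.sum_congr rfl fun k hk => ?_
  rw [Finset.mem_range] at hk
  rw [Finset.sum_congr rfl fun S hS => by rw [(Finset.mem_filter.1 hS).2], Finset.sum_const,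
    nsmul_eq_mul]
  congr 1
  have hcard : i.choose k * (N - i).choose (l - k) =
      ((Finset.Icc 1 i).powersetCard k ×ˢ
        (Finset.Icc 1 N \ Finset.Icc 1 i).powersetCard (l - k)).card := by
    rw [Finset.card_product, Finset.card_powersetCard, Finset.card_powersetCard,
      Finset.card_sdiff_of_subset hsub]
    simp
  rw [← Nat.cast_mul, hcard]
  congr 1
  refine Finset.card_bij' (fun S _ => (S ∩ Finset.Icc 1 i, S \ Finset.Icc 1 i))
    (fun T _ => T.1 ∪ T.2) (fun S hS => ?_) (fun T hT => ?_) (fun S _ => ?_) (fun T hT => ?_)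
  · rw [Finset.mem_filter, Finset.mem_powersetCard] at hS
    rw [Finset.mem_product, Finset.mem_powersetCard, Finset.mem_powersetCard]
    refine ⟨⟨Finset.inter_subset_right, hS.2⟩, Finset.sdiff_subset_sdiff hS.1.1 le_rfl, ?_⟩
    have := Finset.card_sdiff_add_card_inter S (Finset.Icc 1 i)
    simp only
    omega
  · rw [Finset.mem_product, Finset.mem_powersetCard, Finset.mem_powersetCard,
      Finset.subset_sdiff] at hT
    rw [Finset.mem_filter, Finset.mem_powersetCard, Finset.card_union_of_disjoint
      (hT.2.1.2.symm.mono_left hT.1.1), Finset.union_inter_distrib_right,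
      Finset.inter_eq_left.2 hT.1.1, Finset.disjoint_iff_inter_eq_empty.1 hT.2.1.2, Finset.union_empty]
    exact ⟨⟨Finset.union_subset (hT.1.1.trans hsub) hT.2.1.1, by omega⟩, hT.1.2⟩
  · exact (Finset.union_comm _ _).trans (Finset.sdiff_union_inter S _)
  · rw [Finset.mem_product, Finset.mem_powersetCard, Finset.mem_powersetCard,
      Finset.subset_sdiff] at hT
    refine Prod.ext ?_ ?_
    · simp only
      rw [Finset.union_inter_distrib_right,
        Finset.inter_eq_left.2 hT.1.1, Finset.disjoint_iff_inter_eq_empty.1 hT.2.1.2, Finset.union_empty]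
    · simp only
      rw [Finset.union_sdiff_distrib, Finset.sdiff_eq_empty_iff_subset.2 hT.1.1, Finset.empty_union,
        hT.2.1.2.sdiff_eq_left]

theorem tScalar_eq {m n l i : ℕ} (hi : i ≤ n - 2 * m) :
    tScalar m n l i = ∑ k ∈ Finset.range (l + 1),
      ((i.choose k : ℂ) * ((n - 2 * m - i).choose (l - k) : ℂ)) *
        ((-1) ^ (m + k) * ((2 * m + l).choose (m + k) : ℂ)) :=
  sum_powersetCard_card_inter hi fun k => (-1) ^ (m + k) * ((2 * m + l).choose (m + k) : ℂ)

theorem tScalar_zero_ne_zero {m n l : ℕ} (hl : l ≤ n - 2 * m) : tScalar m n l 0 ≠ 0 := by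
  rw [tScalar_eq (Nat.zero_le _), Finset.sum_eq_single 0]
  · have h1 : (n - 2 * m).choose l ≠ 0 := (Nat.choose_pos hl).ne'
    have h2 : (2 * m + l).choose m ≠ 0 := (Nat.choose_pos (by omega)).ne'
    simp [h1, h2]
  · intro k _ hk
    rw [Nat.choose_eq_zero_of_lt (Nat.pos_of_ne_zero hk)]
    simp
  · simp

theorem tScalar_conj (m n l i : ℕ) : (starRingEnd ℂ) (tScalar m n l i) = tScalar m n l i := by
  simp [tScalar]

/-- The falling factorials as a sequence of polynomials. -/
noncomputable def fallingSequence : Polynomial.Sequence ℂ where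
  elems' := descPochhammer ℂ
  degree_eq' i := by
    rw [degree_eq_natDegree (monic_descPochhammer ℂ i).ne_zero, descPochhammer_natDegree]

/-- The polynomials `(X + m + 1) (X + m + 2) ⋯ (X + m + j)`. -/
noncomputable def shiftedRising (m : ℕ) : Polynomial.Sequence ℂ where
  elems' j := (ascPochhammer ℂ j).comp (X + C ((m : ℂ) + 1))
  degree_eq' j := by
    have hm : ((ascPochhammer ℂ j).comp (X + C ((m : ℂ) + 1))).Monic :=
      (monic_ascPochhammer ℂ j).comp_X_add_C _
    rw [degree_eq_natDegree hm.ne_zero, natDegree_comp, ascPochhammer_natDegree,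
      natDegree_X_add_C, mul_one]

theorem shiftedRising_eval (m j i : ℕ) :
    (shiftedRising m j).eval (i : ℂ) = (m + i + j).factorial / (m + i).factorial := by
  have h1 : (shiftedRising m j).eval (i : ℂ) = (ascPochhammer ℂ j).eval ((m + i + 1 : ℕ) : ℂ) := by
    change ((ascPochhammer ℂ j).comp (X + C ((m : ℂ) + 1))).eval (i : ℂ) = _
    rw [eval_comp]
    congr 1
    simp
    ring
  rw [h1, ascPochhammer_nat_eq_natCast_ascFactorial, eq_div_iff
    (Nat.cast_ne_zero.2 (Nat.factorial_ne_zero _)), mul_comm]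
  exact_mod_cast Nat.factorial_mul_ascFactorial (m + i) j

/-! ### Orthogonality of the Hahn polynomials to lower degrees. -/

theorem sum_neg_one_pow_choose_mul_eval {l : ℕ} {P : ℂ[X]} (hP : P.natDegree < l) :
    ∑ k ∈ Finset.range (l + 1), (-1 : ℂ) ^ k * (l.choose k : ℂ) * P.eval (k : ℂ) = 0 := by
  have h := congrFun (Polynomial.fwdDiff_iter_eq_zero_of_degree_lt hP) 0
  rw [fwdDiff_iter_eq_sum_shift] at h
  have h2 : (-1 : ℂ) ^ l * ∑ k ∈ Finset.range (l + 1),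
      ((-1 : ℤ) ^ (l - k) * l.choose k) • P.eval (0 + k • (1 : ℂ)) = 0 := by
    rw [h]; simp
  rw [← h2, Finset.mul_sum]
  refine Finset.sum_congr rfl fun k hk => ?_
  have hk' : k ≤ l := by have := Finset.mem_range.1 hk; omega
  obtain ⟨j, rfl⟩ := Nat.exists_eq_add_of_le hk'
  rw [Nat.add_sub_cancel_left, zsmul_eq_mul, zero_add, nsmul_one]
  push_cast
  have hj : (-1 : ℂ) ^ j * (-1) ^ j = 1 := by rw [← mul_pow]; simp
  rw [pow_add]
  linear_combination (-(-1 : ℂ) ^ k * ((k + j).choose k : ℂ) * P.eval (k : ℂ)) * hj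

/-- The weight for which the Hahn polynomials are orthogonal. -/
noncomputable def hahnWeight (m N i : ℕ) : ℂ := (N.choose i : ℂ) / ((2 * m + N).choose (m + i) : ℂ)

/-- Rearranges factorials so that i survives only in two binomials with tops m + j + i and m + N -
i, the shape required by the convolution. The test polynomials (X+m+1)⋯(X+m+j) serve this purpose:
their value (m+i+j)!/(m+i)! cancels a factorial of the weight. -/
theorem hahnWeight_mul {m N i j k l : ℕ} (hi : i ≤ N) (hk : k ≤ l) :
    hahnWeight m N i * ((m + i + j).factorial / (m + i).factorial) *
      ((i.choose k : ℂ) * ((N - i).choose (l - k) : ℂ)) =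
    (N.factorial : ℂ) / (2 * m + N).factorial * ((m + j + k).factorial * (m + (l - k)).factorial /
      (k.factorial * (l - k).factorial)) *
      (((m + j + i).choose (m + j + k) * (m + N - i).choose (m + (l - k)) : ℕ) : ℂ) := by
  obtain ⟨b, rfl⟩ := Nat.exists_eq_add_of_le hi
  obtain ⟨c, rfl⟩ := Nat.exists_eq_add_of_le hk
  simp only [Nat.add_sub_cancel_left]
  rw [show m + (i + b) - i = m + b by omega]
  by_cases h1 : i < k
  · rw [Nat.choose_eq_zero_of_lt h1, Nat.choose_eq_zero_of_lt (show m + j + i < m + j + k by omega)]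
    simp
  by_cases h2 : b < c
  · rw [Nat.choose_eq_zero_of_lt h2, Nat.choose_eq_zero_of_lt (show m + b < m + c by omega)]
    simp
  obtain ⟨i, rfl⟩ := Nat.exists_eq_add_of_le (not_lt.1 h1)
  obtain ⟨b, rfl⟩ := Nat.exists_eq_add_of_le (not_lt.1 h2)
  have f : ∀ t : ℕ, (t.factorial : ℂ) ≠ 0 := fun t => Nat.cast_ne_zero.2 (Nat.factorial_ne_zero _)
  have hch : ∀ a b : ℕ, ((a + b).choose a : ℂ) =
      (a + b).factorial / (a.factorial * b.factorial) := fun a b => by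
    rw [Nat.cast_choose ℂ (Nat.le_add_right a b), Nat.add_sub_cancel_left]
  have e1 := hch (k + i) (c + b)
  have e2 := hch (m + (k + i)) (m + (c + b))
  have e3 := hch k i
  have e4 := hch c b
  have e5 := hch (m + j + k) i
  have e6 := hch (m + c) b
  rw [show m + (k + i) + (m + (c + b)) = 2 * m + (k + i + (c + b)) by ring] at e2
  rw [show m + j + k + i = m + j + (k + i) by ring] at e5
  rw [show m + c + b = m + (c + b) by ring] at e6
  rw [hahnWeight, Nat.cast_mul, e1, e2, e3, e4, e5, e6,
    show m + (k + i) + j = m + j + (k + i) by ring]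
  have := f (k + i)
  have := f (c + b)
  have := f (2 * m + (k + i + (c + b)))
  have := f (k + i + (c + b))
  have := f (m + (k + i))
  have := f (m + (c + b))
  have := f k
  have := f i
  have := f c
  have := f b
  have := f (m + j + k)
  have := f (m + c)
  have := f (m + j + (k + i))
  field_simp

/-- Summing over i first gives a binomial coefficient free of k. What remains over k is an l-th
finite difference of a polynomial of degree j < l. -/
theorem sum_hahnWeight_mul_shiftedRising {m n l j : ℕ} (hm : 2 * m ≤ n) (hj : j < l) :
    ∑ i ∈ Finset.range (n - 2 * m + 1), hahnWeight m (n - 2 * m) i *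
      (tScalar m n l i * (shiftedRising m j).eval (i : ℂ)) = 0 := by
  obtain ⟨N, rfl⟩ := Nat.exists_eq_add_of_le hm
  rw [Nat.add_sub_cancel_left]
  have h1 : ∀ i ∈ Finset.range (N + 1), hahnWeight m N i *
      (tScalar m (2 * m + N) l i * (shiftedRising m j).eval (i : ℂ)) =
      ∑ k ∈ Finset.range (l + 1), (N.factorial : ℂ) / (2 * m + N).factorial *
        ((m + j + k).factorial * (m + (l - k)).factorial / (k.factorial * (l - k).factorial)) *
        ((-1) ^ (m + k) * ((2 * m + l).choose (m + k) : ℂ)) *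
        (((m + j + i).choose (m + j + k) * (m + N - i).choose (m + (l - k)) : ℕ) : ℂ) := by
    intro i hi
    have hi' : i ≤ N := by have := Finset.mem_range.1 hi; omega
    rw [tScalar_eq (by omega), Nat.add_sub_cancel_left, shiftedRising_eval, Finset.sum_mul,
      Finset.mul_sum]
    refine Finset.sum_congr rfl fun k hk => ?_
    have hk' : k ≤ l := by have := Finset.mem_range.1 hk; omega
    linear_combination ((-1) ^ (m + k) * ((2 * m + l).choose (m + k) : ℂ)) *
      hahnWeight_mul (m := m) (j := j) hi' hk'
  rw [Finset.sum_congr rfl h1, Finset.sum_comm]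
  have h2 : ∀ k ∈ Finset.range (l + 1), ∑ i ∈ Finset.range (N + 1),
      (N.factorial : ℂ) / (2 * m + N).factorial *
        ((m + j + k).factorial * (m + (l - k)).factorial / (k.factorial * (l - k).factorial)) *
        ((-1) ^ (m + k) * ((2 * m + l).choose (m + k) : ℂ)) *
        (((m + j + i).choose (m + j + k) * (m + N - i).choose (m + (l - k)) : ℕ) : ℂ) =
      ((N.factorial : ℂ) / (2 * m + N).factorial * ((-1) ^ m * (2 * m + l).factorial / l.factorial) *
        ((2 * m + j + N + 1).choose (2 * m + j + l + 1) : ℂ)) *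
        ((-1) ^ k * (l.choose k : ℂ) * (shiftedRising m j).eval (k : ℂ)) := by
    intro k hk
    have hk' : k ≤ l := by have := Finset.mem_range.1 hk; omega
    obtain ⟨c, rfl⟩ := Nat.exists_eq_add_of_le hk'
    rw [← Finset.mul_sum, ← Nat.cast_sum, Nat.add_sub_cancel_left,
      sum_shifted_choose_mul_choose N (m + j) m (by omega) (by omega),
      show m + j + m + N + 1 = 2 * m + j + N + 1 by ring,
      show m + j + k + (m + c) + 1 = 2 * m + j + (k + c) + 1 by ring, shiftedRising_eval,
      Nat.cast_choose ℂ (show m + k ≤ 2 * m + (k + c) by omega),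
      Nat.cast_choose ℂ (show k ≤ k + c by omega),
      show 2 * m + (k + c) - (m + k) = m + c by omega, Nat.add_sub_cancel_left,
      show m + k + j = m + j + k by ring, pow_add]
    have f : ∀ t : ℕ, (t.factorial : ℂ) ≠ 0 := fun t =>
      Nat.cast_ne_zero.2 (Nat.factorial_ne_zero _)
    have := f (2 * m + N)
    have := f (k + c)
    have := f (m + k)
    have := f (m + c)
    have := f k
    have := f c
    field_simp
  rw [Finset.sum_congr rfl h2, ← Finset.mul_sum,
    sum_neg_one_pow_choose_mul_eval (by rwa [(shiftedRising m).natDegree_eq]), mul_zero]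

theorem sum_hahnWeight_mul_eval {m n l : ℕ} (hm : 2 * m ≤ n) {P : ℂ[X]} (hP : P ∈ degreeLT ℂ l) :
    ∑ i ∈ Finset.range (n - 2 * m + 1), hahnWeight m (n - 2 * m) i *
      (tScalar m n l i * P.eval (i : ℂ)) = 0 := by
  rw [← (shiftedRising m).span_degreeLT fun i _ => isUnit_iff_ne_zero.2
    (leadingCoeff_ne_zero.2 ((shiftedRising m).ne_zero i))] at hP
  induction hP using Submodule.span_induction with
  | mem P hP =>
    obtain ⟨j, hj, rfl⟩ := hP
    exact sum_hahnWeight_mul_shiftedRising hm hj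
  | zero => simp
  | add P Q _ _ hP hQ => simp only [eval_add, mul_add, Finset.sum_add_distrib, hP, hQ, add_zero]
  | smul a P _ hP =>
    have : ∀ i ∈ Finset.range (n - 2 * m + 1), hahnWeight m (n - 2 * m) i *
        (tScalar m n l i * (a • P).eval (i : ℂ)) = a * (hahnWeight m (n - 2 * m) i *
        (tScalar m n l i * P.eval (i : ℂ))) := fun i _ => by
      rw [eval_smul, smul_eq_mul]; ring
    rw [Finset.sum_congr rfl this, ← Finset.mul_sum, hP, mul_zero]

theorem descPochhammer_eval_natCast (k i : ℕ) :
    (descPochhammer ℂ k).eval (i : ℂ) = (k.factorial : ℂ) * (i.choose k : ℂ) := by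
  rw [descPochhammer_eval_eq_descFactorial, Nat.descFactorial_eq_factorial_mul_choose]
  push_cast
  rfl

/-- For i ≤ N = n - 2m, binom(i, k) binom(N - i, l - k) is a polynomial in i of degree at most l.
The bound on i makes the truncated N - i agree with the polynomial N - X. -/
theorem exists_eval_eq_tScalar (m n l : ℕ) :
    ∃ P ∈ degreeLT ℂ (l + 1), ∀ i ≤ n - 2 * m, P.eval (i : ℂ) = tScalar m n l i := by
  set N := n - 2 * m with hN
  refine ⟨∑ k ∈ Finset.range (l + 1), (((-1) ^ (m + k) * ((2 * m + l).choose (m + k) : ℂ)) /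
    (k.factorial * (l - k).factorial)) • (descPochhammer ℂ k *
      (descPochhammer ℂ (l - k)).comp (C (N : ℂ) - X)), ?_, fun i hi => ?_⟩
  · refine Submodule.sum_mem _ fun k hk => Submodule.smul_mem _ _ ?_
    have hk' : k ≤ l := by have := Finset.mem_range.1 hk; omega
    rw [mem_degreeLT]
    refine (degree_le_natDegree).trans_lt ?_
    have h1 : (descPochhammer ℂ k * (descPochhammer ℂ (l - k)).comp (C (N : ℂ) - X)).natDegree ≤
        k + (l - k) * 1 := by
      refine natDegree_mul_le_of_le (descPochhammer_natDegree ℂ k).le ?_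
      refine (natDegree_comp_le).trans (Nat.mul_le_mul (descPochhammer_natDegree ℂ _).le ?_)
      exact (natDegree_sub_le _ _).trans (by simp)
    exact_mod_cast (show _ < l + 1 by omega)
  · rw [tScalar_eq hi, eval_finsetSum]
    refine Finset.sum_congr rfl fun k _ => ?_
    have f1 : (k.factorial : ℂ) ≠ 0 := Nat.cast_ne_zero.2 (Nat.factorial_ne_zero _)
    have f2 : ((l - k).factorial : ℂ) ≠ 0 := Nat.cast_ne_zero.2 (Nat.factorial_ne_zero _)
    rw [eval_smul, eval_mul, eval_comp, eval_sub, eval_C, eval_X, ← Nat.cast_sub hi,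
      descPochhammer_eval_natCast, descPochhammer_eval_natCast, smul_eq_mul, ← hN]
    field_simp

end Hahn

end BinaryBurnside

namespace BinaryBurnside

open Polynomial

/-! ### The vectors `f_T` -/

section Vectors

theorem bit_castAdd {a b : ℕ} (x : Cube (a + b)) {j : ℕ} (hj : j ≤ a) :
    bit (fun i => x (Fin.castAdd b i)) j = bit x j := by
  by_cases h : 1 ≤ j
  · rw [bit, dif_pos ⟨h, hj⟩, bit, dif_pos ⟨h, by omega⟩]
    rfl
  · rw [bit, dif_neg fun h' => h h'.1, bit, dif_neg fun h' => h h'.1]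

theorem bit_natAdd {a b : ℕ} (x : Cube (a + b)) {j : ℕ} (hj : 1 ≤ j) :
    bit (fun i => x (Fin.natAdd a i)) j = bit x (a + j) := by
  by_cases h : j ≤ b
  · have e : (⟨a + j - 1, by omega⟩ : Fin (a + b)) = Fin.natAdd a ⟨j - 1, by omega⟩ :=
      Fin.ext (by simp only [Fin.natAdd_mk]; omega)
    rw [bit, dif_pos ⟨hj, h⟩, bit, dif_pos ⟨by omega, by omega⟩, e]
  · rw [bit, dif_neg fun h' => h h'.2, bit, dif_neg fun h' => h (by omega)]

theorem bit_cast {a b : ℕ} (h : a = b) (x : Cube b) : bit (fun k => x (Fin.cast h k)) = bit x := by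
  subst h; rfl

theorem restOnes_cast {a b m : ℕ} (h : a = b) (x : Cube b) :
    restOnes m (fun k => x (Fin.cast h k)) = restOnes m x := by
  subst h; rfl

theorem ones_natAdd {m b : ℕ} (x : Cube (2 * m + b)) :
    ones (fun i => x (Fin.natAdd (2 * m) i)) = restOnes m x := by
  unfold ones restOnes
  have hb : ∀ i : Fin b, bit x (2 * m + 1 + i) =
      if x (Fin.natAdd (2 * m) i) = true then 1 else 0 := fun i => by
    rw [show 2 * m + 1 + (i : ℕ) = 2 * m + ((i : ℕ) + 1) by ring, ← bit_natAdd x (by omega),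
      bit_succ]
  refine Finset.card_bij (fun i _ => 2 * m + 1 + i) (fun i hi => ?_) (fun i _ j _ h => ?_)
    fun j hj => ?_
  · rw [Finset.mem_filter] at hi
    rw [Finset.mem_filter, Finset.mem_Icc, hb, if_pos hi.2]
    exact ⟨⟨by omega, by omega⟩, rfl⟩
  · exact Fin.ext (by omega)
  · rw [Finset.mem_filter, Finset.mem_Icc] at hj
    refine ⟨⟨j - (2 * m + 1), by omega⟩, ?_, by simp only; omega⟩
    have h1 := hb ⟨j - (2 * m + 1), by omega⟩
    simp only [show 2 * m + 1 + (j - (2 * m + 1)) = j by omega, hj.2] at h1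
    rw [Finset.mem_filter]
    refine ⟨Finset.mem_univ _, ?_⟩
    by_contra h2
    rw [if_neg h2] at h1
    exact one_ne_zero h1

theorem vec_apply {n : ℕ} (S : Finset (Fin n)) (x : Cube n) :
    vec S x = if S = Finset.univ.filter (fun i => x i = true) then 1 else 0 := by
  rw [vec, Pi.single_apply]
  congr 1
  apply propext
  rw [funext_iff, Finset.ext_iff]
  refine forall_congr' fun i => ?_
  rw [Finset.mem_filter]
  cases h : x i <;> simp

theorem sum_vec_apply {n : ℕ} (i : ℕ) (x : Cube n) :
    (∑ S ∈ (Finset.univ : Finset (Fin n)).powersetCard i, vec S) x =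
      if ones x = i then 1 else 0 := by
  rw [Finset.sum_apply]
  simp only [vec_apply]
  rw [Finset.sum_ite_eq']
  exact if_congr (by simp [Finset.mem_powersetCard, ones]) rfl rfl

theorem pairPower_apply {m : ℕ} (x : Cube (2 * m)) : pairPower m x = specht m (bit x) := by
  induction m with
  | zero =>
    rw [pairPower, vec_apply, specht, Finset.prod_range_zero, if_pos (Finset.ext fun i => absurd i.2 (by omega))]
  | succ m ih =>
    have hv : ∀ z : Cube 2, (vec {1} - vec {0} : L 2) z = bit z 2 - bit z 1 := by
      intro z
      have h2 := bit_succ z 1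
      have h1 := bit_succ z 0
      norm_num at h1 h2
      rw [h1, h2, Pi.sub_apply, vec_apply, vec_apply]
      cases h : z 0 <;> cases h' : z 1 <;>
        simp [Finset.ext_iff, Fin.forall_fin_two, h, h']
    change tensor (pairPower m) (vec {1} - vec {0}) x = _
    rw [tensor, ih, hv, specht, specht, Finset.prod_range_succ,
      bit_natAdd (a := 2 * m) (b := 2) x (by norm_num),
      bit_natAdd (a := 2 * m) (b := 2) x (by norm_num)]
    congr 1
    refine Finset.prod_congr rfl fun p hp => ?_
    rw [Finset.mem_range] at hp
    rw [bit_castAdd (a := 2 * m) (b := 2) x (by omega),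
      bit_castAdd (a := 2 * m) (b := 2) x (by omega)]

theorem gT_apply {n m : ℕ} (hm : m ≤ n / 2) (i : ℕ) (x : Cube n) :
    gT hm i x = specht m (bit x) * if restOnes m x = i then 1 else 0 := by
  have hn : 2 * m + (n - 2 * m) = n := by omega
  have h1 : ones (fun j => x (Fin.cast hn (Fin.natAdd (2 * m) j))) = restOnes m x :=
    (ones_natAdd fun k => x (Fin.cast hn k)).trans (restOnes_cast hn x)
  rw [gT, tensor, pairPower_apply, sum_vec_apply, h1]
  congr 1
  exact specht_congr fun j hj => (bit_castAdd (fun k => x (Fin.cast hn k)) hj).trans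
    (congrFun (bit_cast hn x) j)

theorem restOnes_le {n m : ℕ} (x : Cube n) : restOnes m x ≤ n - 2 * m := by
  refine (Finset.card_filter_le _ _).trans ?_
  rw [Nat.card_Icc]
  omega

/-- The vector v_{01} - v_{10} is the function x_2 - x_1, so g_T^{m,i} is Δ_m restricted to i ones
beyond position 2m. On the support of Δ_m that number is |x| - m. -/
theorem fT_eq {n m : ℕ} (hm : m ≤ n / 2) (l : ℕ) :
    fT hm l = spechtFn n m fun j => tScalar m n l (j - m) := by
  funext x
  rw [spechtFn_apply (by omega), Nat.add_sub_cancel_left, fT, Finset.sum_apply]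
  simp only [Pi.smul_apply, gT_apply, smul_eq_mul]
  rw [Finset.sum_eq_single (restOnes m x)]
  · rw [if_pos rfl]; ring
  · intro i _ hi
    rw [if_neg (Ne.symm hi)]; ring
  · intro h
    exact absurd (Finset.mem_range.2 (Nat.lt_succ_of_le (restOnes_le x))) h

/-! ### Inner products of Specht polynomials -/

theorem sum_append {a b : ℕ} (F : Cube (a + b) → ℂ) :
    ∑ x, F x = ∑ u : Cube a, ∑ v : Cube b, F (Fin.append u v) := by
  rw [← Fintype.sum_prod_type' fun u v => F (Fin.append u v)]
  exact (Equiv.sum_comp (Fin.appendEquiv a b) F).symm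

theorem append_castAdd {a b : ℕ} (u : Cube a) (v : Cube b) :
    (fun i => (Fin.append u v : Cube (a + b)) (Fin.castAdd b i)) = u :=
  funext fun i => Fin.append_left u v i

theorem append_natAdd {a b : ℕ} (u : Cube a) (v : Cube b) :
    (fun i => (Fin.append u v : Cube (a + b)) (Fin.natAdd a i)) = v :=
  funext fun i => Fin.append_right u v i

theorem specht_append {m b : ℕ} (u : Cube (2 * m)) (v : Cube b) :
    specht m (bit (Fin.append u v : Cube (2 * m + b))) = specht m (bit u) := by
  refine specht_congr fun j hj => ?_
  rw [← bit_castAdd _ hj, append_castAdd]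

theorem sum_specht_sq (m : ℕ) : ∑ u : Cube (2 * m), specht m (bit u) ^ 2 = 2 ^ m := by
  induction m with
  | zero => simp [specht]
  | succ m ih =>
    have h : ∀ (u : Cube (2 * m)) (v : Cube 2),
        specht (m + 1) (bit (Fin.append u v : Cube (2 * m + 2))) ^ 2 =
          specht m (bit u) ^ 2 * (bit v 2 - bit v 1) ^ 2 := by
      intro u v
      have e : specht (m + 1) (bit (Fin.append u v : Cube (2 * m + 2))) =
          specht m (bit (Fin.append u v : Cube (2 * m + 2))) *
            (bit (Fin.append u v : Cube (2 * m + 2)) (2 * m + 2) -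
              bit (Fin.append u v : Cube (2 * m + 2)) (2 * m + 1)) := Finset.prod_range_succ _ _
      rw [e, specht_append, ← bit_natAdd _ (by norm_num), ← bit_natAdd _ (by norm_num),
        append_natAdd, mul_pow]
    have h2 : ∑ v : Cube 2, (bit v 2 - bit v 1) ^ 2 = 2 := by
      have hb : ∀ v : Cube 2, (bit v 2 - bit v 1) ^ 2 =
          ((if v 1 = true then 1 else 0) - (if v 0 = true then 1 else 0)) ^ 2 := by
        intro v
        have h2 := bit_succ v 1
        have h1 := bit_succ v 0
        norm_num at h1 h2
        rw [h1, h2]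
      rw [Finset.sum_congr rfl fun v _ => hb v,
        ← Equiv.sum_comp (finTwoArrowEquiv Bool).symm, Fintype.sum_prod_type]
      simp
      norm_num
    have e := sum_append (a := 2 * m) (b := 2)
      fun x => specht (m + 1) (bit (x : Cube (2 * m + 2))) ^ 2
    refine e.trans ?_
    simp only [h]
    rw [← Finset.sum_mul_sum, ih, h2, pow_succ]

theorem sum_ones (b : ℕ) (G : ℕ → ℂ) :
    ∑ v : Cube b, G (ones v) = ∑ i ∈ Finset.range (b + 1), (b.choose i : ℂ) * G i := by
  have h := Finset.sum_powerset_apply_card G (x := (Finset.univ : Finset (Fin b)))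
  rw [Finset.card_univ, Fintype.card_fin] at h
  simp only [nsmul_eq_mul] at h
  rw [← h]
  refine Finset.sum_bij (fun v _ => Finset.univ.filter fun i => v i = true) (by simp) ?_ ?_ ?_
  · intro v _ w _ hvw
    funext i
    have := Finset.ext_iff.1 hvw i
    simp only [Finset.mem_filter, Finset.mem_univ, true_and] at this
    exact Bool.eq_iff_iff.2 this
  · intro S _
    exact ⟨fun i => decide (i ∈ S), Finset.mem_univ _, by ext; simp⟩
  · intro v _
    rfl

theorem specht_conj {n m : ℕ} (x : Cube n) :
    (starRingEnd ℂ) (specht m (bit x)) = specht m (bit x) := by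
  have h : ∀ j, (starRingEnd ℂ) (bit x j) = bit x j := fun j => by
    rcases bit_eq_zero_or_one x j with h | h <;> simp [h]
  simp [specht, h]

/-- Split x after position 2m: ∑ Δ_m² = 2^m over the first block, and binom(n - 2m, i) tails have i
ones. The inner product becomes a one-variable sum with the Hahn weight. -/
theorem innerPi_spechtFn {n m : ℕ} (hm : 2 * m ≤ n) (φ ψ : ℕ → ℂ) :
    innerPi (spechtFn n m φ) (spechtFn n m ψ) = 2 ^ m / ((n : ℂ) + 1) *
      ∑ i ∈ Finset.range (n - 2 * m + 1),
        hahnWeight m (n - 2 * m) i * ((starRingEnd ℂ) (φ (m + i)) * ψ (m + i)) := by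
  obtain ⟨N, rfl⟩ := Nat.exists_eq_add_of_le hm
  rw [Nat.add_sub_cancel_left]
  have hterm : ∀ x : Cube (2 * m + N),
      (starRingEnd ℂ) (spechtFn _ m φ x) * spechtFn _ m ψ x *
        (1 / ((((2 * m + N : ℕ) : ℂ) + 1) * ((2 * m + N).choose (ones x) : ℂ))) =
      specht m (bit x) ^ 2 * ((starRingEnd ℂ) (φ (m + restOnes m x)) * ψ (m + restOnes m x) *
        (1 / ((((2 * m + N : ℕ) : ℂ) + 1) * ((2 * m + N).choose (m + restOnes m x) : ℂ)))) := by
    intro x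
    rw [spechtFn_apply hm, spechtFn_apply hm, map_mul, specht_conj]
    by_cases hx : specht m (bit x) = 0
    · simp [hx]
    · rw [ones_eq hm hx]; ring
  have hrest : ∀ (u : Cube (2 * m)) (v : Cube N),
      restOnes m (Fin.append u v : Cube (2 * m + N)) = ones v := fun u v => by
    rw [← ones_natAdd, append_natAdd]
  rw [innerPi, Finset.sum_congr rfl fun x _ => hterm x, sum_append]
  simp only [specht_append, hrest]
  rw [← Finset.sum_mul_sum, sum_specht_sq, sum_ones N fun i => (starRingEnd ℂ) (φ (m + i)) *
    ψ (m + i) * (1 / ((((2 * m + N : ℕ) : ℂ) + 1) * ((2 * m + N).choose (m + i) : ℂ))),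
    Finset.mul_sum, Finset.mul_sum]
  refine Finset.sum_congr rfl fun i _ => ?_
  rw [hahnWeight, one_div, mul_inv]
  ring

theorem innerPi_fT_self {n m : ℕ} (hm : m ≤ n / 2) (l : ℕ) :
    innerPi (fT hm l) (fT hm l) = 2 ^ m / ((n : ℂ) + 1) *
      ∑ i ∈ Finset.range (n - 2 * m + 1),
        (tScalar m n l i) ^ 2 * (((n - 2 * m).choose i : ℂ) / (n.choose (m + i) : ℂ)) := by
  rw [fT_eq, innerPi_spechtFn (by omega)]
  congr 1
  refine Finset.sum_congr rfl fun i _ => ?_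
  rw [Nat.add_sub_cancel_left, tScalar_conj, hahnWeight, show 2 * m + (n - 2 * m) = n by omega]
  ring

theorem fT_ne_zero {n m l : ℕ} (hm : m ≤ n / 2) (hl : l ≤ n - 2 * m) : fT hm l ≠ 0 := by
  intro h
  -- The tuple 0101…01 followed by zeros: Δ_m is 1 there and the tail has no ones, leaving T(0),
  -- which is nonzero.
  set x : Cube n := fun i => decide ((i : ℕ) % 2 = 1 ∧ (i : ℕ) < 2 * m) with hx
  have hbit : ∀ j, 1 ≤ j → j ≤ n → bit x j = if j % 2 = 0 ∧ j ≤ 2 * m then 1 else 0 := by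
    intro j h1 h2
    rw [bit, dif_pos ⟨h1, h2⟩]
    congr 1
    simp only [hx, decide_eq_true_eq, eq_iff_iff]
    omega
  have hs : specht m (bit x) = 1 := by
    refine Finset.prod_eq_one fun p hp => ?_
    rw [Finset.mem_range] at hp
    rw [hbit _ (by omega) (by omega), hbit _ (by omega) (by omega), if_pos (by omega),
      if_neg (by omega), sub_zero]
  have hr : restOnes m x = 0 := by
    rw [restOnes, Finset.card_eq_zero, Finset.filter_eq_empty_iff]
    intro j hj
    rw [Finset.mem_Icc] at hj
    rw [hbit j (by omega) hj.2, if_neg (by omega)]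
    exact zero_ne_one
  have h2 := congrFun h x
  rw [fT_eq, spechtFn_apply (by omega), hs, hr, one_mul, add_zero, Nat.sub_self] at h2
  exact tScalar_zero_ne_zero hl h2

/-! ### Eigenvectors -/

/-- The function `Δ_m(x) P(|x| - m)` for a polynomial `P`. -/
noncomputable def spechtPoly (n m : ℕ) : ℂ[X] →ₗ[ℂ] L n where
  toFun P := spechtFn n m fun j => P.eval ((j : ℂ) - m)
  map_add' P Q := by
    funext x
    simp only [spechtFn, eval_add, Pi.add_apply, mul_add]
  map_smul' a P := by
    funext x
    simp only [spechtFn, eval_smul, Pi.smul_apply, smul_eq_mul, RingHom.id_apply]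
    ring

theorem spechtPoly_eq {n m : ℕ} (hm : 2 * m ≤ n) {P : ℂ[X]} {φ : ℕ → ℂ}
    (h : ∀ i ≤ n - 2 * m, P.eval (i : ℂ) = φ (m + i)) : spechtPoly n m P = spechtFn n m φ := by
  funext x
  change spechtFn n m (fun j => P.eval ((j : ℂ) - m)) x = _
  rw [spechtFn_apply hm, spechtFn_apply hm, ← h _ (restOnes_le x)]
  simp

theorem exists_spechtPoly_eq_fT {n m : ℕ} (hm : m ≤ n / 2) (l : ℕ) :
    ∃ P ∈ degreeLT ℂ (l + 1), spechtPoly n m P = fT hm l := by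
  obtain ⟨P, hP, h⟩ := exists_eval_eq_tScalar m n l
  refine ⟨P, hP, ?_⟩
  rw [fT_eq]
  refine spechtPoly_eq (by omega) fun i hi => ?_
  rw [h i hi, Nat.add_sub_cancel_left]

theorem innerPi_fT_spechtPoly {n m l : ℕ} (hm : m ≤ n / 2) {P : ℂ[X]} (hP : P ∈ degreeLT ℂ l) :
    innerPi (fT hm l) (spechtPoly n m P) = 0 := by
  rw [fT_eq]
  change innerPi _ (spechtFn n m fun j => P.eval ((j : ℂ) - m)) = 0
  rw [innerPi_spechtFn (by omega)]
  have h : ∀ i ∈ Finset.range (n - 2 * m + 1), hahnWeight m (n - 2 * m) i *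
      ((starRingEnd ℂ) (tScalar m n l (m + i - m)) * P.eval (((m + i : ℕ) : ℂ) - m)) =
      hahnWeight m (n - 2 * m) i * (tScalar m n l i * P.eval (i : ℂ)) := fun i _ => by
    rw [Nat.add_sub_cancel_left, tScalar_conj, Nat.cast_add, add_sub_cancel_left]
  rw [Finset.sum_congr rfl h, sum_hahnWeight_mul_eval (by omega) hP, mul_zero]

theorem innerPi_fT_of_ne {n m l l' : ℕ} (hm : m ≤ n / 2) (h : l ≠ l') :
    innerPi (fT hm l) (fT hm l') = 0 := by
  have key : ∀ l l', l' < l → innerPi (fT hm l) (fT hm l') = 0 := by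
    intro l l' h
    obtain ⟨P, hP, hPf⟩ := exists_spechtPoly_eq_fT hm l'
    rw [← hPf]
    exact innerPi_fT_spechtPoly hm (degreeLT_mono h hP)
  rcases lt_or_gt_of_ne h with h | h
  · rw [← innerPi_conj_symm, key _ _ h, map_zero]
  · exact key _ _ h

/-- The eigenvalue of the transition operator on `f_Q^{m,ℓ}`, `d = m + ℓ`. -/
noncomputable def burnsideEigenvalue (d : ℕ) : ℂ := if Even d then beta (d / 2) else 0

/-- Triangularity by degree, transferred from the binomials binom(|x| - m, e) to all polynomials
through the basis of falling factorials. -/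
theorem burnsideOp_spechtPoly {n m : ℕ} (hm : 2 * m ≤ n) {d : ℕ} {P : ℂ[X]}
    (hP : P ∈ degreeLT ℂ (d + 1)) : ∃ R ∈ degreeLT ℂ d, burnsideOp n (spechtPoly n m P) =
      burnsideEigenvalue (m + d) • spechtPoly n m P + spechtPoly n m R := by
  have hB : ∀ e, spechtPoly n m (descPochhammer ℂ e) =
      (e.factorial : ℂ) • spechtFn n m (shiftedChoose m e) := by
    intro e
    have : spechtFn n m (fun j => (e.factorial : ℂ) * shiftedChoose m e j) =
        (e.factorial : ℂ) • spechtFn n m (shiftedChoose m e) := by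
      funext x
      simp only [spechtFn, Pi.smul_apply, smul_eq_mul]
      ring
    rw [← this]
    refine spechtPoly_eq hm fun i _ => ?_
    rw [descPochhammer_eval_natCast, shiftedChoose, Nat.add_sub_cancel_left]
  have hB' : ∀ e, spechtFn n m (shiftedChoose m e) =
      spechtPoly n m ((e.factorial : ℂ)⁻¹ • descPochhammer ℂ e) := fun e => by
    rw [map_smul, hB, inv_smul_smul₀ (Nat.cast_ne_zero.2 (Nat.factorial_ne_zero _))]
  have hmem : ∀ e k : ℕ, e < k → descPochhammer ℂ e ∈ degreeLT ℂ k := fun e k h => by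
    rw [mem_degreeLT, ← show fallingSequence e = descPochhammer ℂ e from rfl,
      fallingSequence.degree_eq]
    exact_mod_cast h
  have hS : ∀ k, Submodule.span ℂ (fallingSequence '' Set.Iio k) = degreeLT ℂ k := fun k =>
    fallingSequence.span_degreeLT fun i _ => isUnit_iff_ne_zero.2
      (leadingCoeff_ne_zero.2 (fallingSequence.ne_zero i))
  rw [← hS] at hP
  induction hP using Submodule.span_induction with
  | mem P hP =>
    obtain ⟨e, he, rfl⟩ := hP
    have he' : e < d + 1 := he
    change ∃ R ∈ degreeLT ℂ d, burnsideOp n (spechtPoly n m (descPochhammer ℂ e)) =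
      burnsideEigenvalue (m + d) • spechtPoly n m (descPochhammer ℂ e) + spechtPoly n m R
    have hK : burnsideOp n (spechtPoly n m (descPochhammer ℂ e)) =
        burnsideEigenvalue (m + e) • spechtPoly n m (descPochhammer ℂ e) +
        spechtPoly n m ((e.factorial : ℂ) • ∑ u ∈ Finset.range e,
          (((n - 2 * m - u).choose (e - u) : ℂ) *
            arcsine₂ ((varP - varQ) ^ (m + u) * varQ ^ (e - u))) •
              ((u.factorial : ℂ)⁻¹ • descPochhammer ℂ u)) := by
      rw [hB, map_smul, burnsideOp_spechtFn hm, Finset.sum_range_succ, map_smul, map_sum, smul_add,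
        Nat.sub_self, Nat.choose_zero_right, pow_zero, mul_one, arcsine₂_sub_pow, Nat.cast_one,
        one_mul, add_comm]
      congr 1
      · rw [smul_comm]; rfl
      · congr 1
        refine Finset.sum_congr rfl fun u _ => ?_
        rw [map_smul, hB']
    by_cases hed : e = d
    · subst hed
      refine ⟨_, Submodule.smul_mem _ _ (Submodule.sum_mem _ fun u hu => Submodule.smul_mem _ _
        (Submodule.smul_mem _ _ (hmem u e (Finset.mem_range.1 hu)))), hK⟩
    -- For e < d the diagonal entry is the wrong eigenvalue, but the discrepancy has degree below d
    -- and can be put into the remainder.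
    · refine ⟨(burnsideEigenvalue (m + e) - burnsideEigenvalue (m + d)) • descPochhammer ℂ e +
        (e.factorial : ℂ) • ∑ u ∈ Finset.range e,
          (((n - 2 * m - u).choose (e - u) : ℂ) *
            arcsine₂ ((varP - varQ) ^ (m + u) * varQ ^ (e - u))) •
              ((u.factorial : ℂ)⁻¹ • descPochhammer ℂ u), ?_, ?_⟩
      · exact Submodule.add_mem _ (Submodule.smul_mem _ _ (hmem e d (by omega)))
          (Submodule.smul_mem _ _ (Submodule.sum_mem _ fun u hu => Submodule.smul_mem _ _
            (Submodule.smul_mem _ _ (hmem u d (by have := Finset.mem_range.1 hu; omega)))))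
      · rw [hK, map_add, map_smul (spechtPoly n m)
          (burnsideEigenvalue (m + e) - burnsideEigenvalue (m + d)), sub_smul]
        abel
  | zero => exact ⟨0, Submodule.zero_mem _, by simp⟩
  | add P Q _ _ hP hQ =>
    obtain ⟨R, hR, hR'⟩ := hP
    obtain ⟨S, hS, hS'⟩ := hQ
    refine ⟨R + S, Submodule.add_mem _ hR hS, ?_⟩
    rw [map_add, map_add, hR', hS', map_add, smul_add]
    abel
  | smul a P _ hP =>
    obtain ⟨R, hR, hR'⟩ := hP
    refine ⟨a • R, Submodule.smul_mem _ _ hR, ?_⟩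
    rw [map_smul, map_smul, hR', map_smul, smul_add, smul_comm]

/-- The remainder K f - λ f is Δ_m R with deg R < ℓ. It is orthogonal to itself: K is self-adjoint
and preserves polynomials of degree below ℓ, all of which are orthogonal to f = f_T. No separation
of eigenvalues enters. -/
theorem burnsideOp_fT {n m : ℕ} (hm : m ≤ n / 2) (l : ℕ) :
    burnsideOp n (fT hm l) = burnsideEigenvalue (m + l) • fT hm l := by
  have hm' : 2 * m ≤ n := by omega
  obtain ⟨P, hP, hPf⟩ := exists_spechtPoly_eq_fT hm l
  obtain ⟨R, hR, hR'⟩ := burnsideOp_spechtPoly hm' hP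
  obtain ⟨S, hS, hS'⟩ := burnsideOp_spechtPoly hm' (degreeLT_mono (Nat.le_succ l) hR)
  rw [hPf] at hR'
  have h0 : innerPi (burnsideOp n (fT hm l) - burnsideEigenvalue (m + l) • fT hm l)
      (spechtPoly n m R) = 0 := by
    rw [innerPi_sub_left, innerPi_smul_left, innerPi_burnsideOp, hS', innerPi_add_right,
      innerPi_smul_right, innerPi_fT_spechtPoly hm hR, innerPi_fT_spechtPoly hm hS]
    ring
  rw [← eq_sub_of_add_eq' hR'.symm] at h0
  rw [hR', innerPi_self_eq_zero h0, add_zero]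

end Vectors

end BinaryBurnside

namespace BinaryBurnside

/-! ### Two-row standard tableaux -/

section Tableaux

/-- The `j`-th element (from `j = 0`) of a finite set of natural numbers. -/
noncomputable def enum (A : Finset ℕ) (j : ℕ) : ℕ :=
  if h : j < A.card then A.orderEmbOfFin rfl ⟨j, h⟩ else 0

theorem enum_mem {A : Finset ℕ} {j : ℕ} (h : j < A.card) : enum A j ∈ A := by
  rw [enum, dif_pos h]
  exact Finset.orderEmbOfFin_mem _ _ _

theorem enum_lt {A : Finset ℕ} {i j : ℕ} (hij : i < j) (h : j < A.card) : enum A i < enum A j := by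
  rw [enum, enum, dif_pos h, dif_pos (hij.trans h)]
  exact (A.orderEmbOfFin rfl).strictMono hij

theorem enum_injOn (A : Finset ℕ) : Set.InjOn (enum A) (Set.Iio A.card) := by
  intro i hi j hj h
  rcases lt_trichotomy i j with h1 | h1 | h1
  · exact absurd h (enum_lt h1 hj).ne
  · exact h1
  · exact absurd h (enum_lt h1 hi).ne'

theorem exists_enum_eq {A : Finset ℕ} {k : ℕ} (hk : k ∈ A) : ∃ j < A.card, enum A j = k := by
  have h : k ∈ Set.range (A.orderEmbOfFin rfl) := by
    rw [Finset.range_orderEmbOfFin]; exact hk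
  obtain ⟨j, rfl⟩ := h
  exact ⟨j, j.2, by rw [enum, dif_pos j.2]⟩

theorem eq_enum {A : Finset ℕ} {f : ℕ → ℕ} (hf : ∀ j < A.card, f j ∈ A)
    (hmono : ∀ i j, i < j → j < A.card → f i < f j) {j : ℕ} (hj : j < A.card) :
    f j = enum A j := by
  have h := Finset.orderEmbOfFin_unique (s := A) rfl (f := fun i : Fin A.card => f i)
    (fun i => hf i i.2) (fun i j hij => hmono i j hij j.2)
  rw [enum, dif_pos hj]
  exact congrFun h ⟨j, hj⟩

variable {n m : ℕ}

theorem mem_twoRow (hm : m ≤ n / 2) (c : ℕ × ℕ) :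
    c ∈ twoRow hm ↔ c.1 = 0 ∧ c.2 < n - m ∨ c.1 = 1 ∧ c.2 < m := by
  rw [twoRow, YoungDiagram.mem_ofRowLens]
  constructor
  · rintro ⟨h, h'⟩
    rcases c with ⟨_ | _ | i, j⟩
    · exact Or.inl ⟨rfl, h'⟩
    · exact Or.inr ⟨rfl, h'⟩
    · simp at h
  · rintro (⟨h1, h2⟩ | ⟨h1, h2⟩) <;> rcases c with ⟨i, j⟩ <;> obtain rfl : i = _ := h1
    · exact ⟨by simp, h2⟩
    · exact ⟨by simp, h2⟩

theorem card_twoRow (hm : m ≤ n / 2) : (twoRow hm).card = n := by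
  have h : (twoRow hm).cells = (Finset.range (n - m)).image (fun j => ((0 : ℕ), j)) ∪
      (Finset.range m).image (fun j => ((1 : ℕ), j)) := by
    ext ⟨i, j⟩
    rw [YoungDiagram.mem_cells, mem_twoRow]
    simp only [Finset.mem_union, Finset.mem_image, Finset.mem_range, Prod.mk.injEq]
    constructor
    · rintro (⟨rfl, h⟩ | ⟨rfl, h⟩)
      · exact Or.inl ⟨j, h, rfl, rfl⟩
      · exact Or.inr ⟨j, h, rfl, rfl⟩
    · rintro (⟨j', h, rfl, rfl⟩ | ⟨j', h, rfl, rfl⟩)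
      · exact Or.inl ⟨rfl, h⟩
      · exact Or.inr ⟨rfl, h⟩
  rw [YoungDiagram.card, h, Finset.card_union_of_disjoint, Finset.card_image_of_injective,
    Finset.card_image_of_injective, Finset.card_range, Finset.card_range]
  · omega
  · intro a b h; simpa using h
  · intro a b h; simpa using h
  · rw [Finset.disjoint_left]
    rintro ⟨i, j⟩ h1 h2
    simp only [Finset.mem_image, Prod.mk.injEq] at h1 h2
    obtain ⟨_, _, h1, _⟩ := h1
    obtain ⟨_, _, h2, _⟩ := h2
    omega

variable {hm : m ≤ n / 2}

theorem standardTableau_bijOn (Q : StandardTableau (twoRow hm)) :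
    Set.BijOn (fun c : ℕ × ℕ => Q.1 c.1 c.2) ((twoRow hm).cells : Set (ℕ × ℕ)) (Set.Icc 1 n) := by
  have key : ∀ {t t' : Set ℕ}, t = t' →
      Set.BijOn (fun c : ℕ × ℕ => Q.1 c.1 c.2) ((twoRow hm).cells : Set (ℕ × ℕ)) t →
      Set.BijOn (fun c : ℕ × ℕ => Q.1 c.1 c.2) ((twoRow hm).cells : Set (ℕ × ℕ)) t' := by
    rintro t t' rfl h
    exact h
  exact key (by rw [card_twoRow]) Q.2

theorem row_lt (Q : StandardTableau (twoRow hm)) {i j₁ j₂ : ℕ} (hj : j₁ < j₂)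
    (h : (i, j₂) ∈ twoRow hm) : Q.1 i j₁ < Q.1 i j₂ := by
  refine lt_of_le_of_ne (Q.1.row_weak hj h) fun he => ?_
  have h1 : (i, j₁) ∈ twoRow hm := (twoRow hm).up_left_mem le_rfl hj.le h
  have := (standardTableau_bijOn Q).injOn ((YoungDiagram.mem_cells _).2 h1)
    ((YoungDiagram.mem_cells _).2 h) he
  rw [Prod.mk.injEq] at this
  omega

theorem entry_mem (Q : StandardTableau (twoRow hm)) {i j : ℕ} (h : (i, j) ∈ twoRow hm) :
    1 ≤ Q.1 i j ∧ Q.1 i j ≤ n :=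
  (standardTableau_bijOn Q).mapsTo ((YoungDiagram.mem_cells (i, j)).2 h)

theorem isSecondRow_secondRow (Q : StandardTableau (twoRow hm)) :
    IsSecondRow n m (secondRow Q) where
  lt_of_lt r s hr hrs hs :=
    row_lt Q (by omega) ((mem_twoRow hm _).2 (Or.inr ⟨rfl, by simp only; omega⟩))
  two_mul_le r hr hrm := by
    have hr1 : ((1 : ℕ), r - 1) ∈ twoRow hm :=
      (mem_twoRow hm _).2 (Or.inr ⟨rfl, by simp only; omega⟩)
    -- The 2 × r rectangle ending at the cell of a_r holds 2r distinct entries, all between 1 and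
    -- a_r; hence 2r ≤ a_r.
    have hsub : (Finset.range 2 ×ˢ Finset.range r).image (fun c : ℕ × ℕ => Q.1 c.1 c.2) ⊆
        Finset.Icc 1 (secondRow Q r) := by
      intro t ht
      obtain ⟨⟨i, j⟩, hc, rfl⟩ := Finset.mem_image.1 ht
      rw [Finset.mem_product, Finset.mem_range, Finset.mem_range] at hc
      have hc1 : i < 2 := hc.1
      have hc2 : j < r := hc.2
      have hcell : (i, j) ∈ twoRow hm :=
        (twoRow hm).up_left_mem (by omega) (by omega) hr1
      have hj1 : (1, j) ∈ twoRow hm := (twoRow hm).up_left_mem le_rfl (by omega) hr1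
      rw [Finset.mem_Icc]
      exact ⟨(entry_mem Q hcell).1, (Q.1.col_weak (by omega) hj1).trans
        (Q.1.row_weak_of_le (by omega) hr1)⟩
    have hcard := Finset.card_le_card hsub
    rw [Finset.card_image_of_injOn, Finset.card_product, Finset.card_range, Finset.card_range,
      Nat.card_Icc] at hcard
    · omega
    · refine (standardTableau_bijOn Q).injOn.mono ?_
      rintro ⟨i, j⟩ hc
      rw [Finset.mem_coe, Finset.mem_product, Finset.mem_range, Finset.mem_range] at hc
      have hc1 : i < 2 := hc.1
      have hc2 : j < r := hc.2
      exact (YoungDiagram.mem_cells _).2 ((twoRow hm).up_left_mem (by omega) (by omega) hr1)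
  le r hr hrm := (entry_mem Q ((mem_twoRow hm _).2 (Or.inr ⟨rfl, by simp only; omega⟩))).2

/-- The set of entries of the second row. -/
def rowSet (Q : StandardTableau (twoRow hm)) : Finset ℕ := (Finset.Icc 1 m).image (secondRow Q)

theorem mem_rowSet (Q : StandardTableau (twoRow hm)) {k : ℕ} :
    k ∈ rowSet Q ↔ ∃ j < m, Q.1 1 j = k := by
  rw [rowSet, Finset.mem_image]
  constructor
  · rintro ⟨r, hr, rfl⟩
    rw [Finset.mem_Icc] at hr
    exact ⟨r - 1, by omega, rfl⟩
  · rintro ⟨j, hj, rfl⟩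
    exact ⟨j + 1, Finset.mem_Icc.2 ⟨by omega, by omega⟩, rfl⟩

theorem card_rowSet (Q : StandardTableau (twoRow hm)) : (rowSet Q).card = m := by
  rw [rowSet, Finset.card_image_of_injOn (isSecondRow_secondRow Q).injOn]
  simp

theorem rowSet_subset (Q : StandardTableau (twoRow hm)) : rowSet Q ⊆ Finset.Icc 1 n := by
  intro k hk
  obtain ⟨j, hj, rfl⟩ := (mem_rowSet Q).1 hk
  exact Finset.mem_Icc.2 (entry_mem Q ((mem_twoRow hm _).2 (Or.inr ⟨rfl, hj⟩)))

/-- Both rows increase strictly, so they are the increasing enumerations of the second-row set and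
of its complement. -/
theorem rowSet_injective : Function.Injective (rowSet : StandardTableau (twoRow hm) → _) := by
  intro Q Q' h
  have h1 : ∀ (P : StandardTableau (twoRow hm)) (j : ℕ), j < m → P.1 1 j = enum (rowSet P) j := by
    intro P j hj
    refine eq_enum (f := P.1 1) (fun j hj => ?_) (fun i j hij hj => ?_) (by rwa [card_rowSet])
    · rw [card_rowSet] at hj
      exact (mem_rowSet P).2 ⟨j, hj, rfl⟩
    · rw [card_rowSet] at hj
      exact row_lt P hij ((mem_twoRow hm _).2 (Or.inr ⟨rfl, hj⟩))
  have h0 : ∀ (P : StandardTableau (twoRow hm)) (j : ℕ), j < n - m →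
      P.1 0 j = enum (Finset.Icc 1 n \ rowSet P) j := by
    intro P j hj
    have hc : (Finset.Icc 1 n \ rowSet P).card = n - m := by
      rw [Finset.card_sdiff_of_subset (rowSet_subset P), card_rowSet]
      simp
    refine eq_enum (f := P.1 0) (fun j hj => ?_) (fun i j hij hj => ?_) (by rwa [hc])
    · rw [hc] at hj
      have hcell : (0, j) ∈ twoRow hm := (mem_twoRow hm _).2 (Or.inl ⟨rfl, hj⟩)
      rw [Finset.mem_sdiff, Finset.mem_Icc]
      refine ⟨entry_mem P hcell, fun hmem => ?_⟩
      obtain ⟨j', hj', he⟩ := (mem_rowSet P).1 hmem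
      have hcell' : (1, j') ∈ twoRow hm := (mem_twoRow hm _).2 (Or.inr ⟨rfl, hj'⟩)
      have := (standardTableau_bijOn P).injOn ((YoungDiagram.mem_cells _).2 hcell')
        ((YoungDiagram.mem_cells _).2 hcell) he
      rw [Prod.mk.injEq] at this
      omega
    · rw [hc] at hj
      exact row_lt P hij ((mem_twoRow hm _).2 (Or.inl ⟨rfl, hj⟩))
  refine Subtype.ext (SemistandardYoungTableau.ext fun i j => ?_)
  by_cases hc : (i, j) ∈ twoRow hm
  · rcases (mem_twoRow hm _).1 hc with ⟨hi, hj⟩ | ⟨hi, hj⟩ <;> obtain rfl : i = _ := hi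
    · rw [h0 Q j hj, h0 Q' j hj, h]
    · rw [h1 Q j hj, h1 Q' j hj, h]
  · rw [Q.1.zeros hc, Q'.1.zeros hc]

theorem isBallot_rowSet (Q : StandardTableau (twoRow hm)) : IsBallot (rowSet Q) :=
  (isSecondRow_secondRow Q).isBallot

/-- Column strictness from the ballot condition. Otherwise, with a the j-th element of A counted
from 0, {1, …, a} holds at least j + 1 elements of A and at most j others, against 2 cnt(a) ≤ a. -/
theorem enum_sdiff_lt_enum {A : Finset ℕ} (hA : IsBallot A) (hAn : A ⊆ Finset.Icc 1 n) {j : ℕ}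
    (hj : j < A.card) : enum (Finset.Icc 1 n \ A) j < enum A j := by
  set B := Finset.Icc 1 n \ A with hB
  by_contra hlt
  have hmem := enum_mem hj
  have h1 : Finset.Icc 1 (enum A j) ⊆ A.filter (· ≤ enum A j) ∪ B.filter (· ≤ enum A j) := by
    intro k hk
    have hjn := Finset.mem_Icc.1 (hAn hmem)
    rw [Finset.mem_Icc] at hk
    rw [Finset.mem_union, Finset.mem_filter, Finset.mem_filter]
    by_cases hkA : k ∈ A
    · exact Or.inl ⟨hkA, hk.2⟩
    · exact Or.inr ⟨Finset.mem_sdiff.2 ⟨Finset.mem_Icc.2 ⟨hk.1, by omega⟩, hkA⟩, hk.2⟩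
  have h2 : (Finset.range (j + 1)).image (enum A) ⊆ A.filter (· ≤ enum A j) := by
    intro k hk
    obtain ⟨i, hi, rfl⟩ := Finset.mem_image.1 hk
    rw [Finset.mem_range] at hi
    rw [Finset.mem_filter]
    refine ⟨enum_mem (by omega), ?_⟩
    rcases Nat.lt_succ_iff_lt_or_eq.1 hi with h | rfl
    · exact (enum_lt h hj).le
    · exact le_rfl
  have h3 : B.filter (· ≤ enum A j) ⊆ (Finset.range j).image (enum B) := by
    intro k hk
    rw [Finset.mem_filter] at hk
    obtain ⟨i, hi, rfl⟩ := exists_enum_eq hk.1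
    refine Finset.mem_image.2 ⟨i, Finset.mem_range.2 ?_, rfl⟩
    by_contra hij
    have hji : enum B j ≤ enum B i := by
      rcases (not_lt.1 hij).lt_or_eq with h | h
      · exact (enum_lt h hi).le
      · rw [h]
    have heq : enum A j = enum B i := by omega
    have := (Finset.mem_sdiff.1 hk.1).2
    rw [← heq] at this
    exact this hmem
  have c1 := (Finset.card_le_card h1).trans (Finset.card_union_le _ _)
  have c2 := Finset.card_le_card h2
  have c3 := (Finset.card_le_card h3).trans Finset.card_image_le
  rw [Finset.card_image_of_injOn ((enum_injOn A).mono fun i hi => by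
    simp only [Finset.coe_range, Set.mem_Iio] at hi ⊢; omega), Finset.card_range] at c2
  rw [Nat.card_Icc] at c1
  rw [Finset.card_range] at c3
  have hb := hA (enum A j)
  rw [cnt] at hb
  omega

theorem exists_rowSet_eq {A : Finset ℕ} (hA : IsBallot A) (hAn : A ⊆ Finset.Icc 1 n)
    (hcard : A.card = m) : ∃ Q : StandardTableau (twoRow hm), rowSet Q = A := by
  set B := Finset.Icc 1 n \ A with hB
  have hBcard : B.card = n - m := by
    rw [hB, Finset.card_sdiff_of_subset hAn, hcard]
    simp
  let e : ℕ → ℕ → ℕ := fun i j => if i = 0 then enum B j else if i = 1 then enum A j else 0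
  have e0 : ∀ j, e 0 j = enum B j := fun j => rfl
  have e1 : ∀ j, e 1 j = enum A j := fun j => rfl
  have hrow : ∀ {i j1 j2 : ℕ}, j1 < j2 → (i, j2) ∈ twoRow hm → e i j1 < e i j2 := by
    intro i j1 j2 hj hc
    rcases (mem_twoRow hm _).1 hc with ⟨hi, hj'⟩ | ⟨hi, hj'⟩ <;> obtain rfl : i = _ := hi
    · rw [e0, e0]
      exact enum_lt hj (by rw [hBcard]; exact hj')
    · rw [e1, e1]
      exact enum_lt hj (by rw [hcard]; exact hj')
  let T : SemistandardYoungTableau (twoRow hm) :=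
    { entry := e
      row_weak' := fun hj hc => (hrow hj hc).le
      col_strict' := by
        intro i1 i2 j hi hc
        rcases (mem_twoRow hm _).1 hc with ⟨hi', hj'⟩ | ⟨hi', hj'⟩ <;> obtain rfl : i2 = _ := hi'
        · omega
        · obtain rfl : i1 = 0 := by omega
          rw [e0, e1]
          exact enum_sdiff_lt_enum hA hAn (by rw [hcard]; exact hj')
      -- The default value 0 of `enum` past the cardinality is the required value outside the
      -- diagram.
      zeros' := by
        intro i j hc
        rw [mem_twoRow] at hc
        simp only [e]
        split_ifs with h0 h1
        · rw [enum, dif_neg]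
          rw [hBcard]
          exact fun h => hc (Or.inl ⟨h0, h⟩)
        · rw [enum, dif_neg]
          rw [hcard]
          exact fun h => hc (Or.inr ⟨h1, h⟩)
        · rfl }
  have hT : ∀ i j, T i j = e i j := fun i j => rfl
  have hmemA : ∀ j < m, enum A j ∈ A := fun j hj => enum_mem (by omega)
  have hmemB : ∀ j < n - m, enum B j ∈ B := fun j hj => enum_mem (by omega)
  have hbij : Set.BijOn (fun c : ℕ × ℕ => T c.1 c.2) ((twoRow hm).cells : Set (ℕ × ℕ))
      (Set.Icc 1 (twoRow hm).card) := by
    rw [card_twoRow]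
    refine ⟨?_, ?_, ?_⟩
    · rintro ⟨i, j⟩ hc
      rw [Finset.mem_coe, YoungDiagram.mem_cells, mem_twoRow] at hc
      rcases hc with ⟨hi, hj⟩ | ⟨hi, hj⟩ <;> obtain rfl : i = _ := hi
      · exact Finset.mem_Icc.1 (Finset.mem_sdiff.1 (hmemB j hj)).1
      · exact Finset.mem_Icc.1 (hAn (hmemA j hj))
    · rintro ⟨i, j⟩ hc ⟨i', j'⟩ hc' h
      rw [Finset.mem_coe, YoungDiagram.mem_cells, mem_twoRow] at hc hc'
      simp only [hT] at h
      rcases hc with ⟨hi, hj⟩ | ⟨hi, hj⟩ <;> obtain rfl : i = _ := hi <;>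
        rcases hc' with ⟨hi', hj'⟩ | ⟨hi', hj'⟩ <;> obtain rfl : i' = _ := hi' <;>
        simp only [e0, e1] at h hj hj'
      · rw [enum_injOn B (by rw [Set.mem_Iio, hBcard]; exact hj)
          (by rw [Set.mem_Iio, hBcard]; exact hj') h]
      · exact absurd (h ▸ hmemA j' hj') (Finset.mem_sdiff.1 (hmemB j hj)).2
      · exact absurd (h ▸ hmemA j hj) (Finset.mem_sdiff.1 (hmemB j' hj')).2
      · rw [enum_injOn A (by rw [Set.mem_Iio, hcard]; exact hj)
          (by rw [Set.mem_Iio, hcard]; exact hj') h]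
    · intro k hk
      by_cases hkA : k ∈ A
      · obtain ⟨j, hj, rfl⟩ := exists_enum_eq hkA
        exact ⟨(1, j), (YoungDiagram.mem_cells _).2
          ((mem_twoRow hm _).2 (Or.inr ⟨rfl, by rwa [hcard] at hj⟩)), rfl⟩
      · obtain ⟨j, hj, rfl⟩ := exists_enum_eq (Finset.mem_sdiff.2 ⟨Finset.mem_Icc.2 hk, hkA⟩)
        exact ⟨(0, j), (YoungDiagram.mem_cells _).2
          ((mem_twoRow hm _).2 (Or.inl ⟨rfl, by rwa [← hB, hBcard] at hj⟩)), rfl⟩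
  refine ⟨⟨T, hbij⟩, ?_⟩
  ext k
  refine (mem_rowSet (⟨T, hbij⟩ : StandardTableau (twoRow hm))).trans ?_
  constructor
  · rintro ⟨j, hj, rfl⟩
    exact hmemA j hj
  · intro hk
    obtain ⟨j, hj, rfl⟩ := exists_enum_eq hk
    exact ⟨j, by omega, rfl⟩

end Tableaux

/-! ### Counting -/

section Counting

open Classical in
/-- The ballot subsets of `{1, …, n}`. -/
noncomputable def ballots (n : ℕ) : Finset (Finset ℕ) :=
  (Finset.Icc 1 n).powerset.filter IsBallot

theorem mem_ballots {n : ℕ} {A : Finset ℕ} :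
    A ∈ ballots n ↔ A ⊆ Finset.Icc 1 n ∧ IsBallot A := by
  classical
  rw [ballots, Finset.mem_filter, Finset.mem_powerset]

theorem two_mul_card_le {n : ℕ} {A : Finset ℕ} (hA : A ∈ ballots n) : 2 * A.card ≤ n := by
  rw [mem_ballots] at hA
  have h := hA.2 n
  rwa [cnt, Finset.filter_true_of_mem fun k hk => (Finset.mem_Icc.1 (hA.1 hk)).2] at h

theorem notMem_of_mem_ballots {n : ℕ} {A : Finset ℕ} (hA : A ∈ ballots n) : n + 1 ∉ A := fun h => by
  have := (Finset.mem_Icc.1 ((mem_ballots.1 hA).1 h)).2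
  omega

theorem ballots_succ (n : ℕ) : ballots (n + 1) = ballots n ∪
    ((ballots n).filter fun A => 2 * (A.card + 1) ≤ n + 1).image (insert (n + 1)) := by
  ext A
  rw [Finset.mem_union, Finset.mem_image]
  constructor
  · intro hA
    have hA' := mem_ballots.1 hA
    by_cases hn : n + 1 ∈ A
    · right
      have hE : A.erase (n + 1) ∈ ballots n := by
        rw [mem_ballots]
        refine ⟨fun k hk => ?_, fun k => ?_⟩
        · have h1 := Finset.ne_of_mem_erase hk
          have h2 := Finset.mem_Icc.1 (hA'.1 (Finset.mem_of_mem_erase hk))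
          rw [Finset.mem_Icc]
          omega
        · exact (Nat.mul_le_mul_left 2 (Finset.card_le_card
            (Finset.filter_subset_filter _ (Finset.erase_subset _ _)))).trans (hA'.2 k)
      refine ⟨A.erase (n + 1), Finset.mem_filter.2 ⟨hE, ?_⟩, Finset.insert_erase hn⟩
      rw [Finset.card_erase_add_one hn]
      exact two_mul_card_le hA
    · left
      refine mem_ballots.2 ⟨fun k hk => ?_, hA'.2⟩
      have h2 := Finset.mem_Icc.1 (hA'.1 hk)
      have h3 : k ≠ n + 1 := by rintro rfl; exact hn hk
      rw [Finset.mem_Icc]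
      omega
  · rintro (hA | ⟨B, hB, rfl⟩)
    · have hA' := mem_ballots.1 hA
      exact mem_ballots.2 ⟨hA'.1.trans (Finset.Icc_subset_Icc_right (by omega)), hA'.2⟩
    · rw [Finset.mem_filter] at hB
      have hB' := mem_ballots.1 hB.1
      refine mem_ballots.2 ⟨Finset.insert_subset (Finset.mem_Icc.2 ⟨by omega, le_rfl⟩)
        (hB'.1.trans (Finset.Icc_subset_Icc_right (by omega))), fun k => ?_⟩
      rw [cnt, Finset.filter_insert]
      split_ifs with hk
      · have h1 := Finset.card_insert_le (n + 1) (B.filter (· ≤ k))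
        have h2 := Finset.card_filter_le B (· ≤ k)
        omega
      · exact hB'.2 k

/-- A set with k elements has weight n + 1 - 2k, the number of values of ℓ. Placing n + 1 in either
row gives weights (n + 2 - 2k) + (n - 2k), twice the old one. When the second placement is
forbidden, n = 2k and its weight would be 0 anyway. -/
theorem sum_ballots (n : ℕ) : ∑ A ∈ ballots n, (n + 1 - 2 * A.card) = 2 ^ n := by
  induction n with
  | zero =>
    have : ballots 0 = {∅} := by
      ext A
      rw [mem_ballots, Finset.mem_singleton]
      constructor
      · rintro ⟨h, _⟩
        simpa using h
      · rintro rfl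
        exact ⟨by simp, fun k => by simp [cnt]⟩
    simp [this]
  | succ n ih =>
    rw [ballots_succ, Finset.sum_union, Finset.sum_image, Finset.sum_filter,
      ← Finset.sum_add_distrib, pow_succ, ← ih, Finset.sum_mul]
    · refine Finset.sum_congr rfl fun A hA => ?_
      have h1 := two_mul_card_le hA
      rw [Finset.card_insert_of_notMem (notMem_of_mem_ballots hA)]
      split_ifs <;> omega
    · intro A hA B hB h
      have hA' := notMem_of_mem_ballots (Finset.mem_filter.1 hA).1
      have hB' := notMem_of_mem_ballots (Finset.mem_filter.1 hB).1
      rw [← Finset.erase_insert hA', ← Finset.erase_insert hB', h]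
    · rw [Finset.disjoint_left]
      intro A hA hA'
      obtain ⟨B, _, rfl⟩ := Finset.mem_image.1 hA'
      exact notMem_of_mem_ballots hA (Finset.mem_insert_self _ _)

end Counting

/-! ### The basis -/

section Basis

variable {n m : ℕ} {hm : m ≤ n / 2}

theorem tauQ_eq (Q : StandardTableau (twoRow hm)) :
    tauQ Q = ((List.range' (0 + 1) (m - 0)).map fun r => tauStep n (secondRow Q r) r).prod := rfl

theorem hasContent_fT (l : ℕ) : HasContent (content (evens m)) (fT hm l) := by
  rw [fT_eq]
  exact hasContent_spechtFn _

theorem hasContent_fQ (Q : StandardTableau (twoRow hm)) (l : ℕ) :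
    HasContent (content (rowSet Q)) (fQ Q l) := by
  have h := (hasContent_prod_tauStep (isSecondRow_secondRow Q) (Nat.zero_le m)
    (hasContent_fT (hm := hm) l)).1
  have he : evens 0 ∪ (Finset.Icc (0 + 1) m).image (secondRow Q) = rowSet Q := by
    rw [evens, Finset.Icc_eq_empty (by omega), Finset.image_empty, Finset.empty_union]
    rfl
  rwa [he, ← tauQ_eq] at h

theorem innerPi_fQ (Q : StandardTableau (twoRow hm)) (l l' : ℕ) :
    innerPi (fQ Q l) (fQ Q l') = gammaQ Q * innerPi (fT hm l) (fT hm l') := by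
  have h := (hasContent_prod_tauStep (isSecondRow_secondRow Q) (Nat.zero_le m)
    (hasContent_fT (hm := hm) l)).2 _ (hasContent_fT (hm := hm) l')
  rwa [← tauQ_eq] at h

theorem gammaQ_ne_zero (Q : StandardTableau (twoRow hm)) : gammaQ Q ≠ 0 := by
  refine Finset.prod_ne_zero_iff.2 fun r _ => Finset.prod_ne_zero_iff.2 fun t ht => ?_
  rw [Finset.mem_Icc] at ht
  have h1 : (t : ℂ) ≠ 0 := Nat.cast_ne_zero.2 (by omega)
  have h2 : (t : ℂ) ^ 2 - 1 ≠ 0 := by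
    rw [sub_ne_zero]
    exact_mod_cast (show t ^ 2 ≠ 1 by nlinarith)
  exact div_ne_zero h2 (pow_ne_zero 2 h1)

theorem innerPi_fQ_self_ne_zero (I : Index n) : innerPi (fQ I.Q I.l) (fQ I.Q I.l) ≠ 0 := by
  rw [innerPi_fQ]
  exact mul_ne_zero (gammaQ_ne_zero I.Q) fun h => fT_ne_zero I.hm I.hl (innerPi_self_eq_zero h)

/-- Different second rows differ in some content, hence in an eigenvalue of a self-adjoint M_k.
Equal second rows force the same m and Q, and orthogonality in ℓ comes from the Hahn polynomials. -/
theorem innerPi_fQ_of_ne {I J : Index n} (h : I ≠ J) : innerPi (fQ I.Q I.l) (fQ J.Q J.l) = 0 := by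
  obtain ⟨m, hm, Q, l, hl⟩ := I
  obtain ⟨m', hm', Q', l', hl'⟩ := J
  by_cases hA : rowSet Q = rowSet Q'
  · obtain rfl : m = m' := by rw [← card_rowSet Q, hA, card_rowSet]
    obtain rfl : Q = Q' := rowSet_injective hA
    have hll : l ≠ l' := by
      rintro rfl
      exact h rfl
    change innerPi (fQ Q l) (fQ Q l') = 0
    rw [innerPi_fQ, innerPi_fT_of_ne hm hll, mul_zero]
  · by_contra hne
    refine hA (eq_of_content_eq (isBallot_rowSet Q) (isBallot_rowSet Q') (rowSet_subset Q)
      (rowSet_subset Q') fun k h1 h2 => ?_)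
    by_contra hk
    exact hne ((hasContent_fQ Q l).innerPi_eq_zero (hasContent_fQ Q' l') h1 h2 hk)

theorem linearIndependent_fQ (n : ℕ) :
    LinearIndependent ℂ (fun I : BinaryBurnside.Index n => fQ I.Q I.l) := by
  rw [linearIndependent_iff']
  intro s g hg J hJ
  have h := congrArg (innerPi (fQ J.Q J.l)) hg
  rw [innerPi_sum_right, innerPi_zero_right, Finset.sum_eq_single_of_mem J hJ, innerPi_smul_right,
    mul_eq_zero] at h
  · exact h.resolve_right (innerPi_fQ_self_ne_zero J)
  · intro I _ hI
    rw [innerPi_smul_right, innerPi_fQ_of_ne hI.symm, mul_zero]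

theorem exists_index (n : ℕ) (A : {A // A ∈ ballots n}) (l : Fin (n + 1 - 2 * A.1.card)) :
    ∃ I : BinaryBurnside.Index n, rowSet I.Q = A.1 ∧ I.l = l := by
  have h := two_mul_card_le A.2
  obtain ⟨Q, hQ⟩ := exists_rowSet_eq (hm := show A.1.card ≤ n / 2 by omega) (mem_ballots.1 A.2).2
    (mem_ballots.1 A.2).1 rfl
  exact ⟨⟨_, _, Q, l, by omega⟩, hQ, rfl⟩

theorem span_fQ (n : ℕ) :
    Submodule.span ℂ (Set.range fun I : BinaryBurnside.Index n => fQ I.Q I.l) = ⊤ := by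
  -- An injection of the pairs (ballot set, ℓ) into the indices is enough: it selects 2^n
  -- independent vectors, and their span is already everything.
  choose F hF hF' using exists_index n
  let G : (Σ A : {A // A ∈ ballots n}, Fin (n + 1 - 2 * A.1.card)) → BinaryBurnside.Index n :=
    fun p => F p.1 p.2
  have hG : Function.Injective G := by
    rintro ⟨A, l⟩ ⟨A', l'⟩ h
    have h1 : A = A' := Subtype.ext (by
      rw [← hF A l, ← hF A' l', show F A l = F A' l' from h])
    subst h1
    have h2 : l = l' := Fin.ext (by
      rw [← hF' A l, ← hF' A l', show F A l = F A l' from h])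
    rw [h2]
  have hli := (linearIndependent_fQ n).comp G hG
  have hcard : Fintype.card (Σ A : {A // A ∈ ballots n}, Fin (n + 1 - 2 * A.1.card)) =
      Module.finrank ℂ (L n) := by
    rw [Fintype.card_sigma, Module.finrank_fintype_fun_eq_card]
    simp only [Fintype.card_fin, Fintype.card_pi, Fintype.card_bool, Finset.prod_const,
      Finset.card_univ]
    rw [← sum_ballots n]
    exact Finset.sum_coe_sort (ballots n) fun A => n + 1 - 2 * A.card
  rw [eq_top_iff, ← hli.span_eq_top_of_card_eq_finrank' hcard]
  exact Submodule.span_mono (Set.range_comp_subset_range G _)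

theorem hasEigenvector_fQ (I : BinaryBurnside.Index n) :
    (burnsideOp n).HasEigenvector (burnsideEigenvalue (I.m + I.l)) (fQ I.Q I.l) := by
  refine ⟨Module.End.mem_eigenspace_iff.2 ?_, fun h => innerPi_fQ_self_ne_zero I ?_⟩
  · rw [fQ, ← Module.End.mul_apply, (burnsideOp_comm_tauQ I.Q).eq, Module.End.mul_apply,
      burnsideOp_fT, map_smul]
  · rw [h, innerPi_zero_left]

end Basis

end BinaryBurnside

theorem theorem5p2 (n : ℕ) :
    -- the operators inverted in the definition of the intertwiners are invertible
    (∀ j : ℕ, 1 ≤ j → j + 1 ≤ n → IsUnit (jm n j - jm n (j + 1))) ∧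
    -- the vectors form a basis
    LinearIndependent ℂ (fun I : BinaryBurnside.Index n => fQ I.Q I.l) ∧
    Submodule.span ℂ (Set.range fun I : BinaryBurnside.Index n => fQ I.Q I.l) = ⊤ ∧
    -- which is orthogonal
    (∀ I J : BinaryBurnside.Index n, I ≠ J → innerPi (fQ I.Q I.l) (fQ J.Q J.l) = 0) ∧
    -- and consists of eigenvectors of the transition operator
    (∀ I : BinaryBurnside.Index n,
      (burnsideOp n).HasEigenvector (if Even (I.m + I.l) then beta ((I.m + I.l) / 2) else 0)
        (fQ I.Q I.l)) ∧
    -- with the stated squared norms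
    (∀ I : BinaryBurnside.Index n,
      innerPi (fQ I.Q I.l) (fQ I.Q I.l) =
        gammaQ I.Q * innerPi (fT I.hm I.l) (fT I.hm I.l) ∧
      innerPi (fQ I.Q I.l) (fQ I.Q I.l) =
        gammaQ I.Q * (2 ^ I.m / ((n : ℂ) + 1) *
          ∑ i ∈ Finset.range (n - 2 * I.m + 1),
            (tScalar I.m n I.l i) ^ 2 *
              (((n - 2 * I.m).choose i : ℂ) / (n.choose (I.m + i) : ℂ)))) :=
  ⟨fun _ hj hjn => isUnit_jm_sub hj hjn, linearIndependent_fQ n, span_fQ n,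
    fun _ _ h => innerPi_fQ_of_ne h, hasEigenvector_fQ,
    fun I => ⟨innerPi_fQ I.Q I.l I.l, by rw [innerPi_fQ, innerPi_fT_self]⟩⟩
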